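/- Let $M,K\ge 1$ be integers and let $P\ge 0$ be a real number. For $k=1,\dots,K$ and $i=1,2,3$ let $\mathbf H_{k,i}\in\mathbb C^{2M\times M}$ be random matrices, all of whose entries (over all $k$, $i$ and all positions) are i.i.d. circularly symmetric complex Gaussian random variables with zero mean and unit variance. For a matrix $\mathbf F\in\mathbb C^{M\times 2M}$ with $\mathbf F\mathbf F^\dagger=\mathbf I_M$ put $$R_k^-(\mathbf F)=\log_2\det\Big(\mathbf I_M+\frac PM\sum_{i=2}^{3}\mathbf F\mathbf H_{k,i}\mathbf H_{k,i}^\dagger\mathbf F^\dagger\Big).$$ For $i=2,3$ let $\tilde{\mathbf H}_{k,i}\in\mathbb C^{2M\times M}$ be, almost surely, an arbitrary generator matrix of the column space of $\mathbf H_{k,i}$, that is, a matrix whose columns are orthonormal and span that space. For two $M$-dimensional subspaces $\mathcal A,\mathcal B$ of $\mathbb C^{2M}$ with principal angles $\theta_1,\dots,\theta_M\in[0,\pi/2]$ (defined recursively: $\cos\theta_m$ is the maximum of $|\mathbf a^\dagger\mathbf b|$ over unit vectors $\mathbf a\in\mathcal A$, $\mathbf b\in\mathcal B$ orthogonal to the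 maximizers $\mathbf a_n$, respectively $\mathbf b_n$, chosen at the steps $n<m$), let $d_c(\mathcal A,\mathcal B)=\big(\sum_{m=1}^M\sin^2\theta_m\big)^{1/2}$ be the chordal distance, and write $d_c(\tilde{\mathbf H}_{k,2},\tilde{\mathbf H}_{k,3})$ for the chordal distance of the column spaces. Then the minimum of $R_k^-(\mathbf F)$ over all $k\in\{1,\dots,K\}$ and all $\mathbf F$ with $\mathbf F\mathbf F^\dagger=\mathbf I_M$ is attained, both expectations below are finite, and $$\mathbb E\Big[\min_{k,\;\mathbf F\mathbf F^\dagger=\mathbf I_M}R_k^-(\mathbf F)\Big]\le\mathbb E\Big[\min_{1\le k\le K}M\log_2\Big(1+\frac PM\,d_c^2(\tilde{\mathbf H}_{k,2},\tilde{\mathbf H}_{k,3})\Big)\Big].$$ -/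

import Mathlib

open MeasureTheory ProbabilityTheory Matrix

/-- The circularly symmetric complex Gaussian law `CN(0, 1)`: independent real and imaginary
parts, each centred Gaussian of variance `1/2`. -/
noncomputable def stdComplexGaussian : Measure ℂ :=
  ((gaussianReal 0 (1 / 2)).prod (gaussianReal 0 (1 / 2))).map
    (fun p : ℝ × ℝ => (⟨p.1, p.2⟩ : ℂ))

/-- All entries of all the channel matrices `H k i` (user `k`, transmitter `i`) are i.i.d.
`CN(0, 1)` random variables. -/
structure IsIIDGaussianChannel {Ω : Type*} [MeasurableSpace Ω] (μ : Measure Ω) {K M : ℕ}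
    (H : Fin K → Fin 3 → Ω → Matrix (Fin (2 * M)) (Fin M) ℂ) : Prop where
  hasLaw : ∀ k i r c, HasLaw (fun ω => H k i ω r c) stdComplexGaussian μ
  indep : iIndepFun
    (fun (q : Fin K × Fin 3 × Fin (2 * M) × Fin M) (ω : Ω) => H q.1 q.2.1 ω q.2.2.1 q.2.2.2) μ

/-- The rate loss `log₂ det (I + (P/M) ∑ᵢ F Hᵢ Hᵢᴴ Fᴴ)`, the sum running over the interfering
transmitters, that is over the indices `1` and `2` of `Fin 3` (index `0` is the desired
transmitter). The determinant is that of a positive definite Hermitian matrix, hence a positive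
real number, which `re` reads off. -/
noncomputable def rateLoss {M : ℕ} (P : ℝ) (F : Matrix (Fin M) (Fin (2 * M)) ℂ)
    (H : Fin 3 → Matrix (Fin (2 * M)) (Fin M) ℂ) : ℝ :=
  Real.logb 2
    (1 + ((P / M : ℝ) : ℂ) • ∑ i ∈ ({1, 2} : Finset (Fin 3)), F * H i * (H i)ᴴ * Fᴴ).det.re

/-- The values of the rate loss over all users `k` and all admissible postprocessing matrices
(`F Fᴴ = I`). -/
def rateLossValues {K M : ℕ} (P : ℝ) (H : Fin K → Fin 3 → Matrix (Fin (2 * M)) (Fin M) ℂ) :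
    Set ℝ :=
  {x | ∃ (k : Fin K) (F : Matrix (Fin M) (Fin (2 * M)) ℂ), F * Fᴴ = 1 ∧ rateLoss P F (H k) = x}

/-- The subspace spanned by the columns of a matrix. -/
noncomputable def colSpan {m n : ℕ} (A : Matrix (Fin n) (Fin m) ℂ) :
    Submodule ℂ (EuclideanSpace ℂ (Fin n)) :=
  Submodule.span ℂ (Set.range fun j => WithLp.toLp 2 (fun r => A r j))

/-- `A` is a generator matrix of the subspace `S`: its columns are orthonormal and span `S`. -/
def IsGenerator {m n : ℕ} (A : Matrix (Fin n) (Fin m) ℂ)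
    (S : Submodule ℂ (EuclideanSpace ℂ (Fin n))) : Prop :=
  Aᴴ * A = 1 ∧ colSpan A = S

section PrincipalAngles

variable {E : Type*} [NormedAddCommGroup E] [InnerProductSpace ℂ E]

/-- `a`, `b` are principal vectors and `θ` the principal angles of the subspaces `A`, `B`:
recursively, `cos θₘ` is the maximum of `|⟨x, y⟩|` over unit vectors `x ∈ A`, `y ∈ B` orthogonal
to the earlier `aₙ`, respectively `bₙ`, and it is attained at `(aₘ, bₘ)`. -/
structure IsPrincipalSystem (A B : Submodule ℂ E) {M : ℕ} (a b : Fin M → E) (θ : Fin M → ℝ) :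
    Prop where
  angle_mem : ∀ m, θ m ∈ Set.Icc 0 (Real.pi / 2)
  left_mem : ∀ m, a m ∈ A
  right_mem : ∀ m, b m ∈ B
  left_norm : ∀ m, ‖a m‖ = 1
  right_norm : ∀ m, ‖b m‖ = 1
  left_orth : ∀ m n, n < m → inner ℂ (a n) (a m) = 0
  right_orth : ∀ m n, n < m → inner ℂ (b n) (b m) = 0
  cos_eq : ∀ m, Real.cos (θ m) = ‖inner ℂ (a m) (b m)‖
  le_cos : ∀ m, ∀ x ∈ A, ∀ y ∈ B, ‖x‖ = 1 → ‖y‖ = 1 →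
    (∀ n < m, inner ℂ (a n) x = 0) → (∀ n < m, inner ℂ (b n) y = 0) →
    ‖inner ℂ x y‖ ≤ Real.cos (θ m)

/-- `θ` is the list of the principal angles between `A` and `B`. -/
def ArePrincipalAngles (A B : Submodule ℂ E) {M : ℕ} (θ : Fin M → ℝ) : Prop :=
  ∃ a b : Fin M → E, IsPrincipalSystem A B a b θ

open Classical in
/-- The chordal distance `√(∑ₘ sin² θₘ)` between two `M`-dimensional subspaces, where the `θₘ` are
the principal angles. The angles exist (`exists_principalAngles`) and their choice does not matter
(`chordalDist_eq`) when both subspaces have dimension `M`. -/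
noncomputable def chordalDist (M : ℕ) (A B : Submodule ℂ E) : ℝ :=
  if h : ∃ θ : Fin M → ℝ, ArePrincipalAngles A B θ then
    √(∑ m, Real.sin (h.choose m) ^ 2)
  else 0

theorem exists_max_inner [FiniteDimensional ℂ E] (A B : Submodule ℂ E)
    (hA : A ≠ ⊥) (hB : B ≠ ⊥) :
    ∃ a ∈ A, ∃ b ∈ B, ‖a‖ = 1 ∧ ‖b‖ = 1 ∧
      ∀ x ∈ A, ∀ y ∈ B, ‖x‖ = 1 → ‖y‖ = 1 → ‖inner ℂ x y‖ ≤ ‖inner ℂ a b‖ := by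
  have : ProperSpace E := FiniteDimensional.proper ℂ E
  have key : ∀ S : Submodule ℂ E, S ≠ ⊥ →
      IsCompact ((S : Set E) ∩ Metric.sphere 0 1) ∧ ((S : Set E) ∩ Metric.sphere 0 1).Nonempty := by
    intro S hS
    refine ⟨(isCompact_sphere 0 1).inter_left S.closed_of_finiteDimensional, ?_⟩
    obtain ⟨x, hx, hx0⟩ := Submodule.exists_mem_ne_zero_of_ne_bot hS
    refine ⟨((‖x‖⁻¹ : ℝ) : ℂ) • x, S.smul_mem _ hx, ?_⟩
    simp [norm_smul, hx0]
  obtain ⟨cA, nA⟩ := key A hA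
  obtain ⟨cB, nB⟩ := key B hB
  obtain ⟨⟨a, b⟩, ⟨ha, hb⟩, hmax⟩ := (cA.prod cB).exists_isMaxOn (nA.prod nB)
    (f := fun p : E × E => ‖inner ℂ p.1 p.2‖) (by fun_prop)
  refine ⟨a, ha.1, b, hb.1, by simpa using ha.2, by simpa using hb.2, ?_⟩
  intro x hx y hy hx1 hy1
  exact hmax (show (x, y) ∈ _ from ⟨⟨hx, by simpa using hx1⟩, ⟨hy, by simpa using hy1⟩⟩)

theorem exists_principalAngles [FiniteDimensional ℂ E] (M : ℕ) : ∀ (A B : Submodule ℂ E),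
    Module.finrank ℂ A = M → Module.finrank ℂ B = M →
    ∃ θ : Fin M → ℝ, ArePrincipalAngles A B θ := by
  induction M with
  | zero =>
    intro A B _ _
    exact ⟨Fin.elim0, Fin.elim0, Fin.elim0, by constructor <;> exact fun m => m.elim0⟩
  | succ M ih =>
    intro A B hA hB
    obtain ⟨a, ha, b, hb, na, nb, hmax⟩ := exists_max_inner A B
      (by rintro rfl; simp at hA) (by rintro rfl; simp at hB)
    have key : ∀ (S : Submodule ℂ E) (v : E), v ∈ S → ‖v‖ = 1 → Module.finrank ℂ S = M + 1 →
        Module.finrank ℂ ((ℂ ∙ v)ᗮ ⊓ S : Submodule ℂ E) = M := by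
      intro S v hv nv hS
      have h := Submodule.finrank_add_inf_finrank_orthogonal
        (K₁ := (ℂ ∙ v)) (K₂ := S) ((Submodule.span_singleton_le_iff_mem v S).2 hv)
      rw [finrank_span_singleton (by rintro rfl; simp at nv), hS] at h
      omega
    obtain ⟨θ, as, bs, h⟩ := ih _ _ (key A a ha na hA) (key B b hb nb hB)
    have memA : ∀ x, x ∈ ((ℂ ∙ a)ᗮ ⊓ A : Submodule ℂ E) ↔ inner ℂ a x = 0 ∧ x ∈ A := fun x => by
      rw [Submodule.mem_inf, Submodule.mem_orthogonal_singleton_iff_inner_right]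
    have memB : ∀ x, x ∈ ((ℂ ∙ b)ᗮ ⊓ B : Submodule ℂ E) ↔ inner ℂ b x = 0 ∧ x ∈ B := fun x => by
      rw [Submodule.mem_inf, Submodule.mem_orthogonal_singleton_iff_inner_right]
    have hle : ‖inner ℂ a b‖ ≤ 1 := by simpa [na, nb] using norm_inner_le_norm (𝕜 := ℂ) a b
    have hcos : Real.cos (Real.arccos ‖inner ℂ a b‖) = ‖inner ℂ a b‖ :=
      Real.cos_arccos (by linarith [norm_nonneg (inner ℂ a b)]) hle
    refine ⟨Fin.cons (Real.arccos ‖inner ℂ a b‖) θ, Fin.cons a as, Fin.cons b bs, ?_⟩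
    constructor
    · intro m
      refine Fin.cases ?_ (fun m => ?_) m
      · exact ⟨Real.arccos_nonneg _, Real.arccos_le_pi_div_two.2 (norm_nonneg _)⟩
      · simpa using h.angle_mem m
    · intro m
      refine Fin.cases (by simpa using ha) (fun m => ?_) m
      simpa using ((memA _).1 (h.left_mem m)).2
    · intro m
      refine Fin.cases (by simpa using hb) (fun m => ?_) m
      simpa using ((memB _).1 (h.right_mem m)).2
    · intro m
      exact Fin.cases (by simpa using na) (fun m => by simpa using h.left_norm m) m
    · intro m
      exact Fin.cases (by simpa using nb) (fun m => by simpa using h.right_norm m) m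
    · intro m n
      refine Fin.cases (by simp) (fun m => ?_) m
      refine Fin.cases (fun _ => ?_) (fun n hn => ?_) n
      · simpa using ((memA _).1 (h.left_mem m)).1
      · simpa using h.left_orth m n (by simpa using hn)
    · intro m n
      refine Fin.cases (by simp) (fun m => ?_) m
      refine Fin.cases (fun _ => ?_) (fun n hn => ?_) n
      · simpa using ((memB _).1 (h.right_mem m)).1
      · simpa using h.right_orth m n (by simpa using hn)
    · intro m
      refine Fin.cases (by simpa using hcos) (fun m => by simpa using h.cos_eq m) m
    · intro m
      refine Fin.cases ?_ (fun m => ?_) m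
      · intro x hx y hy nx ny _ _
        simpa [hcos] using hmax x hx y hy nx ny
      · intro x hx y hy nx ny ox oy
        have := h.le_cos m x ((memA _).2 ⟨by simpa using ox 0 (by simp), hx⟩)
          y ((memB _).2 ⟨by simpa using oy 0 (by simp), hy⟩) nx ny
          (fun n hn => by simpa using ox n.succ (by simpa using hn))
          (fun n hn => by simpa using oy n.succ (by simpa using hn))
        simpa using this

namespace IsPrincipalSystem

variable {A B : Submodule ℂ E} {M : ℕ} {a b : Fin M → E} {θ : Fin M → ℝ}

theorem symm (h : IsPrincipalSystem A B a b θ) : IsPrincipalSystem B A b a θ where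
  angle_mem := h.angle_mem
  left_mem := h.right_mem
  right_mem := h.left_mem
  left_norm := h.right_norm
  right_norm := h.left_norm
  left_orth := h.right_orth
  right_orth := h.left_orth
  cos_eq m := by rw [h.cos_eq, norm_inner_symm]
  le_cos m x hx y hy nx ny ox oy := by
    rw [norm_inner_symm]
    exact h.le_cos m y hy x hx ny nx oy ox

theorem left_orthonormal (h : IsPrincipalSystem A B a b θ) : Orthonormal ℂ a := by
  refine ⟨h.left_norm, fun i j hij => ?_⟩
  rcases lt_or_gt_of_ne hij with hl | hl
  · exact h.left_orth j i hl
  · exact inner_eq_zero_symm.1 (h.left_orth i j hl)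

/-- Maximality at step `i` forces the later `bⱼ` to be orthogonal to `aᵢ`. -/
theorem inner_of_lt (h : IsPrincipalSystem A B a b θ) {i j : Fin M} (hij : i < j) :
    inner ℂ (a i) (b j) = 0 := by
  set x : ℂ := inner ℂ (a i) (b i) with hx
  set y : ℂ := inner ℂ (a i) (b j) with hy
  by_contra hne
  have hpos : 0 < ‖x‖ ^ 2 + ‖y‖ ^ 2 := by positivity
  set v : E := (starRingEnd ℂ x) • b i + (starRingEnd ℂ y) • b j with hv
  have hbb : inner ℂ (b i) (b j) = 0 := h.right_orth j i hij
  have hvn : ‖v‖ ^ 2 = ‖x‖ ^ 2 + ‖y‖ ^ 2 := by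
    have := norm_add_sq_eq_norm_sq_add_norm_sq_of_inner_eq_zero
      ((starRingEnd ℂ x) • b i) ((starRingEnd ℂ y) • b j)
      (by rw [inner_smul_left, inner_smul_right, hbb]; simp)
    rw [hv, sq, this]
    simp [norm_smul, h.right_norm, sq]
  have hvi : inner ℂ (a i) v = ((‖x‖ ^ 2 + ‖y‖ ^ 2 : ℝ) : ℂ) := by
    rw [hv, inner_add_right, inner_smul_right, inner_smul_right, ← hx, ← hy, Complex.conj_mul',
      Complex.conj_mul']
    push_cast; ring
  have hv0 : 0 < ‖v‖ := by
    rcases (norm_nonneg v).eq_or_lt with h0 | h0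
    · rw [← h0] at hvn; simp at hvn; linarith
    · exact h0
  have hmax := h.le_cos i (a i) (h.left_mem i) (((‖v‖⁻¹ : ℝ) : ℂ) • v)
    (B.smul_mem _ (B.add_mem (B.smul_mem _ (h.right_mem i)) (B.smul_mem _ (h.right_mem j))))
    (h.left_norm i) (by rw [norm_smul]; simp [hv0.ne'])
    (fun n hn => h.left_orth i n hn)
    (fun n hn => by
      rw [inner_smul_right, hv, inner_add_right, inner_smul_right, inner_smul_right,
        h.right_orth i n hn, h.right_orth j n (hn.trans hij)]
      simp)
  rw [h.cos_eq, inner_smul_right, hvi, ← hvn, ← hx, norm_mul, Complex.norm_real,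
    Complex.norm_real, Real.norm_of_nonneg (by positivity), Real.norm_of_nonneg (by positivity),
    sq, inv_mul_cancel_left₀ hv0.ne'] at hmax
  have hy0 : 0 < ‖y‖ := norm_pos_iff.2 hne
  nlinarith [norm_nonneg x]

theorem inner_of_ne (h : IsPrincipalSystem A B a b θ) {i j : Fin M} (hij : i ≠ j) :
    inner ℂ (a i) (b j) = 0 := by
  rcases lt_or_gt_of_ne hij with hl | hl
  · exact h.inner_of_lt hl
  · exact inner_eq_zero_symm.1 (h.symm.inner_of_lt hl)

theorem sum_cos_sq (h : IsPrincipalSystem A B a b θ) :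
    ∑ m, Real.cos (θ m) ^ 2 = ∑ i, ∑ j, ‖inner ℂ (a i) (b j)‖ ^ 2 := by
  refine Finset.sum_congr rfl fun i _ => ?_
  rw [Finset.sum_eq_single i (fun j _ hj => by rw [h.inner_of_ne hj.symm]; simp) (by simp),
    h.cos_eq]

end IsPrincipalSystem

/-- The sum of squared inner products with an orthonormal basis of `A` does not depend on the
basis. -/
theorem sum_sq_norm_inner_eq [FiniteDimensional ℂ E] {A : Submodule ℂ E} {M : ℕ}
    (hA : Module.finrank ℂ A = M) {a a' : Fin M → E} (ha : Orthonormal ℂ a)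
    (ha' : Orthonormal ℂ a') (hm : ∀ i, a i ∈ A) (hm' : ∀ i, a' i ∈ A) (x : E) :
    ∑ i, ‖inner ℂ (a i) x‖ ^ 2 = ∑ i, ‖inner ℂ (a' i) x‖ ^ 2 := by
  have key : ∀ c : Fin M → E, Orthonormal ℂ c → (∀ i, c i ∈ A) →
      ∑ i, ‖inner ℂ (c i) x‖ ^ 2 = ‖A.orthogonalProjectionOnto x‖ ^ 2 := by
    intro c hc hcm
    let c' : Fin M → A := fun i => ⟨c i, hcm i⟩
    have hc' : Orthonormal ℂ c' := by
      constructor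
      · intro i; exact hc.1 i
      · intro i j hij; exact hc.2 hij
    let bs : OrthonormalBasis (Fin M) ℂ A := OrthonormalBasis.mk hc' (by
      rw [hc'.linearIndependent.span_eq_top_of_card_eq_finrank' (by simp [hA])])
    rw [← bs.sum_sq_norm_inner_right (A.orthogonalProjectionOnto x)]
    refine Finset.sum_congr rfl fun i _ => ?_
    have : bs i = c' i := by simp [bs]
    rw [this, Submodule.coe_inner]
    have h2 := Submodule.inner_orthogonalProjectionOnto_eq_of_mem_left (K := A) (c' i) x
    rw [Submodule.coe_inner] at h2
    rw [h2]
  rw [key a ha hm, key a' ha' hm']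

/-- The chordal distance may be computed from any list of principal angles. -/
theorem chordalDist_eq [FiniteDimensional ℂ E] {A B : Submodule ℂ E} {M : ℕ}
    (hA : Module.finrank ℂ A = M) (hB : Module.finrank ℂ B = M) {θ : Fin M → ℝ}
    (hθ : ArePrincipalAngles A B θ) : chordalDist M A B = √(∑ m, Real.sin (θ m) ^ 2) := by
  have hex : ∃ θ : Fin M → ℝ, ArePrincipalAngles A B θ := ⟨θ, hθ⟩
  rw [chordalDist, dif_pos hex]
  obtain ⟨a, b, h⟩ := hθ
  obtain ⟨a', b', h'⟩ := hex.choose_spec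
  have hc : ∑ m, Real.cos (hex.choose m) ^ 2 = ∑ m, Real.cos (θ m) ^ 2 := by
    rw [h'.sum_cos_sq, h.sum_cos_sq, Finset.sum_comm]
    rw [Finset.sum_congr rfl fun j _ => sum_sq_norm_inner_eq hA h'.left_orthonormal
      h.left_orthonormal h'.left_mem h.left_mem (b' j), Finset.sum_comm]
    refine Finset.sum_congr rfl fun i _ => ?_
    have := sum_sq_norm_inner_eq hB h'.symm.left_orthonormal
      h.symm.left_orthonormal h'.right_mem h.right_mem (a i)
    simpa only [norm_inner_symm] using this
  simp only [Real.sin_sq, Finset.sum_sub_distrib, hc]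

end PrincipalAngles

/-! Fix one user and let Z = [H₂ H₃], a 2M × 2M Gaussian matrix. Taking for F the M weakest
eigenvectors of ZZ† and using concavity of the logarithm bounds the minimal rate by M log₂(1 +
(P/M)(s/M)), where s is the sum of the M smallest eigenvalues (`minRate_le`). It remains to compare
s/M with d_c² under concave nondecreasing functions φ. The intermediary is an M × M Gaussian matrix
Y: it will be shown that E φ(s/M) ≤ E φ(‖Y‖²/(2M)) ≤ E φ(d_c²).

First inequality: s is stochastically at most ‖Y‖²/2 (`lintegral_lowSum_gramEigs_le`). The
eigenvalues have the Laguerre density Δ(x)² exp(-∑x). Integrating out the M largest leaves the M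
smallest with density Δ(u)² exp(-2∑u) w(u), and w does not increase when u is scaled up
(`radialWeight_smul_le`): after a translation of the large points this is AM-GM. Without w, the sum
∑u would be distributed as ‖Y‖²/2. With w, Chebyshev's correlation inequality along each ray makes
it smaller (`lintegral_radial_correlation`).

Second inequality (`lintegral_concave_norm_sq_le`): ‖Y‖² has the law of tr((1 - Π)WW†), where W is a
2M × M Gaussian matrix and Π the projection onto an independent random subspace. Write WW† = Q S Q†
with Q an isometry and S = W†W. Since the law of Π is unitarily invariant, Q may be replaced by a
fixed isometry. As E S = 2M·I, Jensen's inequality replaces S/(2M) by I, and tr((1 - Π)QQ†) is the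
squared chordal distance.

The Laguerre law is obtained without a change of variables to eigenvalues. Integration by parts
gives the same recursion (loop equations) for the mixed trace moments of ZZ† and for the mixed power
sum moments of the Laguerre density, also with an extra factor exp(-b·trace). The recursion
determines these moments (`SatisfiesLoopEquations.map_prod_eq`), and with the exponential factors
they determine the law of the sorted eigenvalues (`chamber_measure_ext`).

Several users: min(φ, b) is again concave and nondecreasing, so the comparison holds for means
truncated at any level b. Independence then allows the users to be exchanged one at a time inside
the minimum (`lintegral_min_iInf_le`). -/

/-! ### Uniqueness of the solution of the loop equations -/

section LoopEquations

/-- Loop equations determine a linear functional on all products of the `p k`. -/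
structure SatisfiesLoopEquations {A : Type*} [CommRing A] [Algebra ℂ A] (t : ℂ) (N : ℕ)
    (p : ℕ → A) (D : ℕ → Derivation ℂ A A) (L : A →ₗ[ℂ] ℂ) : Prop where
  zero : p 0 = (N : A)
  deriv : ∀ k m, D k (p m) = (m : A) * p (m + k)
  loop : ∀ k f, t * L (p (k + 1) * f) =
    L ((∑ j ∈ Finset.range (k + 1), p j * p (k - j)) * f + D k f)

namespace SatisfiesLoopEquations

variable {A B : Type*} [CommRing A] [Algebra ℂ A] [CommRing B] [Algebra ℂ B] {t : ℂ} {N : ℕ}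
  {p : ℕ → A} {D : ℕ → Derivation ℂ A A} {L : A →ₗ[ℂ] ℂ}
  {q : ℕ → B} {E : ℕ → Derivation ℂ B B} {T : B →ₗ[ℂ] ℂ}

theorem map_natCast_mul (L : A →ₗ[ℂ] ℂ) (n : ℕ) (x : A) : L ((n : A) * x) = n * L x := by
  rw [← nsmul_eq_mul, map_nsmul, nsmul_eq_mul]

/-- By the Leibniz rule `D k` of a product is a combination of products whose total index is larger
by `k`, so the known values below degree `n` suffice. The list `u` carries the factors already
passed, which is what makes the induction on `l` close. -/
theorem map_deriv_eq (h : SatisfiesLoopEquations t N p D L) (h' : SatisfiesLoopEquations t N q E T)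
    {n k : ℕ} (ih : ∀ l : List ℕ, l.sum < n → L (l.map p).prod = T (l.map q).prod) (l : List ℕ) :
    ∀ u : List ℕ, u.sum + l.sum + k < n →
      L ((u.map p).prod * D k (l.map p).prod) = T ((u.map q).prod * E k (l.map q).prod) := by
  induction l with
  | nil => intro u _; simp
  | cons a l ihl =>
    intro u hu
    simp only [List.sum_cons] at hu
    have e1 : (u.map p).prod * D k ((a :: l).map p).prod =
        ((a :: u).map p).prod * D k (l.map p).prod +
          (a : A) * (((a + k) :: (u ++ l)).map p).prod := by
      simp only [List.map_cons, List.prod_cons, List.map_append, List.prod_append,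
        Derivation.leibniz, smul_eq_mul, h.deriv]
      ring
    have e2 : (u.map q).prod * E k ((a :: l).map q).prod =
        ((a :: u).map q).prod * E k (l.map q).prod +
          (a : B) * (((a + k) :: (u ++ l)).map q).prod := by
      simp only [List.map_cons, List.prod_cons, List.map_append, List.prod_append,
        Derivation.leibniz, smul_eq_mul, h'.deriv]
      ring
    rw [e1, e2, map_add, map_add, map_natCast_mul, map_natCast_mul,
      ihl (a :: u) (by simp only [List.sum_cons]; omega),
      ih _ (by simp only [List.sum_cons, List.sum_append]; omega)]

/-- The loop equation trades a factor of index `k + 1` for terms in which it contributes only `k` to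
the total index. Strong induction on the total index therefore reduces every value to that at `1`.
-/
theorem map_prod_eq (ht : t ≠ 0) (h : SatisfiesLoopEquations t N p D L)
    (h' : SatisfiesLoopEquations t N q E T) (h1 : L 1 = T 1) (l : List ℕ) :
    L (l.map p).prod = T (l.map q).prod := by
  suffices H : ∀ n, ∀ l : List ℕ, l.sum = n → L (l.map p).prod = T (l.map q).prod from H _ l rfl
  intro n
  induction n using Nat.strong_induction_on with
  | _ n ih =>
    intro l
    induction l with
    | nil => intro _; simpa using h1
    | cons a l ihl =>
      intro hl
      simp only [List.sum_cons] at hl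
      -- A factor of index zero is the scalar `N`. It leaves the total index unchanged but shortens
      -- the list, hence the inner induction on the list.
      rcases a with _ | k
      · simp only [List.map_cons, List.prod_cons, h.zero, h'.zero, map_natCast_mul]
        rw [ihl (by omega)]
      · have ih' : ∀ l : List ℕ, l.sum < n → L (l.map p).prod = T (l.map q).prod :=
          fun l hl => ih _ hl l rfl
        refine mul_left_cancel₀ ht ?_
        simp only [List.map_cons, List.prod_cons]
        rw [h.loop, h'.loop, map_add, map_add, Finset.sum_mul, Finset.sum_mul, map_sum, map_sum]
        congr 1
        · refine Finset.sum_congr rfl fun j hj => ?_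
          have := ih' (j :: (k - j) :: l) (by
            have := Finset.mem_range.1 hj
            simp only [List.sum_cons]; omega)
          simpa only [List.map_cons, List.prod_cons, mul_assoc] using this
        · simpa using map_deriv_eq h h' ih' l [] (k := k) (by simp; omega)

end SatisfiesLoopEquations

end LoopEquations

/-! ### Loop equations for traces of Gram matrices -/

section MatrixLoop

theorem Derivation.map_matrix_mul {R S : Type*} [CommRing R] [CommRing S] [Algebra R S]
    {l m n : Type*} [Fintype m] (D : Derivation R S S) (A : Matrix l m S) (B : Matrix m n S) :
    (A * B).map D = A.map D * B + A * B.map D := by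
  ext i j
  simp only [Matrix.map_apply, Matrix.mul_apply, Matrix.add_apply, map_sum, Derivation.leibniz,
    smul_eq_mul, Finset.sum_add_distrib]
  rw [add_comm]
  congr 1
  exact Finset.sum_congr rfl fun x _ => mul_comm _ _

variable {m n S : Type*} [Fintype m] [Fintype n] [DecidableEq m]
  [CommRing S] [Algebra ℂ S] {Z : Matrix m n S} {Y : Matrix n m S}
  {d : m → n → Derivation ℂ S S}

/-- `Z` is constant for these derivations, so Leibniz replaces one occurrence of `Y` at a time by a
matrix unit. -/
theorem map_pderiv_gram_pow [DecidableEq n] (hZ : ∀ a b, Z.map (d a b) = 0)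
    (hY : ∀ a b, Y.map (d a b) = Matrix.single b a 1) (a : m) (b : n) (k : ℕ) :
    ((Z * Y) ^ k).map (d a b) =
      ∑ j ∈ Finset.range k, (Z * Y) ^ j * Z * Matrix.single b a (1 : S) *
        (Z * Y) ^ (k - 1 - j) := by
  induction k with
  | zero =>
    ext i j
    simp only [pow_zero, Matrix.map_apply, Matrix.one_apply, Finset.range_zero, Finset.sum_empty,
      Matrix.zero_apply]
    split_ifs <;> simp
  | succ k ih =>
    rw [pow_succ, Derivation.map_matrix_mul, ih, Derivation.map_matrix_mul, hZ, hY,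
      Finset.sum_range_succ, Finset.sum_mul, Matrix.zero_mul, zero_add]
    congr 1
    · refine Finset.sum_congr rfl fun j hj => ?_
      have := Finset.mem_range.1 hj
      rw [mul_assoc, ← pow_succ]
      congr 2
      omega
    · simp [Matrix.mul_assoc]

theorem deriv_trace_gram_pow [DecidableEq n] (hZ : ∀ a b, Z.map (d a b) = 0)
    (hY : ∀ a b, Y.map (d a b) = Matrix.single b a 1) (a : m) (b : n) (k : ℕ) :
    d a b (trace ((Z * Y) ^ k)) = k * ((Z * Y) ^ (k - 1) * Z) a b := by
  have : d a b (trace ((Z * Y) ^ k)) = trace (((Z * Y) ^ k).map (d a b)) := by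
    simp [Matrix.trace, map_sum]
  rw [this, map_pderiv_gram_pow hZ hY, Matrix.trace_sum]
  rw [Finset.sum_congr rfl (g := fun _ => ((Z * Y) ^ (k - 1) * Z) a b)]
  · simp
  · intro j hj
    have := Finset.mem_range.1 hj
    rw [Matrix.trace_mul_comm, ← Matrix.mul_assoc, ← Matrix.mul_assoc, ← pow_add,
      Matrix.trace_mul_single, show k - 1 - j + j = k - 1 by omega]
    simp only [MulOpposite.op_one, one_smul]

/-- The derivation along `Y (Z Y) ^ k`. -/
noncomputable def gramDeriv (Z : Matrix m n S) (Y : Matrix n m S)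
    (d : m → n → Derivation ℂ S S) (k : ℕ) : Derivation ℂ S S :=
  ∑ a, ∑ b, (Y * (Z * Y) ^ k) b a • d a b

theorem gramDeriv_apply (k : ℕ) (f : S) :
    gramDeriv Z Y d k f = ∑ a, ∑ b, (Y * (Z * Y) ^ k) b a * d a b f := by
  simp only [gramDeriv, ← Derivation.coeFnAddMonoidHom_apply, map_sum, Finset.sum_apply]
  simp

theorem gramDeriv_trace [DecidableEq n] (hZ : ∀ a b, Z.map (d a b) = 0)
    (hY : ∀ a b, Y.map (d a b) = Matrix.single b a 1) (k r : ℕ) :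
    gramDeriv Z Y d k (trace ((Z * Y) ^ r)) = r * trace ((Z * Y) ^ (r + k)) := by
  rcases r with _ | r
  · simp
  have : trace ((Z * Y) ^ (r + 1 + k)) =
      trace (((Z * Y) ^ r * Z) * (Y * (Z * Y) ^ k)) := by
    rw [show r + 1 + k = r + (1 + k) by ring, pow_add, pow_add, pow_one]
    simp only [Matrix.mul_assoc]
  rw [this, gramDeriv_apply]
  simp only [deriv_trace_gram_pow hZ hY]
  simp only [Matrix.trace, Matrix.diag_apply, Matrix.mul_apply (M := (Z * Y) ^ r * Z),
    Finset.mul_sum]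
  refine Finset.sum_congr rfl fun a _ => Finset.sum_congr rfl fun b _ => ?_
  simp only [Nat.add_sub_cancel]
  ring

/-- This is the divergence of the field `Y (Z Y) ^ k`: differentiating one of its `Y`s cuts a cyclic
word into two, which yields products of two traces. -/
theorem sum_deriv_mul_gram_pow [DecidableEq n] (hmn : Fintype.card n = Fintype.card m)
    (hZ : ∀ a b, Z.map (d a b) = 0) (hY : ∀ a b, Y.map (d a b) = Matrix.single b a 1) (k : ℕ) :
    ∑ a : m, ∑ b : n, d a b ((Y * (Z * Y) ^ k) b a) =
      ∑ j ∈ Finset.range (k + 1), trace ((Z * Y) ^ j) * trace ((Z * Y) ^ (k - j)) := by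
  have h1 : ∀ (a : m) (b : n), d a b ((Y * (Z * Y) ^ k) b a) = ((Z * Y) ^ k) a a +
        ∑ j ∈ Finset.range k, (Y * ((Z * Y) ^ j * Z)) b b * ((Z * Y) ^ (k - 1 - j)) a a := by
    intro a b
    have h2 := congrFun (congrFun (Derivation.map_matrix_mul (d a b) Y ((Z * Y) ^ k)) b) a
    rw [Matrix.map_apply] at h2
    rw [h2, hY, map_pderiv_gram_pow hZ hY, Matrix.add_apply, Matrix.mul_sum, Matrix.sum_apply]
    congr 1
    · simp
    · refine Finset.sum_congr rfl fun j _ => ?_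
      rw [← Matrix.mul_assoc, ← Matrix.mul_assoc, Matrix.mul_apply]
      rw [Finset.sum_eq_single a]
      · simp
      · intro c _ hc
        rw [Matrix.mul_single_apply_of_ne _ _ _ _ _ hc, zero_mul]
      · simp
  simp only [h1, Finset.sum_add_distrib]
  -- The term `j = 0` comes from the leading `Y` and equals `card n` times a trace. It has the
  -- required form only because the matrix is square.
  rw [Finset.sum_range_succ', add_comm]
  congr 1
  · rw [Finset.sum_congr rfl fun a _ => Finset.sum_comm, Finset.sum_comm]
    refine Finset.sum_congr rfl fun j hj => ?_
    rw [pow_succ, show trace ((Z * Y) ^ j * (Z * Y)) = trace (Y * ((Z * Y) ^ j * Z)) by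
        rw [Matrix.trace_mul_comm Y]; simp only [Matrix.mul_assoc],
      show k - (j + 1) = k - 1 - j by omega]
    simp only [Matrix.trace, Matrix.diag_apply, Finset.sum_mul, Finset.mul_sum]
  · simp [Matrix.trace, Finset.sum_const, hmn, Finset.mul_sum]

/-- The loop equations of the trace moments of a Gaussian square matrix. -/
theorem satisfiesLoopEquations_gram [DecidableEq n] (hmn : Fintype.card n = Fintype.card m) {t : ℂ}
    (hZ : ∀ a b, Z.map (d a b) = 0) (hY : ∀ a b, Y.map (d a b) = Matrix.single b a 1)
    (L : S →ₗ[ℂ] ℂ) (hL : ∀ a b f, t * L (Z a b * f) = L (d a b f)) :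
    SatisfiesLoopEquations t (Fintype.card m) (fun k => trace ((Z * Y) ^ k))
      (gramDeriv Z Y d) L where
  zero := by simp
  deriv k r := gramDeriv_trace hZ hY k r
  loop k f := by
    have h1 : trace ((Z * Y) ^ (k + 1)) * f = ∑ a, ∑ b, Z a b *
        ((Y * (Z * Y) ^ k) b a * f) := by
      rw [pow_succ', Matrix.mul_assoc]
      simp only [Matrix.trace, Matrix.diag_apply,
        Matrix.mul_apply (M := Z), Finset.sum_mul, mul_assoc]
    rw [h1, map_sum, Finset.mul_sum]
    simp only [map_sum, Finset.mul_sum, hL, Derivation.leibniz, smul_eq_mul]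
    simp only [map_add, Finset.sum_add_distrib, ← map_sum, ← Finset.mul_sum, ← gramDeriv_apply]
    rw [sum_deriv_mul_gram_pow hmn hZ hY, mul_comm f, add_comm]

end MatrixLoop

/-! ### Loop equations for the squared Vandermonde weight -/

section LaguerreLoop

theorem Derivation.map_prod_of_dvd {R S ι : Type*} [CommRing R] [CommRing S] [Algebra R S]
    (D : Derivation R S S) (s : Finset ι) (f h : ι → S) (hf : ∀ i ∈ s, D (f i) = f i * h i) :
    D (∏ i ∈ s, f i) = (∏ i ∈ s, f i) * ∑ i ∈ s, h i := by
  classical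
  induction s using Finset.induction_on with
  | empty => simp
  | insert a s ha ih =>
    rw [Finset.prod_insert ha, Finset.sum_insert ha, Derivation.leibniz,
      ih fun i hi => hf i (Finset.mem_insert_of_mem hi), hf a (Finset.mem_insert_self _ _)]
    simp only [smul_eq_mul]
    ring

variable {N : ℕ}

variable (N) in
/-- The generic Vandermonde polynomial. -/
noncomputable def genVandermonde : MvPolynomial (Fin N) ℂ :=
  ∏ i, ∏ j ∈ Finset.Ioi i, (MvPolynomial.X j - MvPolynomial.X i)

variable (N) in
/-- The derivation `∑ X i ^ (k + 1) ∂ᵢ`. -/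
noncomputable def powDeriv (k : ℕ) :
    Derivation ℂ (MvPolynomial (Fin N) ℂ) (MvPolynomial (Fin N) ℂ) :=
  ∑ i, (MvPolynomial.X i : MvPolynomial (Fin N) ℂ) ^ (k + 1) • MvPolynomial.pderiv i

theorem powDeriv_apply (k : ℕ) (f : MvPolynomial (Fin N) ℂ) :
    powDeriv N k f = ∑ i, MvPolynomial.X i ^ (k + 1) * MvPolynomial.pderiv i f := by
  simp only [powDeriv, ← Derivation.coeFnAddMonoidHom_apply, map_sum, Finset.sum_apply]
  simp

theorem powDeriv_X (k : ℕ) (i : Fin N) :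
    powDeriv N k (MvPolynomial.X i) = MvPolynomial.X i ^ (k + 1) := by
  rw [powDeriv_apply, Finset.sum_eq_single i]
  · simp
  · intro j _ hj
    simp [MvPolynomial.pderiv_X_of_ne hj.symm]
  · simp

theorem powDeriv_psum (k r : ℕ) :
    powDeriv N k (∑ i, MvPolynomial.X i ^ r) =
      (r : MvPolynomial (Fin N) ℂ) * ∑ i, MvPolynomial.X i ^ (r + k) := by
  rw [map_sum, Finset.mul_sum]
  refine Finset.sum_congr rfl fun i _ => ?_
  rw [Derivation.leibniz_pow, powDeriv_X]
  rcases r with _ | r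
  · simp
  · simp only [smul_eq_mul, Nat.add_sub_cancel, nsmul_eq_mul]
    ring

/-- Each factor `X j - X i` divides its derivative `X j ^ (k + 1) - X i ^ (k + 1)`, with a geometric
sum as quotient. Logarithmic differentiation adds these quotients. -/
theorem powDeriv_genVandermonde (k : ℕ) :
    powDeriv N k (genVandermonde N) = genVandermonde N *
      ∑ i, ∑ j ∈ Finset.Ioi i, ∑ r ∈ Finset.range (k + 1),
        MvPolynomial.X j ^ r * MvPolynomial.X i ^ (k - r) := by
  refine Derivation.map_prod_of_dvd _ _ _ _ fun i _ =>
    Derivation.map_prod_of_dvd _ _ _ _ fun j _ => ?_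
  rw [map_sub, powDeriv_X, powDeriv_X, mul_comm]
  exact (Commute.geom_sum₂_mul (Commute.all _ _) (k + 1)).symm

/-- Expand into a double sum over points. The off-diagonal part is symmetric and matches the
logarithmic derivative of the squared Vandermonde; the diagonal part matches the divergence of the
field with components `X i ^ (k + 1)`. -/
theorem sum_psum_mul_psum (k : ℕ) :
    ∑ j ∈ Finset.range (k + 1), (∑ i : Fin N, (MvPolynomial.X i : MvPolynomial (Fin N) ℂ) ^ j) *
        (∑ i : Fin N, MvPolynomial.X i ^ (k - j)) =
      2 * (∑ i : Fin N, ∑ j ∈ Finset.Ioi i, ∑ r ∈ Finset.range (k + 1),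
        MvPolynomial.X j ^ r * MvPolynomial.X i ^ (k - r)) +
      ((k + 1 : ℕ) : MvPolynomial (Fin N) ℂ) * ∑ i : Fin N, MvPolynomial.X i ^ k := by
  let h : Fin N → Fin N → MvPolynomial (Fin N) ℂ := fun i j =>
    ∑ r ∈ Finset.range (k + 1), MvPolynomial.X j ^ r * MvPolynomial.X i ^ (k - r)
  have hsymm : ∀ i j, h i j = h j i := by
    intro i j
    simp only [h]
    rw [← Finset.sum_range_reflect]
    refine Finset.sum_congr rfl fun r hr => ?_
    have := Finset.mem_range.1 hr
    rw [mul_comm, show k + 1 - 1 - r = k - r by omega, show k - (k - r) = r by omega]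
  have h1 : ∑ j ∈ Finset.range (k + 1),
      (∑ i : Fin N, (MvPolynomial.X i : MvPolynomial (Fin N) ℂ) ^ j) *
        (∑ i : Fin N, MvPolynomial.X i ^ (k - j)) = ∑ i, ∑ j, h i j := by
    simp only [h, Finset.sum_mul_sum]
    rw [Finset.sum_comm]
    rw [Finset.sum_congr rfl fun i _ => Finset.sum_comm]
    rw [Finset.sum_comm]
  have h2 : ∀ i, ∑ j, h i j = ∑ j ∈ Finset.Ioi i, h i j + ∑ j ∈ Finset.Iio i, h i j + h i i := by
    intro i
    rw [← Finset.sum_union, ← Finset.sum_erase_add _ _ (Finset.mem_univ i)]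
    · congr 2
      ext j
      simp only [Finset.mem_erase, Finset.mem_univ, and_true, Finset.mem_union, Finset.mem_Ioi,
        Finset.mem_Iio]
      exact ⟨fun h => (lt_or_gt_of_ne h).symm, fun h => h.elim ne_of_gt ne_of_lt⟩
    · rw [Finset.disjoint_left]
      intro j hj hj'
      exact lt_asymm (Finset.mem_Ioi.1 hj) (Finset.mem_Iio.1 hj')
  have h3 : ∑ i, ∑ j ∈ Finset.Iio i, h i j = ∑ i, ∑ j ∈ Finset.Ioi i, h i j := by
    rw [Finset.sum_comm' (t' := Finset.univ) (s' := fun j => Finset.Ioi j)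
      (by intro x y; simp)]
    exact Finset.sum_congr rfl fun i _ => Finset.sum_congr rfl fun j _ => hsymm _ _
  have h4 : ∀ i, h i i = ((k + 1 : ℕ) : MvPolynomial (Fin N) ℂ) * MvPolynomial.X i ^ k := by
    intro i
    simp only [h]
    rw [Finset.sum_congr rfl (g := fun _ => MvPolynomial.X i ^ k)]
    · simp
    · intro r hr
      have := Finset.mem_range.1 hr
      rw [← pow_add]
      congr 1
      omega
  rw [h1, Finset.sum_congr rfl fun i _ => h2 i, Finset.sum_add_distrib, Finset.sum_add_distrib,
    h3, Finset.sum_congr rfl fun i _ => h4 i, ← Finset.mul_sum, two_mul]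

/-- The loop equations of the Laguerre ensemble. -/
theorem satisfiesLoopEquations_laguerre {t : ℂ} (L : MvPolynomial (Fin N) ℂ →ₗ[ℂ] ℂ)
    (hL : ∀ i f, t * L (MvPolynomial.X i * f) =
      L (MvPolynomial.pderiv i (MvPolynomial.X i * f))) :
    SatisfiesLoopEquations t N (fun k => ∑ i : Fin N, (MvPolynomial.X i) ^ k) (powDeriv N)
      (L ∘ₗ LinearMap.mulRight ℂ (genVandermonde N ^ 2)) where
  zero := by simp
  deriv k r := powDeriv_psum k r
  loop k f := by
    simp only [LinearMap.comp_apply, LinearMap.mulRight_apply]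
    have h1 : (∑ i : Fin N, (MvPolynomial.X i : MvPolynomial (Fin N) ℂ) ^ (k + 1)) * f *
        genVandermonde N ^ 2 = ∑ i, MvPolynomial.X i * (MvPolynomial.X i ^ k *
          (f * genVandermonde N ^ 2)) := by
      rw [Finset.sum_mul, Finset.sum_mul]
      exact Finset.sum_congr rfl fun i _ => by ring
    rw [h1, map_sum, Finset.mul_sum, Finset.sum_congr rfl fun i _ => hL i _, ← map_sum]
    congr 1
    have h2 : ∀ i : Fin N, MvPolynomial.pderiv i (MvPolynomial.X i * (MvPolynomial.X i ^ k *
          (f * genVandermonde N ^ 2))) = ((k + 1 : ℕ) : MvPolynomial (Fin N) ℂ) * MvPolynomial.X i ^ k *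
          (f * genVandermonde N ^ 2) + MvPolynomial.X i ^ (k + 1) *
          MvPolynomial.pderiv i (f * genVandermonde N ^ 2) := by
      intro i
      rw [← mul_assoc, ← pow_succ', Derivation.leibniz, Derivation.leibniz_pow,
        MvPolynomial.pderiv_X_self]
      simp only [smul_eq_mul, nsmul_eq_mul, Nat.add_sub_cancel]
      ring
    rw [Finset.sum_congr rfl fun i _ => h2 i, Finset.sum_add_distrib, ← powDeriv_apply,
      sum_psum_mul_psum, Derivation.leibniz, Derivation.leibniz_pow, powDeriv_genVandermonde,
      ← Finset.sum_mul, ← Finset.mul_sum]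
    simp only [smul_eq_mul, nsmul_eq_mul]
    push_cast
    ring

end LaguerreLoop

/-! ### Moments of one complex Gaussian with an exponential weight -/

section ComplexGaussian

theorem gaussianPDF_half (x : ℝ) : gaussianPDF 0 (1 / 2) x =
    ENNReal.ofReal ((√Real.pi)⁻¹ * Real.exp (-x ^ 2)) := by
  rw [gaussianPDF, gaussianPDFReal]
  have h : (2 * Real.pi * ((1 / 2 : NNReal) : ℝ)) = Real.pi := by push_cast; ring
  rw [h]
  congr 3
  simp

theorem stdComplexGaussian_eq_withDensity :
    stdComplexGaussian =
      volume.withDensity (fun z : ℂ => ENNReal.ofReal (Real.pi⁻¹ * Real.exp (-‖z‖ ^ 2))) := by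
  have hm : Measurable (fun p : ℝ × ℝ => (⟨p.1, p.2⟩ : ℂ)) :=
    Complex.measurableEquivRealProd.symm.measurable
  refine Measure.ext_of_lintegral _ fun f hf => ?_
  rw [stdComplexGaussian, lintegral_map hf hm, gaussianReal_of_var_ne_zero _ (by simp),
    prod_withDensity (measurable_gaussianPDF _ _) (measurable_gaussianPDF _ _),
    lintegral_withDensity_eq_lintegral_mul _ (by fun_prop) (by fun_prop),
    lintegral_withDensity_eq_lintegral_mul _ (by fun_prop) hf, ← Measure.volume_eq_prod,
    ← Complex.volume_preserving_equiv_real_prod.symm.lintegral_comp_emb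
      Complex.measurableEquivRealProd.symm.measurableEmbedding]
  refine lintegral_congr fun p => ?_
  simp only [Pi.mul_apply, gaussianPDF_half, Complex.measurableEquivRealProd_symm_apply]
  rw [← ENNReal.ofReal_mul (by positivity)]
  congr 2
  have h1 : ‖(⟨p.1, p.2⟩ : ℂ)‖ ^ 2 = p.1 ^ 2 + p.2 ^ 2 := by
    rw [← Complex.normSq_eq_norm_sq, Complex.normSq_mk]; ring
  have h2 : Real.pi⁻¹ = (√Real.pi)⁻¹ * (√Real.pi)⁻¹ := by
    rw [← mul_inv, Real.mul_self_sqrt Real.pi_pos.le]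
  rw [h1, h2, neg_add, Real.exp_add]
  ring

instance : IsProbabilityMeasure stdComplexGaussian := by
  rw [stdComplexGaussian]
  exact Measure.isProbabilityMeasure_map
    (Complex.measurableEquivRealProd.symm.measurable).aemeasurable

theorem integral_stdComplexGaussian {E : Type*} [NormedAddCommGroup E] [NormedSpace ℝ E]
    (f : ℂ → E) : ∫ z, f z ∂stdComplexGaussian =
      ∫ z : ℂ, (Real.pi⁻¹ * Real.exp (-‖z‖ ^ 2)) • f z := by
  rw [stdComplexGaussian_eq_withDensity,
    integral_withDensity_eq_integral_toReal_smul (by fun_prop) (by simp)]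
  refine integral_congr_ae (.of_forall fun z => ?_)
  simp only
  rw [ENNReal.toReal_ofReal (by positivity)]

theorem integral_norm_pow_gaussian (b a : ℕ) :
    ∫ z : ℂ, ‖z‖ ^ (2 * a) * Real.exp (-b * ‖z‖ ^ 2) ∂stdComplexGaussian =
      a.factorial / (1 + b : ℝ) ^ (a + 1) := by
  have h := Complex.integral_rpow_mul_exp_neg_mul_rpow (p := 2) (q := (2 * a : ℕ))
    (b := 1 + b) (by norm_num) (by
      have : (0 : ℝ) ≤ ((2 * a : ℕ) : ℝ) := by positivity
      linarith) (by positivity)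
  rw [integral_stdComplexGaussian]
  have e1 : ((2 * a : ℕ) + 2 : ℝ) / 2 = a + 1 := by push_cast; ring
  have e2 : (-((2 * a : ℕ) + 2 : ℝ)) / 2 = -((a + 1 : ℕ) : ℝ) := by push_cast; ring
  rw [e1, e2, Real.Gamma_nat_eq_factorial, Real.rpow_neg (by positivity), Real.rpow_natCast] at h
  calc _ = ∫ z : ℂ, Real.pi⁻¹ * (‖z‖ ^ ((2 * a : ℕ) : ℝ) *
        Real.exp (-(1 + b) * ‖z‖ ^ (2 : ℝ))) := by
        refine integral_congr_ae (.of_forall fun z => ?_)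
        simp only [smul_eq_mul]
        rw [Real.rpow_natCast, Real.rpow_two,
          show -(1 + (b : ℝ)) * ‖z‖ ^ 2 = -‖z‖ ^ 2 + -b * ‖z‖ ^ 2 by ring, Real.exp_add]
        ring
    _ = _ := by
        rw [integral_const_mul, h]
        field_simp

theorem integrable_norm_pow_gaussian (b a : ℕ) :
    Integrable (fun z : ℂ => ‖z‖ ^ a * Real.exp (-b * ‖z‖ ^ 2)) stdComplexGaussian := by
  -- A nonzero integral certifies integrability, since the integral of a nonintegrable function is
  -- zero by convention. Odd powers are then dominated by `1 + ‖z‖ ^ (2 * a)`.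
  have h : ∀ c : ℕ, Integrable (fun z : ℂ => ‖z‖ ^ (2 * c) * Real.exp (-b * ‖z‖ ^ 2))
      stdComplexGaussian := fun c => .of_integral_ne_zero (by
    rw [integral_norm_pow_gaussian]; positivity)
  refine Integrable.mono' ((h 0).add (h a)) (by fun_prop) (.of_forall fun z => ?_)
  rw [Real.norm_of_nonneg (by positivity)]
  simp only [Pi.add_apply, mul_zero, pow_zero, ← add_mul]
  gcongr
  rcases le_total ‖z‖ 1 with h1 | h1
  · have := pow_le_one₀ (n := a) (norm_nonneg z) h1
    have : 0 ≤ ‖z‖ ^ (2 * a) := by positivity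
    linarith
  · have := pow_le_pow_right₀ h1 (show a ≤ 2 * a by omega)
    linarith

/-- The mixed moments of a complex Gaussian with weight `exp (-b |z|²)`. -/
noncomputable def mixedMoment (b α β : ℕ) : ℂ :=
  ∫ z : ℂ, z ^ α * (starRingEnd ℂ z) ^ β * (Real.exp (-b * ‖z‖ ^ 2) : ℂ) ∂stdComplexGaussian

theorem integrable_mixedMoment (b α β : ℕ) :
    Integrable (fun z : ℂ => z ^ α * (starRingEnd ℂ z) ^ β * (Real.exp (-b * ‖z‖ ^ 2) : ℂ))
      stdComplexGaussian := by
  refine (integrable_norm_pow_gaussian b (α + β)).mono' ?_ (.of_forall fun z => ?_)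
  · exact (by fun_prop : Continuous fun z : ℂ => z ^ α * (starRingEnd ℂ z) ^ β *
      (Real.exp (-b * ‖z‖ ^ 2) : ℂ)).aestronglyMeasurable
  · rw [norm_mul, norm_mul, norm_pow, norm_pow, RCLike.norm_conj, Complex.norm_real,
      Real.norm_of_nonneg (Real.exp_pos _).le, pow_add]

theorem mixedMoment_self (b a : ℕ) :
    mixedMoment b a a = a.factorial / (1 + b : ℂ) ^ (a + 1) := by
  have : mixedMoment b a a =
      ((∫ z : ℂ, ‖z‖ ^ (2 * a) * Real.exp (-b * ‖z‖ ^ 2) ∂stdComplexGaussian : ℝ) : ℂ) := by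
    rw [mixedMoment, ← integral_complex_ofReal]
    refine integral_congr_ae (.of_forall fun z => ?_)
    simp only
    rw [← mul_pow, Complex.mul_conj', ← pow_mul]
    push_cast
    rfl
  rw [this, integral_norm_pow_gaussian]
  push_cast
  rfl

/-- Rotation by the angle π/(α - β) preserves Lebesgue measure and the radial weights and changes
the sign of the integrand. -/
theorem mixedMoment_of_ne (b : ℕ) {α β : ℕ} (h : α ≠ β) : mixedMoment b α β = 0 := by
  set f : ℂ → ℂ := fun z => ((Real.pi⁻¹ * Real.exp (-‖z‖ ^ 2) : ℝ) : ℂ) * (z ^ α *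
    (starRingEnd ℂ z) ^ β * (Real.exp (-b * ‖z‖ ^ 2) : ℂ)) with hf
  have hI : mixedMoment b α β = ∫ z, f z := by
    rw [mixedMoment, integral_stdComplexGaussian]
    simp only [hf, Complex.real_smul]
  have hd : ((α : ℝ) - β) ≠ 0 := sub_ne_zero.2 (by exact_mod_cast h)
  set c : Circle := Circle.exp (Real.pi / (α - β)) with hc
  have hrot : ∀ z, f (rotation c z) = -f z := by
    intro z
    have hn : ‖rotation c z‖ = ‖z‖ := (rotation c).norm_map z
    have hcc : (c : ℂ) ^ α * (starRingEnd ℂ (c : ℂ)) ^ β = -1 := by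
      rw [hc, Circle.coe_exp, ← Complex.exp_conj, ← Complex.exp_nat_mul, ← Complex.exp_nat_mul,
        ← Complex.exp_add, ← Complex.exp_pi_mul_I]
      congr 1
      have hd' : ((α : ℂ) - β) ≠ 0 := by exact_mod_cast hd
      simp only [map_mul, Complex.conj_ofReal, Complex.conj_I]
      push_cast
      field_simp
      ring
    simp only [hf, hn]
    simp only [rotation_apply, map_mul, mul_pow]
    linear_combination (((Real.pi⁻¹ * Real.exp (-‖z‖ ^ 2) : ℝ) : ℂ) * z ^ α *
      (starRingEnd ℂ z) ^ β * (Real.exp (-b * ‖z‖ ^ 2) : ℂ)) * hcc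
  have h1 : ∫ z, f z = -∫ z, f z := by
    conv_lhs => rw [← (rotation c).measurePreserving.integral_comp
      (rotation c).toHomeomorph.measurableEmbedding]
    simp only [hrot, integral_neg]
  rw [hI]
  exact self_eq_neg.1 h1

/-- Gaussian integration by parts in the conjugate variable, read off from the explicit moments. The
truncated `β - 1` is harmless at `β = 0`, where its coefficient vanishes. -/
theorem mixedMoment_succ (b α β : ℕ) :
    (1 + b : ℂ) * mixedMoment b (α + 1) β = β * mixedMoment b α (β - 1) := by
  have hb : (1 + b : ℂ) ≠ 0 := by
    have : ((1 + b : ℕ) : ℂ) ≠ 0 := Nat.cast_ne_zero.2 (by omega)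
    exact_mod_cast this
  rcases β with _ | β
  · rw [mixedMoment_of_ne b (by omega)]; simp
  · by_cases h : α = β
    · subst h
      rw [Nat.add_sub_cancel, mixedMoment_self, mixedMoment_self, Nat.factorial_succ]
      push_cast
      field_simp
      ring
    · rw [Nat.add_sub_cancel, mixedMoment_of_ne b (by omega), mixedMoment_of_ne b h]; simp

end ComplexGaussian

/-! ### Gaussian integration by parts for polynomials in the entries and their conjugates -/

section MatrixFunctional

variable {ι : Type*} [Fintype ι]

variable (ι) in
/-- Independent standard complex Gaussians. -/
noncomputable abbrev gaussPi : Measure (ι → ℂ) := Measure.pi fun _ : ι => stdComplexGaussian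

/-- The value of a polynomial in the entries and their conjugates. -/
noncomputable def conjEval (z : ι → ℂ) (f : MvPolynomial (ι ⊕ ι) ℂ) : ℂ :=
  MvPolynomial.eval (Sum.elim z fun i => starRingEnd ℂ (z i)) f

theorem conjEval_monomial (b : ℕ) (z : ι → ℂ) (s : ι ⊕ ι →₀ ℕ) (c : ℂ) :
    conjEval z (MvPolynomial.monomial s c) * (Real.exp (-b * ∑ i, ‖z i‖ ^ 2) : ℂ) =
      c * ∏ i, (z i ^ s (Sum.inl i) * (starRingEnd ℂ (z i)) ^ s (Sum.inr i) *
        (Real.exp (-b * ‖z i‖ ^ 2) : ℂ)) := by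
  rw [conjEval, MvPolynomial.eval_monomial, Finsupp.prod_fintype _ _ (by simp),
    Fintype.prod_sum_type, Finset.mul_sum, Real.exp_sum, Finset.prod_mul_distrib,
    Finset.prod_mul_distrib]
  push_cast
  simp [mul_assoc]

theorem integrable_conjEval (b : ℕ) (f : MvPolynomial (ι ⊕ ι) ℂ) :
    Integrable (fun z : ι → ℂ => conjEval z f * (Real.exp (-b * ∑ i, ‖z i‖ ^ 2) : ℂ))
      (gaussPi ι) := by
  induction f using MvPolynomial.induction_on' with
  | monomial s c =>
    simp only [conjEval_monomial]
    refine Integrable.const_mul ?_ c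
    exact Integrable.fintype_prod (f := fun i z => z ^ s (Sum.inl i) *
      (starRingEnd ℂ z) ^ s (Sum.inr i) * (Real.exp (-b * ‖z‖ ^ 2) : ℂ))
      fun i => integrable_mixedMoment b _ _
  | add p q hp hq =>
    refine (hp.add hq).congr (.of_forall fun z => ?_)
    simp [conjEval, add_mul]

/-- The expectation functional with weight `exp (-b ∑ |z i|²)`. -/
noncomputable def gaussFunctional (ι : Type*) [Fintype ι] (b : ℕ) :
    MvPolynomial (ι ⊕ ι) ℂ →ₗ[ℂ] ℂ where
  toFun f := ∫ z, conjEval z f * (Real.exp (-b * ∑ i, ‖z i‖ ^ 2) : ℂ) ∂gaussPi ι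
  map_add' f g := by
    rw [← integral_add (integrable_conjEval b f) (integrable_conjEval b g)]
    simp [conjEval, add_mul]
  map_smul' c f := by
    rw [RingHom.id_apply, smul_eq_mul, ← integral_const_mul]
    simp [conjEval, mul_assoc, MvPolynomial.smul_eval]

theorem gaussFunctional_monomial (b : ℕ) (s : ι ⊕ ι →₀ ℕ) (c : ℂ) :
    gaussFunctional ι b (MvPolynomial.monomial s c) =
      c * ∏ i, mixedMoment b (s (Sum.inl i)) (s (Sum.inr i)) := by
  simp only [gaussFunctional, LinearMap.coe_mk, AddHom.coe_mk, conjEval_monomial]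
  rw [integral_const_mul, integral_fintype_prod_eq_prod (f := fun i z => z ^ s (Sum.inl i) *
      (starRingEnd ℂ z) ^ s (Sum.inr i) * (Real.exp (-b * ‖z‖ ^ 2) : ℂ))]
  rfl

theorem gaussFunctional_one (b : ℕ) :
    gaussFunctional ι b 1 = ((1 + b : ℂ)⁻¹) ^ Fintype.card ι := by
  rw [← MvPolynomial.C_1, ← MvPolynomial.monomial_zero', gaussFunctional_monomial]
  simp [mixedMoment_self]

/-- On monomials the functional factors over coordinates, so this is the one-variable identity in
coordinate `i`. It provides the hypothesis of the loop equations with `t = 1 + b`. -/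
theorem gaussFunctional_X_mul [DecidableEq ι] (b : ℕ) (i : ι) (f : MvPolynomial (ι ⊕ ι) ℂ) :
    (1 + b : ℂ) * gaussFunctional ι b (MvPolynomial.X (Sum.inl i) * f) =
      gaussFunctional ι b (MvPolynomial.pderiv (Sum.inr i) f) := by
  induction f using MvPolynomial.induction_on' with
  | add p q hp hq => rw [mul_add, map_add, map_add, map_add, mul_add, hp, hq]
  | monomial s c =>
    rw [mul_comm (MvPolynomial.X _), show MvPolynomial.monomial s c * MvPolynomial.X (Sum.inl i) =
      MvPolynomial.monomial (s + Finsupp.single (Sum.inl i) 1) c by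
        rw [MvPolynomial.monomial_add_single, pow_one], MvPolynomial.pderiv_monomial,
      gaussFunctional_monomial, gaussFunctional_monomial,
      ← Finset.mul_prod_erase _ _ (Finset.mem_univ i),
      ← Finset.mul_prod_erase (a := i) (s := Finset.univ) (f := fun j => mixedMoment b
        ((s - Finsupp.single (Sum.inr i) 1 : ι ⊕ ι →₀ ℕ) (Sum.inl j)) _) (Finset.mem_univ i)]
    have h1 : ∏ j ∈ Finset.univ.erase i, mixedMoment b
        ((s + Finsupp.single (Sum.inl i) 1 : ι ⊕ ι →₀ ℕ) (Sum.inl j))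
        ((s + Finsupp.single (Sum.inl i) 1 : ι ⊕ ι →₀ ℕ) (Sum.inr j)) =
        ∏ j ∈ Finset.univ.erase i, mixedMoment b
        ((s - Finsupp.single (Sum.inr i) 1 : ι ⊕ ι →₀ ℕ) (Sum.inl j))
        ((s - Finsupp.single (Sum.inr i) 1 : ι ⊕ ι →₀ ℕ) (Sum.inr j)) := by
      refine Finset.prod_congr rfl fun j hj => ?_
      have hne := Finset.ne_of_mem_erase hj
      simp [hne.symm]
    have h2 := mixedMoment_succ b (s (Sum.inl i)) (s (Sum.inr i))
    rw [h1]
    generalize ∏ j ∈ Finset.univ.erase i, mixedMoment b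
        ((s - Finsupp.single (Sum.inr i) 1 : ι ⊕ ι →₀ ℕ) (Sum.inl j))
        ((s - Finsupp.single (Sum.inr i) 1 : ι ⊕ ι →₀ ℕ) (Sum.inr j)) = R
    simp only [Finsupp.coe_add, Finsupp.coe_tsub, Pi.add_apply, Pi.sub_apply,
      Finsupp.single_eq_same, Finsupp.single_apply, reduceCtorEq, if_false, add_zero, tsub_zero]
    linear_combination c * R * h2

end MatrixFunctional

/-! ### Exponential integrals over the positive orthant -/

section LaguerreFunctional

theorem integral_pow_mul_exp_Ioi {t : ℝ} (ht : 0 < t) (a : ℕ) :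
    ∫ x in Set.Ioi (0 : ℝ), x ^ a * Real.exp (-t * x) = a.factorial / t ^ (a + 1) := by
  have h := Real.integral_rpow_mul_exp_neg_mul_Ioi (a := a + 1) (r := t) (by positivity) ht
  rw [Real.Gamma_nat_eq_factorial] at h
  have e : ((1 / t) ^ ((a : ℝ) + 1)) = 1 / t ^ (a + 1) := by
    rw [show ((a : ℝ) + 1) = ((a + 1 : ℕ) : ℝ) by push_cast; rfl, Real.rpow_natCast, div_pow,
      one_pow]
  rw [e] at h
  calc _ = ∫ x in Set.Ioi (0 : ℝ), x ^ ((a : ℝ) + 1 - 1) * Real.exp (-(t * x)) := by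
        refine setIntegral_congr_fun measurableSet_Ioi fun x hx => ?_
        simp only [add_sub_cancel_right, Real.rpow_natCast, neg_mul]
    _ = _ := by rw [h]; ring

/-- One-dimensional exponential moments, as complex numbers. -/
theorem integral_ofReal_pow_mul_exp_Ioi {t : ℝ} (ht : 0 < t) (a : ℕ) :
    ∫ x in Set.Ioi (0 : ℝ), (x : ℂ) ^ a * (Real.exp (-t * x) : ℂ) =
      a.factorial / (t : ℂ) ^ (a + 1) := by
  have := congrArg ((↑) : ℝ → ℂ) (integral_pow_mul_exp_Ioi ht a)
  rw [← integral_complex_ofReal] at this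
  push_cast at this ⊢
  exact this

theorem integrable_ofReal_pow_mul_exp_Ioi {t : ℝ} (ht : 0 < t) (a : ℕ) :
    Integrable (fun x : ℝ => (x : ℂ) ^ a * (Real.exp (-t * x) : ℂ))
      (volume.restrict (Set.Ioi 0)) := by
  refine .of_integral_ne_zero ?_
  rw [integral_ofReal_pow_mul_exp_Ioi ht]
  have : (t : ℂ) ≠ 0 := by exact_mod_cast ht.ne'
  have : (a.factorial : ℂ) ≠ 0 := by exact_mod_cast a.factorial_ne_zero
  positivity

/-- Lebesgue measure on the open positive orthant. -/
noncomputable abbrev orthant (ι : Type*) [Fintype ι] : Measure (ι → ℝ) :=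
  Measure.pi fun _ => volume.restrict (Set.Ioi 0)

variable {N : ℕ}

/-- The value of a complex polynomial at a real point. -/
noncomputable def realEval (x : Fin N → ℝ) (f : MvPolynomial (Fin N) ℂ) : ℂ :=
  MvPolynomial.eval (fun i => (x i : ℂ)) f

theorem realEval_monomial (t : ℝ) (x : Fin N → ℝ) (s : Fin N →₀ ℕ) (c : ℂ) :
    realEval x (MvPolynomial.monomial s c) * (Real.exp (-t * ∑ i, x i) : ℂ) =
      c * ∏ i, ((x i : ℂ) ^ s i * (Real.exp (-t * x i) : ℂ)) := by
  rw [realEval, MvPolynomial.eval_monomial, Finsupp.prod_fintype _ _ (by simp),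
    Finset.mul_sum, Real.exp_sum, Finset.prod_mul_distrib]
  push_cast
  simp [mul_assoc]

theorem integrable_realEval {t : ℝ} (ht : 0 < t) (f : MvPolynomial (Fin N) ℂ) :
    Integrable (fun x : Fin N → ℝ => realEval x f * (Real.exp (-t * ∑ i, x i) : ℂ))
      (orthant (Fin N)) := by
  induction f using MvPolynomial.induction_on' with
  | monomial s c =>
    simp only [realEval_monomial]
    refine Integrable.const_mul ?_ c
    exact Integrable.fintype_prod (f := fun i (x : ℝ) => (x : ℂ) ^ s i *
      (Real.exp (-t * x) : ℂ)) fun i => integrable_ofReal_pow_mul_exp_Ioi ht _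
  | add p q hp hq =>
    refine (hp.add hq).congr (.of_forall fun z => ?_)
    simp [realEval, add_mul]

/-- Integration against `exp (-t ∑ x i)` over the positive orthant. -/
noncomputable def expFunctional (N : ℕ) {t : ℝ} (ht : 0 < t) :
    MvPolynomial (Fin N) ℂ →ₗ[ℂ] ℂ where
  toFun f := ∫ x, realEval x f * (Real.exp (-t * ∑ i, x i) : ℂ) ∂orthant (Fin N)
  map_add' f g := by
    rw [← integral_add (integrable_realEval ht f) (integrable_realEval ht g)]
    simp [realEval, add_mul]
  map_smul' c f := by
    rw [RingHom.id_apply, smul_eq_mul, ← integral_const_mul]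
    simp [realEval, mul_assoc, MvPolynomial.smul_eval]

theorem expFunctional_monomial {t : ℝ} (ht : 0 < t) (s : Fin N →₀ ℕ) (c : ℂ) :
    expFunctional N ht (MvPolynomial.monomial s c) =
      c * ∏ i, ((s i).factorial / (t : ℂ) ^ (s i + 1)) := by
  simp only [expFunctional, LinearMap.coe_mk, AddHom.coe_mk, realEval_monomial]
  rw [integral_const_mul, integral_fintype_prod_eq_prod (f := fun i (x : ℝ) => (x : ℂ) ^ s i *
      (Real.exp (-t * x) : ℂ))]
  simp only [integral_ofReal_pow_mul_exp_Ioi ht]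

/-- Integration by parts against the exponential; the factor `X i` removes the boundary term at
zero. On monomials it is the recursion of the factorial. -/
theorem expFunctional_X_mul {t : ℝ} (ht : 0 < t) (i : Fin N) (f : MvPolynomial (Fin N) ℂ) :
    (t : ℂ) * expFunctional N ht (MvPolynomial.X i * f) =
      expFunctional N ht (MvPolynomial.pderiv i (MvPolynomial.X i * f)) := by
  have ht' : (t : ℂ) ≠ 0 := by exact_mod_cast ht.ne'
  induction f using MvPolynomial.induction_on' with
  | add p q hp hq => simp only [mul_add, map_add, hp, hq]
  | monomial s c =>
    rw [mul_comm (MvPolynomial.X _), show MvPolynomial.monomial s c * MvPolynomial.X i =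
      MvPolynomial.monomial (s + Finsupp.single i 1) c by
        rw [MvPolynomial.monomial_add_single, pow_one], MvPolynomial.pderiv_monomial,
      add_tsub_cancel_right,
      expFunctional_monomial, expFunctional_monomial,
      ← Finset.mul_prod_erase _ _ (Finset.mem_univ i),
      ← Finset.mul_prod_erase (a := i) (s := Finset.univ) (f := fun j => _ / _)
        (Finset.mem_univ i)]
    have h1 : ∏ j ∈ Finset.univ.erase i, ((((s + Finsupp.single i 1 : Fin N →₀ ℕ) j).factorial : ℂ)
        / (t : ℂ) ^ ((s + Finsupp.single i 1 : Fin N →₀ ℕ) j + 1)) =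
        ∏ j ∈ Finset.univ.erase i, (((s j).factorial : ℂ) / (t : ℂ) ^ (s j + 1)) := by
      refine Finset.prod_congr rfl fun j hj => ?_
      have hne := Finset.ne_of_mem_erase hj
      simp [hne.symm]
    rw [h1]
    generalize ∏ j ∈ Finset.univ.erase i, (((s j).factorial : ℂ) / (t : ℂ) ^ (s j + 1)) = R
    simp only [Finsupp.coe_add, Pi.add_apply, Finsupp.single_eq_same, Nat.factorial_succ]
    push_cast
    field_simp
    ring

/-- The scaling `x ↦ x / t`: the exponent `d` comes from the polynomial and `N` from Lebesgue
measure. -/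
theorem expFunctional_of_isHomogeneous {t : ℝ} (ht : 0 < t) {f : MvPolynomial (Fin N) ℂ} {d : ℕ}
    (hf : f.IsHomogeneous d) :
    (t : ℂ) ^ (d + N) * expFunctional N ht f = expFunctional N one_pos f := by
  have ht' : (t : ℂ) ≠ 0 := by exact_mod_cast ht.ne'
  rw [MvPolynomial.as_sum f, map_sum, map_sum, Finset.mul_sum]
  refine Finset.sum_congr rfl fun s hs => ?_
  have hd : s.degree = d := by
    rw [Finsupp.degree_eq_weight_one]
    exact hf (MvPolynomial.mem_support_iff.1 hs)
  have hd' : ∑ i, (s i + 1) = d + N := by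
    rw [Finset.sum_add_distrib, ← hd, Finsupp.degree_eq_sum]
    simp
  rw [expFunctional_monomial, expFunctional_monomial, Finset.prod_div_distrib,
    Finset.prod_div_distrib, Finset.prod_pow_eq_pow_sum, hd']
  simp only [Complex.ofReal_one, one_pow, Finset.prod_const_one, div_one]
  field_simp

theorem isHomogeneous_genVandermonde_sq :
    (genVandermonde N ^ 2).IsHomogeneous (∑ i : Fin N, (Finset.Ioi i).card * 2) := by
  rw [← Finset.sum_mul]
  refine MvPolynomial.IsHomogeneous.pow ?_ 2
  refine MvPolynomial.IsHomogeneous.prod _ _ _ fun i _ => ?_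
  have := MvPolynomial.IsHomogeneous.prod (Finset.Ioi i)
    (fun j => (MvPolynomial.X j - MvPolynomial.X i : MvPolynomial (Fin N) ℂ)) (fun _ => 1)
    fun j _ => (MvPolynomial.isHomogeneous_X _ _).sub (MvPolynomial.isHomogeneous_X _ _)
  simpa using this

theorem sum_card_Ioi_add : ∑ i : Fin N, (Finset.Ioi i).card * 2 + N = N * N := by
  rw [← Finset.sum_mul]
  simp only [Fin.card_Ioi]
  rw [Fin.sum_univ_eq_sum_range (fun i => N - 1 - i) N, Finset.sum_range_reflect (fun i => i) N,
    Finset.sum_range_id_mul_two]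
  rcases N with _ | N
  · rfl
  · simp; ring

end LaguerreFunctional

/-! ### Equality of the trace moments and the Laguerre moments -/

section MomentIdentity

variable {N : ℕ} {m n : Type*} [Fintype m] [Fintype n] [DecidableEq m] [DecidableEq n]

/-- The squared Vandermonde determinant. -/
noncomputable def vandermondeSq (x : Fin N → ℝ) : ℝ :=
  (∏ i, ∏ j ∈ Finset.Ioi i, (x j - x i)) ^ 2

variable (N) in
/-- The total mass of the Laguerre ensemble. -/
noncomputable def laguerreMass : ℝ :=
  ∫ x, vandermondeSq x * Real.exp (-∑ i, x i) ∂orthant (Fin N)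

theorem realEval_genVandermonde_sq (x : Fin N → ℝ) :
    realEval x (genVandermonde N ^ 2) = (vandermondeSq x : ℂ) := by
  simp [realEval, genVandermonde, vandermondeSq, map_prod]

theorem integrable_laguerreDensity :
    Integrable (fun x : Fin N → ℝ => vandermondeSq x * Real.exp (-∑ i, x i))
      (orthant (Fin N)) := by
  have := (integrable_realEval one_pos (genVandermonde N ^ 2)).re
  refine this.congr (.of_forall fun x => ?_)
  simp only [realEval_genVandermonde_sq, neg_mul, one_mul]
  rw [← Complex.ofReal_mul]
  exact Complex.ofReal_re _

/-- The exponent is also the number of entries of the Gaussian matrix, so both functionals depend on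
`t` in the same way at the constant polynomial. One normalising constant thus serves for all
weights. -/
theorem expFunctional_genVandermonde_sq {t : ℝ} (ht : 0 < t) :
    (t : ℂ) ^ (N * N) * expFunctional N ht (genVandermonde N ^ 2) = laguerreMass N := by
  rw [← sum_card_Ioi_add, expFunctional_of_isHomogeneous ht isHomogeneous_genVandermonde_sq,
    laguerreMass, ← integral_complex_ofReal]
  simp only [expFunctional, LinearMap.coe_mk, AddHom.coe_mk, realEval_genVandermonde_sq]
  refine integral_congr_ae (.of_forall fun x => ?_)
  simp

/-- On the box of the intervals (i, i + 1) the coordinates are positive and strictly ordered, so the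
density is positive there. -/
theorem laguerreMass_pos : 0 < laguerreMass N := by
  have hnn : ∀ x : Fin N → ℝ, 0 ≤ vandermondeSq x * Real.exp (-∑ i, x i) := fun x => by
    unfold vandermondeSq; positivity
  rw [laguerreMass, integral_pos_iff_support_of_nonneg hnn integrable_laguerreDensity]
  have hsub : (Set.univ.pi fun i : Fin N => Set.Ioo (i : ℝ) (i + 1)) ⊆
      Function.support fun x : Fin N → ℝ => vandermondeSq x * Real.exp (-∑ i, x i) := by
    intro x hx
    have hx' : ∀ i : Fin N, (i : ℝ) < x i ∧ x i < i + 1 := fun i => hx i (Set.mem_univ i)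
    rw [Function.mem_support]
    refine (mul_pos (pow_pos (Finset.prod_pos fun i _ => Finset.prod_pos fun j hj => ?_) 2)
      (Real.exp_pos _)).ne'
    have h1 : (i : ℕ) + 1 ≤ j := Finset.mem_Ioi.1 hj
    have h2 : ((i : ℕ) : ℝ) + 1 ≤ (j : ℕ) := by exact_mod_cast h1
    linarith [(hx' i).2, (hx' j).1]
  refine lt_of_lt_of_le ?_ (measure_mono hsub)
  rw [Measure.pi_pi]
  refine pos_iff_ne_zero.2 (Finset.prod_ne_zero_iff.2 fun i _ => ?_)
  have hs : Set.Ioo (i : ℝ) (i + 1) ⊆ Set.Ioi 0 := fun y hy =>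
    lt_of_le_of_lt (Nat.cast_nonneg _) hy.1
  rw [Measure.restrict_apply measurableSet_Ioo, Set.inter_eq_left.2 hs]
  simp

/-- The matrix with the entries of a family indexed by pairs. -/
def toMatrix (z : m × n → ℂ) : Matrix m n ℂ := Matrix.of fun a b => z (a, b)

/-- All mixed trace moments of a square Gaussian matrix are those of the Laguerre ensemble. -/
theorem laguerreMass_mul_integral_trace (hm : Fintype.card m = N) (hn : Fintype.card n = N)
    (b : ℕ) (l : List ℕ) :
    (laguerreMass N : ℂ) * ∫ z : m × n → ℂ,
      (l.map fun k => trace ((toMatrix z * (toMatrix z)ᴴ) ^ k)).prod *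
        (Real.exp (-b * ∑ i, ‖z i‖ ^ 2) : ℂ) ∂gaussPi (m × n) =
    ∫ x : Fin N → ℝ, (l.map fun k => ∑ i, (x i : ℂ) ^ k).prod *
      ((vandermondeSq x * Real.exp (-(1 + b) * ∑ i, x i) : ℝ) : ℂ) ∂orthant (Fin N) := by
  have hb : (0 : ℝ) < 1 + b := by positivity
  have hbc : ((1 + b : ℝ) : ℂ) ≠ 0 := by exact_mod_cast hb.ne'
  -- The entries and their conjugates are treated as independent variables; `Y` stands for the
  -- conjugate transpose of `Z`.
  let Z : Matrix m n (MvPolynomial ((m × n) ⊕ (m × n)) ℂ) := Matrix.of fun a b => MvPolynomial.X (Sum.inl (a, b))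
  let Y : Matrix n m (MvPolynomial ((m × n) ⊕ (m × n)) ℂ) := Matrix.of fun b a => MvPolynomial.X (Sum.inr (a, b))
  let d : m → n →
    Derivation ℂ (MvPolynomial ((m × n) ⊕ (m × n)) ℂ) (MvPolynomial ((m × n) ⊕ (m × n)) ℂ) := fun a b => MvPolynomial.pderiv (Sum.inr (a, b))
  have hZ : ∀ a b, Z.map (d a b) = 0 := by
    intro a b
    ext1 i j
    simp [Z, d, MvPolynomial.pderiv_X]
  have hY : ∀ a b, Y.map (d a b) = Matrix.single b a 1 := by
    intro a b
    ext1 i j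
    simp only [Y, d, Matrix.map_apply, Matrix.of_apply, MvPolynomial.pderiv_X,
      Matrix.single_apply, Pi.single_apply, Sum.inr.injEq, Prod.mk.injEq]
    refine if_congr ?_ rfl rfl
    constructor <;> rintro ⟨rfl, rfl⟩ <;> exact ⟨rfl, rfl⟩
  have hmat := satisfiesLoopEquations_gram (hn.trans hm.symm) (t := ((1 + b : ℝ) : ℂ)) hZ hY
    ((laguerreMass N : ℂ) • gaussFunctional (m × n) b) (by
      intro a c f
      have := gaussFunctional_X_mul b (a, c) f
      simp only [Z, d, LinearMap.smul_apply, smul_eq_mul, Matrix.of_apply, ← this]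
      push_cast
      ring)
  rw [hm] at hmat
  have hlag := satisfiesLoopEquations_laguerre (N := N) (t := ((1 + b : ℝ) : ℂ))
    (expFunctional N hb) (expFunctional_X_mul hb)
  -- Both functionals satisfy the same loop equations, so only their values at `1` need to be
  -- matched.
  have key := hmat.map_prod_eq hbc hlag (by
    have h1 := expFunctional_genVandermonde_sq (N := N) hb
    simp only [LinearMap.smul_apply, gaussFunctional_one, LinearMap.comp_apply,
      LinearMap.mulRight_apply, one_mul, ← h1, Fintype.card_prod, hm, hn, smul_eq_mul]
    have h2 : (1 + b : ℂ) ≠ 0 := by simpa using hbc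
    rw [inv_pow]
    push_cast
    field_simp) l
  have hev : ∀ z : m × n → ℂ, ∀ k, conjEval z (trace ((Z * Y) ^ k)) =
      trace ((toMatrix z * (toMatrix z)ᴴ) ^ k) := by
    intro z k
    set φ : MvPolynomial ((m × n) ⊕ (m × n)) ℂ →+* ℂ := MvPolynomial.eval (Sum.elim z fun i => starRingEnd ℂ (z i)) with hφ
    have h1 : conjEval z (trace ((Z * Y) ^ k)) = trace (φ.mapMatrix ((Z * Y) ^ k)) := by
      simp [conjEval, Matrix.trace, ← hφ, map_sum]
    have h2 : φ.mapMatrix (Z * Y) = toMatrix z * (toMatrix z)ᴴ := by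
      ext a c
      simp [Matrix.mul_apply, Z, Y, φ, toMatrix]
    rw [h1, map_pow, h2]
  have hev' : ∀ z : m × n → ℂ, conjEval z (l.map fun k => trace ((Z * Y) ^ k)).prod =
      (l.map fun k => trace ((toMatrix z * (toMatrix z)ᴴ) ^ k)).prod := by
    intro z
    rw [conjEval, map_list_prod, List.map_map]
    congr 1
    exact List.map_congr_left fun k _ => hev z k
  have hevl : ∀ x : Fin N → ℝ, realEval x
      (l.map fun k => ∑ i : Fin N, (MvPolynomial.X i : MvPolynomial (Fin N) ℂ) ^ k).prod =
      (l.map fun k => ∑ i, (x i : ℂ) ^ k).prod := by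
    intro x
    rw [realEval, map_list_prod, List.map_map]
    congr 1
    refine List.map_congr_left fun k _ => ?_
    simp
  have e1 : gaussFunctional (m × n) b (l.map fun k => trace ((Z * Y) ^ k)).prod =
    ∫ z : m × n → ℂ, (l.map fun k => trace ((toMatrix z * (toMatrix z)ᴴ) ^ k)).prod *
        (Real.exp (-b * ∑ i, ‖z i‖ ^ 2) : ℂ) ∂gaussPi (m × n) := by
    simp only [gaussFunctional, LinearMap.coe_mk, AddHom.coe_mk, hev']
  rw [LinearMap.smul_apply, smul_eq_mul, e1] at key
  rw [key]
  simp only [LinearMap.comp_apply, LinearMap.mulRight_apply, expFunctional, LinearMap.coe_mk,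
    AddHom.coe_mk]
  refine integral_congr_ae (.of_forall fun x => ?_)
  have : realEval x ((l.map fun k => ∑ i : Fin N,
      (MvPolynomial.X i : MvPolynomial (Fin N) ℂ) ^ k).prod * genVandermonde N ^ 2) =
      realEval x ((l.map fun k => ∑ i : Fin N,
        (MvPolynomial.X i : MvPolynomial (Fin N) ℂ) ^ k).prod) *
        realEval x (genVandermonde N ^ 2) := map_mul _ _ _
  simp only
  rw [this, hevl, realEval_genVandermonde_sq]
  push_cast
  ring

end MomentIdentity

/-! ### From moments to the law of the sorted eigenvalues -/

section EigenvalueLaw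

variable {N : ℕ}

/-- Nondecreasing tuples of nonnegative reals. -/
abbrev Chamber (N : ℕ) : Type := {x : Fin N → ℝ // Monotone x ∧ ∀ i, 0 ≤ x i}

theorem isClosed_chamber : IsClosed {x : Fin N → ℝ | Monotone x ∧ ∀ i, 0 ≤ x i} := by
  refine IsClosed.inter ?_ ?_
  · have : {x : Fin N → ℝ | Monotone x} = ⋂ (i : Fin N) (j : Fin N) (_ : i ≤ j),
        {x : Fin N → ℝ | x i ≤ x j} := by
      ext x; simp [Monotone]
    change IsClosed {x : Fin N → ℝ | Monotone x}
    rw [this]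
    exact isClosed_iInter fun i => isClosed_iInter fun j => isClosed_iInter fun _ =>
      isClosed_le (continuous_apply i) (continuous_apply j)
  · change IsClosed {x : Fin N → ℝ | ∀ i, 0 ≤ x i}
    rw [Set.ofPred_forall]
    exact isClosed_iInter fun i => isClosed_le continuous_const (continuous_apply i)

instance : PolishSpace (Chamber N) := isClosed_chamber.polishSpace

/-- Tuples with the same power sums agree up to a permutation. -/
theorem exists_perm_of_psum_eq {x y : Fin N → ℝ} (h : ∀ k : ℕ, ∑ i, x i ^ k = ∑ i, y i ^ k) :
    ∃ σ : Equiv.Perm (Fin N), y ∘ σ = x := by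
  classical
  have hpoly : ∀ p : Polynomial ℝ, ∑ i, p.eval (x i) = ∑ i, p.eval (y i) := by
    intro p
    simp only [Polynomial.eval_eq_sum_range]
    rw [Finset.sum_comm, Finset.sum_comm (s := Finset.univ)]
    refine Finset.sum_congr rfl fun k _ => ?_
    rw [← Finset.mul_sum, ← Finset.mul_sum, h]
  have hcount : ∀ v : ℝ, Fintype.card {i // x i = v} = Fintype.card {i // y i = v} := by
    intro v
    -- Interpolation at all occurring values gives a polynomial that is the indicator of `v` there.
    -- Summing it over the points counts the multiplicity of `v`.
    set s : Finset ℝ := insert v (Finset.univ.image x ∪ Finset.univ.image y) with hs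
    set p : Polynomial ℝ := Lagrange.interpolate s id (fun w => if w = v then 1 else 0) with hp
    have hev : ∀ w ∈ s, p.eval w = if w = v then 1 else 0 := fun w hw =>
      Lagrange.eval_interpolate_at_node (v := id) _ (Set.injOn_id _) hw
    have h1 := hpoly p
    have hx : ∀ i, p.eval (x i) = if x i = v then 1 else 0 := fun i => hev _ (by simp [hs])
    have hy : ∀ i, p.eval (y i) = if y i = v then 1 else 0 := fun i => hev _ (by simp [hs])
    simp only [hx, hy, Finset.sum_boole] at h1
    rw [Fintype.card_subtype, Fintype.card_subtype]
    exact_mod_cast h1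
  have e : ∀ v, {i // x i = v} ≃ {i // y i = v} := fun v => Fintype.equivOfCardEq (hcount v)
  refine ⟨(Equiv.sigmaFiberEquiv x).symm.trans ((Equiv.sigmaCongrRight e).trans
    (Equiv.sigmaFiberEquiv y)), ?_⟩
  ext i
  simp only [Function.comp_apply, Equiv.trans_apply]
  exact ((e _) ⟨i, rfl⟩).2

/-- The sequence of the power sums. -/
def psumSeq (x : Fin N → ℝ) (k : ℕ) : ℝ := ∑ i, x i ^ k

theorem psumSeq_injective : Function.Injective fun x : Chamber N => psumSeq x.1 := by
  intro x y h
  obtain ⟨σ, hσ⟩ := exists_perm_of_psum_eq (fun k => congrFun h k)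
  refine Subtype.ext ?_
  have := Tuple.unique_monotone (f := y.1) (σ := σ) (τ := 1) (by rw [hσ]; exact x.2.1)
    (by simpa using y.2.1)
  rw [← hσ, this]
  simp

theorem measurable_psumSeq : Measurable (psumSeq : (Fin N → ℝ) → ℕ → ℝ) := by
  unfold psumSeq
  fun_prop

/-- Lusin–Souslin: an injective Borel map between Polish spaces is a Borel embedding. Measurability
of a map into the chamber may therefore be tested on power sums, which settles sorting and
eigenvalues without any continuity argument for them. -/
theorem measurableEmbedding_psumSeq : MeasurableEmbedding fun x : Chamber N => psumSeq x.1 :=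
  (measurable_psumSeq.comp measurable_subtype_coe).measurableEmbedding psumSeq_injective

/-- Sorting the positive parts of a tuple. -/
noncomputable def sortChamber (x : Fin N → ℝ) : Chamber N :=
  ⟨(fun i => max (x i) 0) ∘ Tuple.sort fun i => max (x i) 0,
    Tuple.monotone_sort _, fun _ => le_max_right _ _⟩

theorem psumSeq_sortChamber {x : Fin N → ℝ} (hx : ∀ i, 0 ≤ x i) :
    psumSeq (sortChamber x).1 = psumSeq x := by
  ext k
  simp only [psumSeq, sortChamber, Function.comp_apply]
  rw [Equiv.sum_comp (Tuple.sort fun i => max (x i) 0) (fun i => max (x i) 0 ^ k)]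
  simp [hx]

theorem measurable_sortChamber : Measurable (sortChamber : (Fin N → ℝ) → Chamber N) := by
  rw [← measurableEmbedding_psumSeq.measurable_comp_iff]
  have : (fun x : Chamber N => psumSeq x.1) ∘ sortChamber =
      fun x : Fin N → ℝ => psumSeq fun i => max (x i) 0 := by
    funext x k
    simp only [Function.comp_apply, psumSeq, sortChamber]
    exact Equiv.sum_comp (Tuple.sort fun i => max (x i) 0) (fun i => max (x i) 0 ^ k)
  rw [this]
  exact measurable_psumSeq.comp (by fun_prop)

theorem Chamber.continuous_apply (i : Fin N) : Continuous fun x : Chamber N => x.1 i :=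
  (_root_.continuous_apply i).comp continuous_subtype_val

theorem continuous_psumSeq_mul_exp (k : ℕ) :
    Continuous fun x : Chamber N => psumSeq x.1 k * Real.exp (-∑ i, x.1 i) :=
  (continuous_finsetSum _ fun i _ => (Chamber.continuous_apply i).pow k).mul
    (Real.continuous_exp.comp (continuous_finsetSum _ fun i _ => Chamber.continuous_apply i).neg)

/-- All coordinates are nonnegative, so each term is at most `x ^ k * exp (-x)`, and the exponential
series gives `x ^ k ≤ k! * exp x`. -/
theorem norm_psumSeq_mul_exp_le (k : ℕ) (x : Chamber N) :
    ‖psumSeq x.1 k * Real.exp (-∑ i, x.1 i)‖ ≤ N * k.factorial := by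
  have h0 := x.2.2
  have h3 : 0 ≤ psumSeq x.1 k := Finset.sum_nonneg fun i _ => pow_nonneg (h0 i) _
  rw [Real.norm_of_nonneg (mul_nonneg h3 (Real.exp_pos _).le), psumSeq, Finset.sum_mul]
  refine (Finset.sum_le_card_nsmul _ _ (k.factorial : ℝ) fun i _ => ?_).trans (by simp)
  have h1 : Real.exp (-∑ i, x.1 i) ≤ Real.exp (-x.1 i) := Real.exp_le_exp.2
    (neg_le_neg (Finset.single_le_sum (fun j _ => h0 j) (Finset.mem_univ i)))
  have h2 := Real.pow_div_factorial_le_exp _ (h0 i) k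
  rw [div_le_iff₀ (by positivity)] at h2
  have h4 := pow_nonneg (h0 i) k
  calc x.1 i ^ k * Real.exp (-∑ i, x.1 i) ≤ x.1 i ^ k * Real.exp (-x.1 i) := by gcongr
    _ ≤ Real.exp (x.1 i) * k.factorial * Real.exp (-x.1 i) := by gcongr
    _ = k.factorial := by
        rw [mul_right_comm, ← Real.exp_add, add_neg_cancel, Real.exp_zero, one_mul]

/-- The bounded test functions `pₖ exp (-p₁)`. -/
noncomputable def chamberTest (N k : ℕ) : BoundedContinuousFunction (Chamber N) ℝ :=
  BoundedContinuousFunction.ofNormedAddCommGroup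
    (fun x => psumSeq x.1 k * Real.exp (-∑ i, x.1 i)) (continuous_psumSeq_mul_exp k)
    (N * k.factorial) (norm_psumSeq_mul_exp_le k)

theorem chamberTest_apply (k : ℕ) (x : Chamber N) :
    chamberTest N k x = psumSeq x.1 k * Real.exp (-∑ i, x.1 i) := rfl

/-- The algebra generated by the test functions. -/
noncomputable def chamberAlgebra (N : ℕ) :
    StarSubalgebra ℝ (BoundedContinuousFunction (Chamber N) ℝ) where
  toSubalgebra := Algebra.adjoin ℝ (Set.range (chamberTest N))
  star_mem' := by
    intro a ha
    have : star a = a := by ext x; simp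
    rw [this]; exact ha

/-- The test function with `k = 0` is `N` times the exponential factor. Once this factor is known it
can be cancelled from the others, leaving all power sums. -/
theorem chamberAlgebra_separatesPoints :
    ((chamberAlgebra N).map
      (BoundedContinuousFunction.toContinuousMapStarₐ ℝ)).SeparatesPoints := by
  intro x y hxy
  have hmem : ∀ k, chamberTest N k ∈ chamberAlgebra N := fun k =>
    Algebra.subset_adjoin (Set.mem_range_self k)
  have hsep : ∃ k, chamberTest N k x ≠ chamberTest N k y := by
    by_contra! hcon
    refine hxy (psumSeq_injective (funext fun k => ?_))
    have h0 := hcon 0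
    have hk := hcon k
    rw [chamberTest_apply, chamberTest_apply] at h0 hk
    rcases Nat.eq_zero_or_pos N with rfl | hN
    · simp [psumSeq]
    have hN' : (N : ℝ) ≠ 0 := by exact_mod_cast hN.ne'
    simp only [psumSeq, pow_zero, Finset.sum_const, Finset.card_univ, Fintype.card_fin,
      nsmul_eq_mul, mul_one] at h0
    rw [mul_left_cancel₀ hN' h0] at hk
    exact mul_right_cancel₀ (Real.exp_pos _).ne' hk
  obtain ⟨k, hk⟩ := hsep
  refine ⟨_, ⟨_, ⟨chamberTest N k, hmem k, rfl⟩, rfl⟩, hk⟩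

/-- A point-separating algebra of bounded continuous functions determines a finite measure on a
Polish space. The algebra is spanned by products of test functions, and each factor contributes one
`exp (-∑ x i)`; hence the weight is tied to the length of `l`. -/
theorem chamber_measure_ext {P Q : Measure (Chamber N)} [IsFiniteMeasure P] [IsFiniteMeasure Q]
    (h : ∀ l : List ℕ, ∫ x, (l.map (psumSeq x.1)).prod * Real.exp (-l.length * ∑ i, x.1 i) ∂P =
      ∫ x, (l.map (psumSeq x.1)).prod * Real.exp (-l.length * ∑ i, x.1 i) ∂Q) : P = Q := by
  refine ext_of_forall_mem_subalgebra_integral_eq_of_polish chamberAlgebra_separatesPoints ?_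
  intro g hg
  have hg' : g ∈ Subalgebra.toSubmodule (Algebra.adjoin ℝ (Set.range (chamberTest N))) := hg
  clear hg
  rw [Algebra.adjoin_eq_span] at hg'
  induction hg' using Submodule.span_induction with
  | zero => simp
  | add f g _ _ hf hg =>
    simp only [BoundedContinuousFunction.coe_add, Pi.add_apply]
    rw [integral_add (f.integrable P) (g.integrable P), integral_add (f.integrable Q)
      (g.integrable Q), hf, hg]
  | smul c f _ hf =>
    simp only [BoundedContinuousFunction.coe_smul, smul_eq_mul, integral_const_mul, hf]
  | mem g hg =>
    obtain ⟨l, hl, rfl⟩ := Submonoid.exists_list_of_mem_closure hg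
    have : ∃ l' : List ℕ, l = l'.map (chamberTest N) := by
      clear hg
      induction l with
      | nil => exact ⟨[], rfl⟩
      | cons a l ih =>
        obtain ⟨k, rfl⟩ := hl a (by simp)
        obtain ⟨l', rfl⟩ := ih fun y hy => hl y (by simp [hy])
        exact ⟨k :: l', rfl⟩
    obtain ⟨l', rfl⟩ := this
    have hprod : ∀ x : Chamber N, (l'.map (chamberTest N)).prod x =
        (l'.map (psumSeq x.1)).prod * Real.exp (-l'.length * ∑ i, x.1 i) := by
      intro x
      clear hl hg
      induction l' with
      | nil => simp
      | cons k l ih =>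
        simp only [List.map_cons, List.prod_cons, BoundedContinuousFunction.coe_mul,
          Pi.mul_apply, ih, chamberTest_apply, List.length_cons]
        push_cast
        rw [show -((l.length : ℝ) + 1) * ∑ i, x.1 i =
          -(∑ i, x.1 i) + -l.length * ∑ i, x.1 i by ring, Real.exp_add]
        ring
    simp only [hprod]
    exact h l'

theorem unitary_conj_diagonal_pow {m : Type*} [Fintype m] [DecidableEq m]
    (U : unitaryGroup m ℂ) (d : m → ℂ) (k : ℕ) :
    ((U : Matrix m m ℂ) * diagonal d * (star U : Matrix m m ℂ)) ^ k =
      (U : Matrix m m ℂ) * diagonal (fun i => d i ^ k) * (star U : Matrix m m ℂ) := by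
  induction k with
  | zero => simp
  | succ k ih =>
    rw [pow_succ, ih]
    simp only [Matrix.mul_assoc]
    rw [← Matrix.mul_assoc (star U : Matrix m m ℂ) (U : Matrix m m ℂ), Unitary.coe_star_mul_self,
      Matrix.one_mul, ← Matrix.mul_assoc (diagonal _), diagonal_mul_diagonal]
    simp only [pow_succ]

theorem eq_unitary_conj_diagonal {m : Type*} [Fintype m] [DecidableEq m] {A : Matrix m m ℂ}
    (hA : A.IsHermitian) : A = (hA.eigenvectorUnitary : Matrix m m ℂ) *
      diagonal (fun i => (hA.eigenvalues i : ℂ)) *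
        (star hA.eigenvectorUnitary : Matrix m m ℂ) := by
  conv_lhs => rw [hA.spectral_theorem]
  rfl

theorem trace_pow_eq_sum_eigenvalues {m : Type*} [Fintype m] [DecidableEq m] {A : Matrix m m ℂ}
    (hA : A.IsHermitian) (k : ℕ) : trace (A ^ k) = ∑ i, (hA.eigenvalues i : ℂ) ^ k := by
  refine (congrArg (fun B => trace (B ^ k)) (eq_unitary_conj_diagonal hA)).trans ?_
  rw [unitary_conj_diagonal_pow, Matrix.trace_mul_comm, ← Matrix.mul_assoc,
    Unitary.coe_star_mul_self, Matrix.one_mul, Matrix.trace_diagonal]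

variable {m n : Type*} [Fintype m] [Fintype n] [DecidableEq m]

/-- The sorted eigenvalues of a Gram matrix. -/
noncomputable def gramEigs (e : Fin N ≃ m) (z : m × n → ℂ) : Chamber N :=
  sortChamber fun i => (isHermitian_mul_conjTranspose_self (toMatrix z)).eigenvalues (e i)

open scoped ComplexOrder in
theorem psumSeq_gramEigs (e : Fin N ≃ m) (z : m × n → ℂ) (k : ℕ) :
    (psumSeq (gramEigs e z).1 k : ℂ) = trace ((toMatrix z * (toMatrix z)ᴴ) ^ k) := by
  rw [gramEigs, psumSeq_sortChamber fun i =>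
      (posSemidef_self_mul_conjTranspose (toMatrix z)).eigenvalues_nonneg (e i),
    trace_pow_eq_sum_eigenvalues (isHermitian_mul_conjTranspose_self (toMatrix z)), psumSeq]
  push_cast
  exact Equiv.sum_comp e (fun i =>
    ((isHermitian_mul_conjTranspose_self (toMatrix z)).eigenvalues i : ℂ) ^ k)

theorem measurable_gramEigs (e : Fin N ≃ m) :
    Measurable (gramEigs e : (m × n → ℂ) → Chamber N) := by
  rw [← measurableEmbedding_psumSeq.measurable_comp_iff]
  have : (fun x : Chamber N => psumSeq x.1) ∘ gramEigs e =
      fun (z : m × n → ℂ) k => (trace ((toMatrix z * (toMatrix z)ᴴ) ^ k)).re := by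
    funext z k
    rw [← psumSeq_gramEigs e, Complex.ofReal_re]
    rfl
  rw [this, measurable_pi_iff]
  intro k
  refine Continuous.measurable ?_
  have hc : Continuous (toMatrix : (m × n → ℂ) → Matrix m n ℂ) :=
    continuous_matrix fun i j => continuous_apply (i, j)
  exact Complex.continuous_re.comp ((hc.matrix_mul hc.matrix_conjTranspose).pow k).matrix_trace

theorem sum_gramEigs (e : Fin N ≃ m) (z : m × n → ℂ) :
    ∑ i, (gramEigs e z).1 i = ∑ i, ‖z i‖ ^ 2 := by
  have h := psumSeq_gramEigs e z 1
  rw [pow_one] at h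
  simp only [psumSeq, pow_one] at h
  have h2 : trace (toMatrix z * (toMatrix z)ᴴ) = ((∑ i, ‖z i‖ ^ 2 : ℝ) : ℂ) := by
    simp only [Matrix.trace, Matrix.diag_apply, Matrix.mul_apply, toMatrix, Matrix.of_apply,
      Matrix.conjTranspose_apply, RCLike.star_def, Complex.mul_conj', Fintype.sum_prod_type]
    push_cast
    rfl
  rw [h2] at h
  exact_mod_cast h

/-- The Laguerre ensemble, not normalized. -/
noncomputable def laguerre (N : ℕ) : Measure (Fin N → ℝ) :=
  (orthant (Fin N)).withDensity
    fun x => ENNReal.ofReal (vandermondeSq x * Real.exp (-∑ i, x i))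

theorem continuous_vandermondeSq : Continuous (vandermondeSq : (Fin N → ℝ) → ℝ) := by
  unfold vandermondeSq
  fun_prop

theorem vandermondeSq_nonneg (x : Fin N → ℝ) : 0 ≤ vandermondeSq x := sq_nonneg _

theorem measurable_laguerreDensity : Measurable fun x : Fin N → ℝ =>
    ENNReal.ofReal (vandermondeSq x * Real.exp (-∑ i, x i)) := by
  have := continuous_vandermondeSq (N := N)
  fun_prop

theorem laguerre_univ : laguerre N Set.univ = ENNReal.ofReal (laguerreMass N) := by
  rw [laguerre, withDensity_apply _ MeasurableSet.univ, Measure.restrict_univ, laguerreMass,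
    ofReal_integral_eq_lintegral_ofReal integrable_laguerreDensity
      (.of_forall fun x => mul_nonneg (vandermondeSq_nonneg x) (Real.exp_pos _).le)]

instance : IsFiniteMeasure (laguerre N) := ⟨by rw [laguerre_univ]; exact ENNReal.ofReal_lt_top⟩

theorem ae_orthant_pos {ι : Type*} [Fintype ι] : ∀ᵐ x ∂orthant ι, ∀ i, 0 < x i := by
  rw [ae_all_iff]
  intro i
  exact (Measure.quasiMeasurePreserving_eval _ i).ae (ae_restrict_mem measurableSet_Ioi)

/-- The eigenvalues of the Gram matrix of a square complex Gaussian matrix form the Laguerre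
ensemble. -/
theorem laguerreMass_smul_map_gramEigs (e : Fin N ≃ m) (hn : Fintype.card n = N) :
    ENNReal.ofReal (laguerreMass N) • (gaussPi (m × n)).map (gramEigs e) =
      (laguerre N).map sortChamber := by
  classical
  have : IsProbabilityMeasure ((gaussPi (m × n)).map (gramEigs e)) :=
    Measure.isProbabilityMeasure_map (measurable_gramEigs e).aemeasurable
  have : IsFiniteMeasure (ENNReal.ofReal (laguerreMass N) •
    (gaussPi (m × n)).map (gramEigs e)) := Measure.smul_finite _ ENNReal.ofReal_ne_top
  refine chamber_measure_ext fun l => ?_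
  have hm : Fintype.card m = N := by rw [← Fintype.card_congr e, Fintype.card_fin]
  have hmeas : Measurable fun x : Chamber N =>
      (l.map (psumSeq x.1)).prod * Real.exp (-l.length * ∑ i, x.1 i) := by
    have h1 : ∀ i, Measurable fun x : Chamber N => x.1 i := fun i =>
      (Chamber.continuous_apply i).measurable
    have h2 : Measurable fun x : Chamber N => (l.map (psumSeq x.1)).prod := by
      refine (continuous_list_prod (f := fun (k : ℕ) (x : Chamber N) => psumSeq x.1 k) l
        fun k _ => continuous_finsetSum _ fun i _ =>
          (Chamber.continuous_apply i).pow k).measurable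
    fun_prop
  rw [integral_smul_measure, integral_map (measurable_gramEigs e).aemeasurable
    hmeas.aestronglyMeasurable, integral_map measurable_sortChamber.aemeasurable
    hmeas.aestronglyMeasurable, ENNReal.toReal_ofReal laguerreMass_pos.le, laguerre,
    integral_withDensity_eq_integral_toReal_smul measurable_laguerreDensity (by simp)]
  have key := laguerreMass_mul_integral_trace hm hn l.length l
  refine Complex.ofReal_injective ?_
  rw [smul_eq_mul, Complex.ofReal_mul, ← integral_complex_ofReal, ← integral_complex_ofReal]
  have e1 : ∀ z : m × n → ℂ,
      (((l.map (psumSeq (gramEigs e z).1)).prod *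
        Real.exp (-l.length * ∑ i, (gramEigs e z).1 i) : ℝ) : ℂ) =
      (l.map fun k => trace ((toMatrix z * (toMatrix z)ᴴ) ^ k)).prod *
        (Real.exp (-l.length * ∑ i, ‖z i‖ ^ 2) : ℂ) := by
    intro z
    rw [sum_gramEigs, Complex.ofReal_mul]
    congr 1
    rw [← Complex.ofRealHom_eq_coe, map_list_prod, List.map_map]
    congr 1
    exact List.map_congr_left fun k _ => psumSeq_gramEigs e z k
  simp only [e1]
  rw [key]
  refine integral_congr_ae ?_
  filter_upwards [ae_orthant_pos] with x hx
  have hs := psumSeq_sortChamber (fun i => (hx i).le)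
  have hs1 : ∑ i, (sortChamber x).1 i = ∑ i, x i := by
    simpa [psumSeq] using congrFun hs 1
  rw [hs, hs1, ENNReal.toReal_ofReal (mul_nonneg (vandermondeSq_nonneg x) (Real.exp_pos _).le),
    -- One unit of the exponent belongs to the Laguerre density, the others to the test functions.
    show -(1 + (l.length : ℝ)) * ∑ i, x i = -(∑ i, x i) + -l.length * ∑ i, x i by ring,
    Real.exp_add, smul_eq_mul]
  have e2 : (l.map fun k => ∑ i, (x i : ℂ) ^ k).prod = (((l.map (psumSeq x)).prod : ℝ) : ℂ) := by
    rw [← Complex.ofRealHom_eq_coe, map_list_prod, List.map_map]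
    congr 1
    refine List.map_congr_left fun k _ => ?_
    simp [psumSeq]
  rw [e2]
  push_cast
  ring

end EigenvalueLaw

/-! ### Radial monotonicity of the weight left by the larger points -/

section LaguerreWeight

/-- Moving positive numbers away from their mean decreases the product. -/
theorem prod_stretch_le {ι : Type*} [Fintype ι] [Nonempty ι] {x y : ι → ℝ} {s c : ℝ} (hs : 1 ≤ s)
    (hc : c * Fintype.card ι = ∑ i, x i) (hy : ∀ i, y i = s * x i - (s - 1) * c)
    (hpos : ∀ i, 0 ≤ y i) : ∏ i, y i ≤ ∏ i, x i := by
  have hs0 : 0 < s := by linarith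
  have hn : (0 : ℝ) < Fintype.card ι := by exact_mod_cast Fintype.card_pos
  have hsum : ∑ i, y i = c * Fintype.card ι := by
    simp only [hy, Finset.sum_sub_distrib, ← Finset.mul_sum, ← hc, Finset.sum_const,
      Finset.card_univ, nsmul_eq_mul]
    ring
  have hc0 : 0 ≤ c := by
    have : 0 ≤ c * Fintype.card ι := hsum ▸ Finset.sum_nonneg fun i _ => hpos i
    exact nonneg_of_mul_nonneg_left this hn
  -- Undoing the stretch writes `x i` as a convex combination of `y i` and the common mean `c`.
  -- Weighted AM-GM then bounds each `x i` below by a geometric mean, and AM-GM for the whole family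
  -- gives `∏ y i ≤ c ^ n`.
  have hx : ∀ i, x i = s⁻¹ * y i + (1 - s⁻¹) * c := by
    intro i
    rw [hy]
    field_simp
    ring
  have hw : 0 ≤ 1 - s⁻¹ := sub_nonneg.2 (inv_le_one_of_one_le₀ hs)
  have hamgm : ∏ i, y i ≤ c ^ Fintype.card ι := by
    have h := Real.geom_mean_le_arith_mean Finset.univ (fun _ : ι => (1 : ℝ)) y (by simp)
      (by simpa using hn) (fun i _ => hpos i)
    simp only [Real.rpow_one, Finset.sum_const, Finset.card_univ, nsmul_eq_mul, mul_one, one_mul,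
      hsum, mul_div_cancel_right₀ _ hn.ne'] at h
    have hp : 0 ≤ ∏ i, y i := Finset.prod_nonneg fun i _ => hpos i
    calc ∏ i, y i = ((∏ i, y i) ^ ((Fintype.card ι : ℝ)⁻¹)) ^ Fintype.card ι := by
          rw [← Real.rpow_natCast, ← Real.rpow_mul hp, inv_mul_cancel₀ hn.ne', Real.rpow_one]
      _ ≤ c ^ Fintype.card ι := by
          gcongr
  have hp : 0 ≤ ∏ i, y i := Finset.prod_nonneg fun i _ => hpos i
  calc ∏ i, y i = (∏ i, y i) ^ s⁻¹ * (∏ i, y i) ^ (1 - s⁻¹) := by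
        rw [← Real.rpow_add_of_nonneg hp (by positivity) hw]; simp
    _ ≤ (∏ i, y i) ^ s⁻¹ * (c ^ Fintype.card ι) ^ (1 - s⁻¹) := by
        gcongr
    _ = ∏ i, (y i ^ s⁻¹ * c ^ (1 - s⁻¹)) := by
        rw [Finset.prod_mul_distrib, Real.finsetProd_rpow _ _ (fun i _ => hpos i),
          Finset.prod_const, Finset.card_univ, ← Real.rpow_natCast, ← Real.rpow_mul hc0,
          ← Real.rpow_natCast, ← Real.rpow_mul hc0, mul_comm (1 - s⁻¹)]
    _ ≤ ∏ i, x i := by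
        refine Finset.prod_le_prod (fun i _ => mul_nonneg (Real.rpow_nonneg (hpos i) _)
          (Real.rpow_nonneg hc0 _)) fun i _ => ?_
        rw [hx]
        exact Real.geom_mean_le_arith_mean2_weighted (by positivity) hw (hpos i) hc0 (by ring)

variable {ι κ : Type*} [Fintype ι] [Fintype κ]

/-- The product of all distances between distinct coordinates, each pair counted twice. -/
def pairProd (x : ι → ℝ) : ℝ := ∏ p ∈ (Finset.univ : Finset ι).offDiag, |x p.1 - x p.2|

theorem pairProd_nonneg (x : ι → ℝ) : 0 ≤ pairProd x :=
  Finset.prod_nonneg fun _ _ => abs_nonneg _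

theorem continuous_pairProd : Continuous (pairProd : (ι → ℝ) → ℝ) := by
  unfold pairProd
  fun_prop

theorem pairProd_add_const (x : ι → ℝ) (c : ℝ) : pairProd (fun i => x i + c) = pairProd x := by
  simp [pairProd]

theorem pairProd_smul {a : ℝ} (ha : 0 ≤ a) (x : ι → ℝ) :
    pairProd (a • x) = a ^ (Fintype.card ι * Fintype.card ι - Fintype.card ι) * pairProd x := by
  simp only [pairProd, Pi.smul_apply, smul_eq_mul, ← mul_sub, abs_mul, abs_of_nonneg ha,
    Finset.prod_mul_distrib, Finset.prod_const, Finset.offDiag_card, Finset.card_univ]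

/-- The interaction of `x` with larger points `y`. -/
noncomputable def crossDensity (x : ι → ℝ) (y : κ → ℝ) : ENNReal :=
  Set.indicator {p : (ι → ℝ) × (κ → ℝ) | ∀ i j, p.1 i < p.2 j}
    (fun p => ENNReal.ofReal (pairProd p.2 * (∏ j, ∏ i, (p.2 j - p.1 i)) ^ 2 *
      Real.exp (-∑ j, p.2 j))) (x, y)

theorem measurable_crossDensity :
    Measurable fun p : (ι → ℝ) × (κ → ℝ) => crossDensity p.1 p.2 := by
  refine Measurable.indicator ?_ ?_
  · have := (continuous_pairProd (ι := κ)).measurable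
    fun_prop
  · have : {p : (ι → ℝ) × (κ → ℝ) | ∀ i j, p.1 i < p.2 j} =
        ⋂ (i) (j), {p : (ι → ℝ) × (κ → ℝ) | p.1 i < p.2 j} := by ext; simp
    rw [this]
    exact MeasurableSet.iInter fun i => MeasurableSet.iInter fun j =>
      measurableSet_lt (by fun_prop) (by fun_prop)

variable (κ) in
/-- The weight left on the smaller points when the larger points are integrated out, relative to
the factor `exp (-2 ∑ x i)`. -/
noncomputable def radialWeight (x : ι → ℝ) : ENNReal :=
  ENNReal.ofReal (Real.exp (∑ i, x i)) * ∫⁻ y : κ → ℝ, crossDensity x y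

theorem measurable_radialWeight : Measurable (radialWeight κ : (ι → ℝ) → ENNReal) := by
  unfold radialWeight
  have := (measurable_crossDensity (ι := ι) (κ := κ)).lintegral_prod_right' (ν := volume)
  exact (by fun_prop : Measurable fun x : ι → ℝ =>
    ENNReal.ofReal (Real.exp (∑ i, x i))).mul this

/-- Scaling `x` by `s` is compensated by translating `y` by `(s - 1)` times the mean of `x`. For
fixed `j` the distances `y j - x i` are then stretched about their mean, so their product decreases,
while the exponentials cancel and the self-interaction of `y` is unchanged. -/
theorem radialWeight_smul_le [Nonempty ι] (hcard : Fintype.card κ = Fintype.card ι) (x : ι → ℝ)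
    {s : ℝ} (hs : 1 ≤ s) : radialWeight κ (s • x) ≤ radialWeight κ x := by
  have hn : (0 : ℝ) < Fintype.card ι := by exact_mod_cast Fintype.card_pos
  set m : ℝ := (∑ i, x i) / Fintype.card ι with hm
  have hm' : m * Fintype.card ι = ∑ i, x i := div_mul_cancel₀ _ hn.ne'
  rw [radialWeight, radialWeight,
    ← lintegral_add_right_eq_self _ (fun _ : κ => (s - 1) * m),
    ← lintegral_const_mul' _ _ ENNReal.ofReal_ne_top,
    ← lintegral_const_mul' _ _ ENNReal.ofReal_ne_top]
  refine lintegral_mono fun y => ?_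
  unfold crossDensity
  simp only [Set.indicator_apply, Set.mem_ofPred_eq, Pi.smul_apply, smul_eq_mul, Pi.add_apply]
  split_ifs with h1 h2 h2
  · rw [← ENNReal.ofReal_mul (Real.exp_pos _).le, ← ENNReal.ofReal_mul (Real.exp_pos _).le]
    refine ENNReal.ofReal_le_ofReal ?_
    have hprod : ∏ j, ∏ i, (y j + (s - 1) * m - s * x i) ≤ ∏ j, ∏ i, (y j - x i) := by
      refine Finset.prod_le_prod (fun j _ => Finset.prod_nonneg fun i _ =>
        (sub_pos.2 (h1 i j)).le) fun j _ => ?_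
      refine prod_stretch_le (s := s) (c := y j - m) hs ?_ (fun i => by ring)
        fun i => (sub_pos.2 (h1 i j)).le
      rw [Finset.sum_sub_distrib, ← hm', Finset.sum_const, Finset.card_univ, nsmul_eq_mul]
      ring
    have hprod0 : 0 ≤ ∏ j, ∏ i, (y j + (s - 1) * m - s * x i) :=
      Finset.prod_nonneg fun j _ => Finset.prod_nonneg fun i _ => (sub_pos.2 (h1 i j)).le
    -- The cancellation is exact because there are as many large points as small ones.
    have hexp : Real.exp (∑ i, s * x i) * Real.exp (-∑ j, (y j + (s - 1) * m)) =
        Real.exp (∑ i, x i) * Real.exp (-∑ j, y j) := by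
      rw [← Real.exp_add, ← Real.exp_add, ← Finset.mul_sum, Finset.sum_add_distrib,
        Finset.sum_const, Finset.card_univ, nsmul_eq_mul, hcard, ← hm']
      congr 1
      ring
    have hV : pairProd (y + fun _ => (s - 1) * m) = pairProd y := pairProd_add_const y _
    rw [hV]
    calc Real.exp (∑ i, s * x i) * (pairProd y *
          (∏ j, ∏ i, (y j + (s - 1) * m - s * x i)) ^ 2 *
          Real.exp (-∑ j, (y j + (s - 1) * m))) = (Real.exp (∑ i, s * x i) *
          Real.exp (-∑ j, (y j + (s - 1) * m))) * (pairProd y *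
          (∏ j, ∏ i, (y j + (s - 1) * m - s * x i)) ^ 2) := by ring
      _ ≤ (Real.exp (∑ i, x i) * Real.exp (-∑ j, y j)) * (pairProd y *
          (∏ j, ∏ i, (y j - x i)) ^ 2) := by
          rw [hexp]
          have := pairProd_nonneg y
          gcongr
      _ = _ := by ring
  -- The translated domain lies in the original one: the largest `x i₀` is at least the mean, so `y
  -- j > s * x i₀ - (s - 1) * m ≥ x i₀`.
  · exfalso
    refine h2 fun i j => ?_
    obtain ⟨i₀, -, hi₀⟩ := Finset.exists_max_image Finset.univ x Finset.univ_nonempty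
    have h3 : m ≤ x i₀ := by
      rw [hm, div_le_iff₀ hn]
      refine (Finset.sum_le_card_nsmul _ _ (x i₀) fun i hi => hi₀ i hi).trans ?_
      rw [Finset.card_univ, nsmul_eq_mul, mul_comm]
    have h4 := h1 i₀ j
    have h5 := hi₀ i (Finset.mem_univ i)
    nlinarith
  · simp
  · simp

end LaguerreWeight

/-! ### Polar coordinates on the orthant and Chebyshev's inequality -/

section Polar

theorem ENNReal.mul_add_mul_le_of_antivary {a b c d : ENNReal} (hab : a ≤ b) (hdc : d ≤ c) :
    a * c + b * d ≤ a * d + b * c := by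
  obtain ⟨e, rfl⟩ := le_iff_exists_add.1 hab
  obtain ⟨f, rfl⟩ := le_iff_exists_add.1 hdc
  calc a * (d + f) + (a + e) * d ≤ a * (d + f) + (a + e) * d + e * f := le_self_add
    _ = _ := by ring

/-- Chebyshev's correlation inequality. -/
theorem lintegral_mul_le_of_monotoneOn_antitoneOn {ρ : Measure ℝ} [SFinite ρ]
    {F u : ℝ → ENNReal} {s : Set ℝ} (hs : ∀ᵐ b ∂ρ, b ∈ s) (hF : Measurable F) (hu : Measurable u)
    (hFm : MonotoneOn F s) (hum : AntitoneOn u s) :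
    ρ Set.univ * ∫⁻ b, F b * u b ∂ρ ≤ (∫⁻ b, F b ∂ρ) * ∫⁻ b, u b ∂ρ := by
  have h1 : ∫⁻ a, ∫⁻ b, (F a * u a + F b * u b) ∂ρ ∂ρ =
      2 * (ρ Set.univ * ∫⁻ b, F b * u b ∂ρ) := by
    have : ∀ a, ∫⁻ b, (F a * u a + F b * u b) ∂ρ =
        F a * u a * ρ Set.univ + ∫⁻ b, F b * u b ∂ρ := fun a => by
      rw [lintegral_add_left measurable_const, lintegral_const]
    simp only [this]
    rw [lintegral_add_right _ measurable_const, lintegral_mul_const _ (f := fun a => F a * u a) (hF.mul hu),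
      lintegral_const]
    ring
  have h2 : ∫⁻ a, ∫⁻ b, (F a * u b + F b * u a) ∂ρ ∂ρ =
      2 * ((∫⁻ b, F b ∂ρ) * ∫⁻ b, u b ∂ρ) := by
    have : ∀ a, ∫⁻ b, (F a * u b + F b * u a) ∂ρ =
        F a * (∫⁻ b, u b ∂ρ) + (∫⁻ b, F b ∂ρ) * u a := fun a => by
      rw [lintegral_add_left (hu.const_mul _), lintegral_const_mul _ hu, lintegral_mul_const _ hF]
    simp only [this]
    rw [lintegral_add_left (hF.mul_const _), lintegral_mul_const _ hF, lintegral_const_mul _ hu]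
    ring
  -- The two-point rearrangement inequality, integrated over independent copies `a`, `b`. It is kept
  -- in additive form because extended nonnegative reals have no true subtraction.
  have h3 : ∫⁻ a, ∫⁻ b, (F a * u a + F b * u b) ∂ρ ∂ρ ≤
      ∫⁻ a, ∫⁻ b, (F a * u b + F b * u a) ∂ρ ∂ρ := by
    refine lintegral_mono_ae ?_
    filter_upwards [hs] with a ha
    refine lintegral_mono_ae ?_
    filter_upwards [hs] with b hb
    rcases le_total a b with hab | hab
    · exact ENNReal.mul_add_mul_le_of_antivary (hFm ha hb hab) (hum ha hb hab)
    · rw [add_comm (F a * u a), add_comm (F a * u b)]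
      exact ENNReal.mul_add_mul_le_of_antivary (hFm hb ha hab) (hum hb ha hab)
  rw [h1, h2] at h3
  exact (ENNReal.mul_le_mul_iff_right (by simp) (by simp)).1 h3

variable {ι : Type*} [Fintype ι]

theorem orthant_eq_restrict :
    orthant ι = volume.restrict (Set.univ.pi fun _ : ι => Set.Ioi (0 : ℝ)) :=
  (Measure.restrict_pi_pi (fun _ : ι => (volume : Measure ℝ)) _).symm

theorem lintegral_orthant_comp_smul {a : ℝ} (ha : 0 < a) (h : (ι → ℝ) → ENNReal) :
    ∫⁻ x, h (a • x) ∂orthant ι = ENNReal.ofReal ((a ^ Fintype.card ι)⁻¹) * ∫⁻ x, h x ∂orthant ι := by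
  have hS : MeasurableSet (Set.univ.pi fun _ : ι => Set.Ioi (0 : ℝ)) :=
    MeasurableSet.univ_pi fun _ => measurableSet_Ioi
  have hmap := Measure.map_addHaar_smul (volume : Measure (ι → ℝ)) ha.ne'
  rw [Module.finrank_fintype_fun_eq_card, abs_of_pos (by positivity)] at hmap
  have hemb : MeasurableEmbedding fun x : ι → ℝ => a • x :=
    (Homeomorph.smulOfNeZero a ha.ne').measurableEmbedding
  rw [orthant_eq_restrict, ← lintegral_indicator hS, ← lintegral_indicator hS]
  have h1 : ∀ x : ι → ℝ, (Set.univ.pi fun _ : ι => Set.Ioi (0 : ℝ)).indicator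
      (fun x => h (a • x)) x =
      (Set.univ.pi fun _ : ι => Set.Ioi (0 : ℝ)).indicator h (a • x) := by
    intro x
    classical
    simp only [Set.indicator_apply]
    refine if_congr ?_ rfl rfl
    simp [Set.mem_pi, ha]
  rw [lintegral_congr h1]
  rw [← hemb.lintegral_map (μ := volume)
    ((Set.univ.pi fun _ : ι => Set.Ioi (0 : ℝ)).indicator h), hmap, lintegral_smul_measure,
    smul_eq_mul]

theorem lintegral_Ioi_comp_mul {a : ℝ} (ha : 0 < a) (h : ℝ → ENNReal) :
    ENNReal.ofReal a * ∫⁻ x in Set.Ioi (0 : ℝ), h (a * x) = ∫⁻ x in Set.Ioi (0 : ℝ), h x := by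
  have hemb : MeasurableEmbedding fun x : ℝ => a * x :=
    (Homeomorph.mulLeft₀ a ha.ne').measurableEmbedding
  have hmap := Real.smul_map_volume_mul_left ha.ne'
  rw [abs_of_pos ha] at hmap
  rw [← lintegral_indicator measurableSet_Ioi, ← lintegral_indicator measurableSet_Ioi]
  have h1 : ∀ x : ℝ, (Set.Ioi (0 : ℝ)).indicator (fun x => h (a * x)) x =
      (Set.Ioi (0 : ℝ)).indicator h (a * x) := by
    intro x
    simp only [Set.indicator_apply, Set.mem_Ioi]
    refine if_congr ?_ rfl rfl
    simp [ha]
  rw [lintegral_congr h1]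
  rw [← hemb.lintegral_map (μ := volume) ((Set.Ioi (0 : ℝ)).indicator h)]
  conv_rhs => rw [← hmap, lintegral_smul_measure, smul_eq_mul]

theorem lintegral_inv_mul_exp_Ioi {σ : ℝ} (hσ : 0 < σ) :
    ∫⁻ a in Set.Ioi (0 : ℝ), ENNReal.ofReal (σ⁻¹ * Real.exp (-a / σ)) = 1 := by
  have h := integral_pow_mul_exp_Ioi (inv_pos.2 hσ) 0
  have h1 : ∫ a in Set.Ioi (0 : ℝ), σ⁻¹ * Real.exp (-a / σ) = 1 := by
    rw [integral_const_mul]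
    have : ∀ a : ℝ, Real.exp (-a / σ) = a ^ 0 * Real.exp (-σ⁻¹ * a) := fun a => by
      rw [pow_zero, one_mul]; congr 1; field_simp
    simp only [this, h]
    simp
    field_simp
  rw [← ofReal_integral_eq_lintegral_ofReal (.of_integral_ne_zero (by rw [h1]; exact one_ne_zero))
    (.of_forall fun a => by positivity), h1, ENNReal.ofReal_one]

/-- The radial law of the Laguerre ensemble with `n` points. -/
noncomputable def radialMeasure (n : ℕ) : Measure ℝ :=
  (volume.restrict (Set.Ioi 0)).withDensity
    fun b => ENNReal.ofReal (b ^ (n * n - 1) * Real.exp (-2 * b))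

instance (n : ℕ) : SFinite (radialMeasure n) := by unfold radialMeasure; infer_instance

/-- The angular weight in polar coordinates. -/
noncomputable def angularWeight (x : ι → ℝ) : ENNReal :=
  ENNReal.ofReal ((∑ i, x i)⁻¹ * Real.exp (-1 / ∑ i, x i) * pairProd x *
    ((∑ i, x i) ^ (Fintype.card ι * Fintype.card ι))⁻¹)

theorem measurable_angularWeight : Measurable (angularWeight : (ι → ℝ) → ENNReal) := by
  unfold angularWeight
  have := (continuous_pairProd (ι := ι)).measurable
  fun_prop

/-- Integration in polar coordinates `x = b u`, `∑ u i = 1`. -/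
theorem lintegral_polar [Nonempty ι] {f : (ι → ℝ) → ENNReal} (hf : Measurable f) :
    ∫⁻ x, f x * ENNReal.ofReal (pairProd x * Real.exp (-2 * ∑ i, x i)) ∂orthant ι =
      ∫⁻ x, angularWeight x *
        ∫⁻ b, f ((b / ∑ i, x i) • x) ∂radialMeasure (Fintype.card ι) ∂orthant ι := by
  set n := Fintype.card ι with hn
  have hn0 : 0 < n := Fintype.card_pos
  have hVm := (continuous_pairProd (ι := ι)).measurable
  have hpos : ∀ᵐ x ∂orthant ι, 0 < ∑ i, x i := by
    filter_upwards [ae_orthant_pos] with x hx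
    exact Finset.sum_pos (fun i _ => hx i) Finset.univ_nonempty
  -- No measure on the simplex of directions is used: a direction is represented by any point `x` of
  -- its ray. The substitution is `b = a * ∑ x i`, with `a` a redundant scale.
  have step1 : ∀ᵐ x ∂orthant ι, angularWeight x *
      ∫⁻ b, f ((b / ∑ i, x i) • x) ∂radialMeasure n =
      ∫⁻ a in Set.Ioi (0 : ℝ), ENNReal.ofReal ((∑ i, x i)⁻¹ * Real.exp (-1 / ∑ i, x i) *
        pairProd x * a ^ (n * n - 1) * Real.exp (-2 * (a * ∑ i, x i))) * f (a • x) := by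
    filter_upwards [hpos] with x hx
    set σ := ∑ i, x i with hσ
    rw [radialMeasure, lintegral_withDensity_eq_lintegral_mul _ (by fun_prop) (by fun_prop),
      ← lintegral_Ioi_comp_mul hx, ← mul_assoc, ← lintegral_const_mul' _ _ (by
        exact ENNReal.mul_ne_top ENNReal.ofReal_ne_top ENNReal.ofReal_ne_top)]
    refine setLIntegral_congr_fun measurableSet_Ioi fun a ha => ?_
    simp only [Pi.mul_apply]
    rw [mul_div_cancel_left₀ _ hx.ne', ← mul_assoc, angularWeight, ← hσ, ← hn]
    congr 1
    have hV := pairProd_nonneg x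
    rw [← ENNReal.ofReal_mul (by positivity), ← ENNReal.ofReal_mul (by positivity)]
    congr 1
    have : σ * (σ * a) ^ (n * n - 1) = σ ^ (n * n) * a ^ (n * n - 1) := by
      rw [mul_pow, ← mul_assoc, ← pow_succ', Nat.sub_add_cancel (Nat.mul_pos hn0 hn0)]
    calc _ = σ⁻¹ * Real.exp (-1 / σ) * pairProd x * (σ ^ (n * n))⁻¹ *
          (σ * (σ * a) ^ (n * n - 1)) * Real.exp (-2 * (σ * a)) := by ring
      _ = _ := by
          rw [this, mul_comm σ a]
          field_simp
  rw [lintegral_congr_ae step1, lintegral_lintegral_swap (by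
    refine Measurable.aemeasurable ?_
    fun_prop)]
  -- Substitute `y = a • x` at fixed `a`. The powers of `a` cancel, and the angular factor becomes
  -- an exponential density in `a` with mean `∑ y i`.
  have step2 : ∀ a ∈ Set.Ioi (0 : ℝ), ∫⁻ x, ENNReal.ofReal ((∑ i, x i)⁻¹ *
      Real.exp (-1 / ∑ i, x i) * pairProd x * a ^ (n * n - 1) *
        Real.exp (-2 * (a * ∑ i, x i))) * f (a • x) ∂orthant ι =
      ∫⁻ y, ENNReal.ofReal ((∑ i, y i)⁻¹ * Real.exp (-a / ∑ i, y i)) *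
        (f y * ENNReal.ofReal (pairProd y * Real.exp (-2 * ∑ i, y i))) ∂orthant ι := by
    intro a ha
    have ha' : 0 < a := ha
    have := lintegral_orthant_comp_smul ha' fun y : ι → ℝ =>
      ENNReal.ofReal (a ^ n) * (ENNReal.ofReal ((∑ i, y i)⁻¹ * Real.exp (-a / ∑ i, y i)) *
        (f y * ENNReal.ofReal (pairProd y * Real.exp (-2 * ∑ i, y i))))
    conv_rhs at this => rw [lintegral_const_mul' _ _ ENNReal.ofReal_ne_top]
    rw [← mul_assoc (ENNReal.ofReal _) (ENNReal.ofReal _), ← ENNReal.ofReal_mul (by positivity), ← hn,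
      inv_mul_cancel₀ (by positivity), ENNReal.ofReal_one, one_mul] at this
    rw [← this]
    refine lintegral_congr_ae ?_
    filter_upwards [hpos] with x hx
    have hsum : ∑ i, (a • x) i = a * ∑ i, x i := by simp [Finset.mul_sum]
    simp only [hsum, pairProd_smul ha'.le, ← hn]
    set σ := ∑ i, x i
    have hV := pairProd_nonneg x
    rw [mul_comm (f _), ← mul_assoc (ENNReal.ofReal _),
      ← ENNReal.ofReal_mul (by positivity), ← mul_assoc (ENNReal.ofReal _),
      ← ENNReal.ofReal_mul (by positivity)]
    congr 2
    have e1 : a ^ n * a ^ (n * n - n) = a * a ^ (n * n - 1) := by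
      rw [← pow_add, ← pow_succ', Nat.sub_add_cancel (Nat.mul_pos hn0 hn0),
        Nat.add_sub_cancel' (Nat.le_mul_of_pos_left n hn0)]
    have e2 : -a / (a * σ) = -1 / σ := by field_simp
    rw [e2, mul_inv]
    calc _ = σ⁻¹ * Real.exp (-1 / σ) * pairProd x * Real.exp (-2 * (a * σ)) *
          (a⁻¹ * (a * a ^ (n * n - 1))) := by
          rw [inv_mul_cancel_left₀ ha'.ne']; ring
      _ = _ := by rw [← e1]; ring
  rw [setLIntegral_congr_fun measurableSet_Ioi step2, lintegral_lintegral_swap (by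
    refine Measurable.aemeasurable ?_
    fun_prop)]
  refine lintegral_congr_ae ?_
  filter_upwards [hpos] with y hy
  -- The auxiliary scale integrates out to one.
  rw [lintegral_mul_const _ (by fun_prop), lintegral_inv_mul_exp_Ioi hy, one_mul]

/-- A radially nonincreasing weight lowers the law of the sum. -/
theorem lintegral_radial_correlation [Nonempty ι] {F : ℝ → ENNReal} (hF : Measurable F)
    (hFm : Monotone F) {w : (ι → ℝ) → ENNReal} (hw : Measurable w)
    (hws : ∀ x : ι → ℝ, ∀ s : ℝ, 1 ≤ s → w (s • x) ≤ w x) :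
    (∫⁻ x, F (∑ i, x i) * w x *
        ENNReal.ofReal (pairProd x * Real.exp (-2 * ∑ i, x i)) ∂orthant ι) *
      ∫⁻ x : ι → ℝ, ENNReal.ofReal (pairProd x * Real.exp (-2 * ∑ i, x i)) ∂orthant ι ≤
    (∫⁻ x, w x * ENNReal.ofReal (pairProd x * Real.exp (-2 * ∑ i, x i)) ∂orthant ι) *
      ∫⁻ x : ι → ℝ, F (∑ i, x i) *
        ENNReal.ofReal (pairProd x * Real.exp (-2 * ∑ i, x i)) ∂orthant ι := by
  set ρ := radialMeasure (Fintype.card ι) with hρ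
  have hs : ∀ᵐ b ∂ρ, b ∈ Set.Ioi (0 : ℝ) :=
    (withDensity_absolutelyContinuous _ _).ae_le (ae_restrict_mem measurableSet_Ioi)
  have hpos : ∀ᵐ x ∂orthant ι, 0 < ∑ i, x i := by
    filter_upwards [ae_orthant_pos] with x hx
    exact Finset.sum_pos (fun i _ => hx i) Finset.univ_nonempty
  have hsum : ∀ x : ι → ℝ, 0 < ∑ i, x i → ∀ b : ℝ, ∑ i, ((b / ∑ i, x i) • x) i = b := by
    intro x hx b
    simp only [Pi.smul_apply, smul_eq_mul, ← Finset.mul_sum]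
    exact div_mul_cancel₀ _ hx.ne'
  have hFsum : Measurable fun x : ι → ℝ => F (∑ i, x i) := by fun_prop
  have e1 : ∫⁻ x : ι → ℝ, ENNReal.ofReal (pairProd x * Real.exp (-2 * ∑ i, x i)) ∂orthant ι =
      (∫⁻ x : ι → ℝ, angularWeight x ∂orthant ι) * ρ Set.univ := by
    have := lintegral_polar (ι := ι) (f := fun _ => 1) measurable_const
    simp only [one_mul, lintegral_one] at this
    rw [this, lintegral_mul_const _ measurable_angularWeight]
  have e2 : ∫⁻ x : ι → ℝ, F (∑ i, x i) *
      ENNReal.ofReal (pairProd x * Real.exp (-2 * ∑ i, x i)) ∂orthant ι =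
      (∫⁻ x : ι → ℝ, angularWeight x ∂orthant ι) * ∫⁻ b, F b ∂ρ := by
    rw [lintegral_polar hFsum, ← lintegral_mul_const _ measurable_angularWeight]
    refine lintegral_congr_ae ?_
    filter_upwards [hpos] with x hx
    simp only [hsum x hx, hρ]
  -- On each ray the radial law is the same measure ρ, `F` is monotone and `w` antitone, so
  -- Chebyshev applies ray by ray before averaging over directions.
  have e3 : ρ Set.univ * ∫⁻ x, F (∑ i, x i) * w x *
        ENNReal.ofReal (pairProd x * Real.exp (-2 * ∑ i, x i)) ∂orthant ι ≤
      (∫⁻ b, F b ∂ρ) * ∫⁻ x, w x *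
        ENNReal.ofReal (pairProd x * Real.exp (-2 * ∑ i, x i)) ∂orthant ι := by
    have hwm : ∀ x : ι → ℝ, Measurable fun b : ℝ => w ((b / ∑ i, x i) • x) := fun x =>
      hw.comp (by fun_prop)
    have hjoint : Measurable fun x : ι → ℝ => ∫⁻ b, w ((b / ∑ i, x i) • x) ∂ρ := by
      have : Measurable fun p : (ι → ℝ) × ℝ => w ((p.2 / ∑ i, p.1 i) • p.1) :=
        hw.comp (by fun_prop)
      exact this.lintegral_prod_right'
    have hjoint2 : Measurable fun x : ι → ℝ =>
        ∫⁻ b, F (∑ i, ((b / ∑ i, x i) • x) i) * w ((b / ∑ i, x i) • x) ∂ρ := by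
      have : Measurable fun p : (ι → ℝ) × ℝ =>
          F (∑ i, ((p.2 / ∑ i, p.1 i) • p.1) i) * w ((p.2 / ∑ i, p.1 i) • p.1) :=
        ((hFsum.mul hw).comp (by fun_prop : Measurable fun p : (ι → ℝ) × ℝ =>
          (p.2 / ∑ i, p.1 i) • p.1))
      exact this.lintegral_prod_right'
    rw [lintegral_polar (f := fun x => F (∑ i, x i) * w x) (hFsum.mul hw), lintegral_polar hw,
      ← lintegral_const_mul _ (show Measurable fun x => angularWeight x * _ from
        measurable_angularWeight.mul hjoint2),
      ← lintegral_const_mul _ (show Measurable fun x => angularWeight x * _ from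
        measurable_angularWeight.mul hjoint)]
    refine lintegral_mono_ae ?_
    filter_upwards [hpos] with x hx
    rw [mul_left_comm, mul_left_comm _ (angularWeight x)]
    refine mul_le_mul' le_rfl ?_
    simp only [hsum x hx]
    refine lintegral_mul_le_of_monotoneOn_antitoneOn hs hF (hwm x) (hFm.monotoneOn _) ?_
    intro b hb c hc hbc
    have hb' : (0 : ℝ) < b := hb
    have : (c / ∑ i, x i) • x = (c / b) • ((b / ∑ i, x i) • x) := by
      rw [smul_smul]
      congr 1
      field_simp
    change w _ ≤ w _
    rw [this]
    exact hws _ _ ((one_le_div hb').2 hbc)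
  rw [e1, e2]
  calc _ = (∫⁻ x : ι → ℝ, angularWeight x ∂orthant ι) * (ρ Set.univ *
        ∫⁻ x, F (∑ i, x i) * w x *
          ENNReal.ofReal (pairProd x * Real.exp (-2 * ∑ i, x i)) ∂orthant ι) := by ring
    _ ≤ (∫⁻ x : ι → ℝ, angularWeight x ∂orthant ι) * ((∫⁻ b, F b ∂ρ) * ∫⁻ x, w x *
        ENNReal.ofReal (pairProd x * Real.exp (-2 * ∑ i, x i)) ∂orthant ι) := by gcongr
    _ = _ := by ring

end Polar

/-! ### Stochastic domination of the sum of the smallest eigenvalues -/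

section LowSum

variable {ι κ τ : Type*} [Fintype ι] [Fintype κ] [Fintype τ]

theorem pairProd_eq_prod_ite [DecidableEq ι] (x : ι → ℝ) :
    pairProd x = ∏ i, ∏ j, if i = j then 1 else |x i - x j| := by
  rw [pairProd, ← Finset.prod_product' (f := fun i j => if i = j then 1 else |x i - x j|)]
  refine (Finset.prod_congr rfl fun p hp => ?_).trans
    (Finset.prod_subset (fun p _ => by simp) fun p _ hp => ?_)
  · rw [if_neg (by simpa using hp)]
  · rw [if_pos (by simpa using hp)]

theorem pairProd_comp_equiv (σ : τ ≃ ι) (x : ι → ℝ) : pairProd (x ∘ σ) = pairProd x := by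
  classical
  rw [pairProd_eq_prod_ite, pairProd_eq_prod_ite, ← Equiv.prod_comp σ]
  refine Finset.prod_congr rfl fun i _ => ?_
  rw [← Equiv.prod_comp σ]
  simp

theorem pairProd_sumElim (u : ι → ℝ) (v : κ → ℝ) :
    pairProd (Sum.elim u v) = pairProd u * pairProd v * (∏ j, ∏ i, (v j - u i)) ^ 2 := by
  classical
  simp only [pairProd_eq_prod_ite, Fintype.prod_sum_type, Sum.elim_inl, Sum.elim_inr,
    Sum.inl.injEq, Sum.inr.injEq, reduceCtorEq, if_false, Finset.prod_mul_distrib]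
  rw [Finset.prod_comm (f := fun i j => |u i - v j|)]
  have h : ∏ j, ∏ i, |u i - v j| = ∏ j, ∏ i, |v j - u i| := by simp only [abs_sub_comm]
  rw [h, ← sq_abs (∏ j, ∏ i, (v j - u i))]
  simp only [Finset.abs_prod]
  ring

theorem vandermondeSq_eq_pairProd {N : ℕ} (x : Fin N → ℝ) : vandermondeSq x = pairProd x := by
  rw [pairProd_eq_prod_ite, vandermondeSq, ← sq_abs, sq]
  have h1 : ∀ i j, (if i = j then 1 else |x i - x j|) =
      (if i < j then |x j - x i| else 1) * if j < i then |x i - x j| else 1 := by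
    intro i j
    rcases lt_trichotomy i j with h | h | h
    · simp [h, h.ne, h.not_gt, abs_sub_comm]
    · simp [h]
    · simp [h, h.ne', h.not_gt]
  simp only [h1, Finset.prod_mul_distrib]
  rw [Finset.prod_comm (f := fun i j => if j < i then |x i - x j| else 1)]
  simp only [← Finset.prod_filter, Finset.abs_prod]
  congr 1 <;>
  · refine Finset.prod_congr rfl fun i _ => Finset.prod_congr ?_ fun _ _ => rfl
    ext; simp

theorem lintegral_pi_sum {α : Type*} [MeasurableSpace α] (ν : Measure α) [SigmaFinite ν]
    (σ : ι ⊕ κ ≃ τ) {h : (τ → α) → ENNReal} (hh : Measurable h) :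
    ∫⁻ x, h x ∂(Measure.pi fun _ : τ => ν) =
      ∫⁻ u, ∫⁻ v, h (Sum.elim u v ∘ σ.symm) ∂(Measure.pi fun _ : κ => ν)
        ∂(Measure.pi fun _ : ι => ν) := by
  have h1 := measurePreserving_piCongrLeft (α := fun _ : τ => α) (fun _ => ν) σ
  have h2 := measurePreserving_sumPiEquivProdPi_symm (ι := ι) (ι' := κ) (X := fun _ => α)
    (fun _ => ν)
  have h3 := h1.comp h2
  rw [← h3.lintegral_comp hh, lintegral_prod (fun p => h _) (hh.comp h3.measurable).aemeasurable]
  refine lintegral_congr fun u => lintegral_congr fun v => ?_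
  congr 1
  funext t
  obtain ⟨s, rfl⟩ := σ.surjective t
  simp only [Function.comp_apply, Equiv.symm_apply_apply]
  rw [MeasurableEquiv.coe_piCongrLeft, Equiv.piCongrLeft_apply_apply]
  cases s <;> rfl

/-- The contribution of the configurations whose lowest points are those indexed by `ι`. -/
theorem lintegral_low_block [Nonempty ι] (σ : ι ⊕ κ ≃ τ) {F : ℝ → ENNReal} (hF : Measurable F) :
    ∫⁻ x, Set.indicator {x : τ → ℝ | ∀ i j, x (σ (.inl i)) < x (σ (.inr j))}
        (fun x => F (∑ i, x (σ (.inl i)))) x *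
        ENNReal.ofReal (pairProd x * Real.exp (-∑ t, x t)) ∂orthant τ =
      ∫⁻ u : ι → ℝ, F (∑ i, u i) * radialWeight κ u *
        ENNReal.ofReal (pairProd u * Real.exp (-2 * ∑ i, u i)) ∂orthant ι := by
  have hV := (continuous_pairProd (ι := τ)).measurable
  have hset : MeasurableSet {x : τ → ℝ | ∀ i j, x (σ (.inl i)) < x (σ (.inr j))} := by
    have : {x : τ → ℝ | ∀ i j, x (σ (.inl i)) < x (σ (.inr j))} =
        ⋂ (i) (j), {x : τ → ℝ | x (σ (.inl i)) < x (σ (.inr j))} := by ext; simp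
    rw [this]
    exact MeasurableSet.iInter fun i => MeasurableSet.iInter fun j =>
      measurableSet_lt (measurable_pi_apply _) (measurable_pi_apply _)
  have hFs : Measurable fun x : τ → ℝ => F (∑ i, x (σ (.inl i))) := hF.comp (by fun_prop)
  have hd : Measurable fun x : τ → ℝ => ENNReal.ofReal (pairProd x * Real.exp (-∑ t, x t)) := by
    fun_prop
  rw [lintegral_pi_sum _ σ (h := fun x => _ * _) ((hFs.indicator hset).mul hd)]
  refine lintegral_congr_ae ?_
  filter_upwards [ae_orthant_pos] with u hu
  -- The larger points exceed the positive `u`, so confining them to the orthant is no restriction;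
  -- the translation-invariant integral in the weight is therefore the right one.
  have hinner : ∫⁻ v, crossDensity u v ∂orthant κ = ∫⁻ v : κ → ℝ, crossDensity u v := by
    rw [orthant_eq_restrict, ← lintegral_indicator
      (MeasurableSet.univ_pi fun _ => measurableSet_Ioi)]
    refine lintegral_congr fun v => ?_
    rw [Set.indicator_eq_self.2]
    intro v hv
    have : (u, v) ∈ {p : (ι → ℝ) × (κ → ℝ) | ∀ i j, p.1 i < p.2 j} := by
      by_contra hc
      exact hv (Set.indicator_of_notMem hc _)
    exact fun j _ => (hu (Classical.arbitrary ι)).trans (this _ j)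
  have hcm : Measurable fun v : κ → ℝ => crossDensity u v :=
    measurable_crossDensity.comp (by fun_prop : Measurable fun v : κ → ℝ => (u, v))
  have hpt : ∀ v : κ → ℝ, Set.indicator {x : τ → ℝ | ∀ i j, x (σ (.inl i)) < x (σ (.inr j))}
        (fun x => F (∑ i, x (σ (.inl i)))) (Sum.elim u v ∘ σ.symm) *
        ENNReal.ofReal (pairProd (Sum.elim u v ∘ σ.symm) *
          Real.exp (-∑ t, (Sum.elim u v ∘ σ.symm) t)) =
      F (∑ i, u i) * ENNReal.ofReal (pairProd u * Real.exp (-∑ i, u i)) * crossDensity u v := by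
    intro v
    have hs : ∑ t, (Sum.elim u v ∘ σ.symm) t = ∑ i, u i + ∑ j, v j := by
      rw [Function.comp_def, Equiv.sum_comp σ.symm (Sum.elim u v), Fintype.sum_sum_type]
      simp
    rw [pairProd_comp_equiv, pairProd_sumElim, hs, crossDensity]
    by_cases hv : ∀ i j, u i < v j
    · rw [Set.indicator_of_mem (by simpa using hv), Set.indicator_of_mem (by simpa using hv)]
      have h1 := pairProd_nonneg u
      have h2 := pairProd_nonneg v
      rw [mul_assoc (F _), ← ENNReal.ofReal_mul (by positivity)]
      congr 2
      · simp
      · rw [neg_add, Real.exp_add]; ring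
    · rw [Set.indicator_of_notMem (by simpa using hv), Set.indicator_of_notMem (by simpa using hv)]
      simp
  rw [lintegral_congr hpt, lintegral_const_mul _ hcm, hinner, radialWeight]
  have h1 := pairProd_nonneg u
  have : ENNReal.ofReal (pairProd u * Real.exp (-∑ i, u i)) =
      ENNReal.ofReal (Real.exp (∑ i, u i)) *
        ENNReal.ofReal (pairProd u * Real.exp (-2 * ∑ i, u i)) := by
    rw [← ENNReal.ofReal_mul (by positivity), mul_left_comm, ← Real.exp_add]
    congr 3
    ring
  rw [this]
  ring

/-- The sum of the `M` smallest points. -/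
def lowSum {N : ℕ} (M : ℕ) (y : Chamber N) : ℝ :=
  ∑ i with (i : Fin N).1 < M, y.1 i

theorem measurable_lowSum {N M : ℕ} : Measurable (lowSum M : Chamber N → ℝ) :=
  (continuous_finsetSum _ fun i _ => Chamber.continuous_apply i).measurable

theorem ae_laguerre_pos {N : ℕ} : ∀ᵐ x ∂laguerre N, ∀ i, 0 < x i :=
  (withDensity_absolutelyContinuous _ _).ae_le ae_orthant_pos

/-- The density vanishes wherever two coordinates coincide. -/
theorem ae_laguerre_injective {N : ℕ} : ∀ᵐ x ∂laguerre N, Function.Injective x := by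
  rw [laguerre, ae_withDensity_iff measurable_laguerreDensity]
  refine .of_forall fun x hx => ?_
  intro i j hij
  by_contra hne
  refine hx ?_
  rw [vandermondeSq_eq_pairProd, pairProd,
    Finset.prod_eq_zero (i := (i, j)) (by simpa using hne) (by simp [hij])]
  simp

/-- The lowest `M` points of a configuration without ties are indexed by a unique set. -/
theorem lowSum_sortChamber_eq {N M : ℕ} (hMN : M ≤ N) (F : ℝ → ENNReal) {x : Fin N → ℝ}
    (hpos : ∀ i, 0 < x i) (hinj : Function.Injective x) :
    F (lowSum M (sortChamber x)) = ∑ I ∈ (Finset.univ : Finset (Fin N)).powersetCard M,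
      Set.indicator {x : Fin N → ℝ | ∀ i ∈ I, ∀ j ∉ I, x i < x j}
        (fun x => F (∑ i ∈ I, x i)) x := by
  have hmax : (fun i => max (x i) 0) = x := by
    funext i; exact max_eq_left (hpos i).le
  set τ := Tuple.sort x with hτ
  have hmono : StrictMono (x ∘ τ) :=
    (Tuple.monotone_sort x).strictMono_of_injective (hinj.comp τ.injective)
  set I : Finset (Fin N) := (Finset.univ.filter fun i : Fin N => i.1 < M).map τ.toEmbedding with hI
  have hmem : ∀ i, i ∈ I ↔ (τ.symm i).1 < M := by
    intro i
    simp only [hI, Finset.mem_map_equiv, Finset.mem_filter, Finset.mem_univ, true_and]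
  have hcard : I.card = M := by
    rw [hI, Finset.card_map]
    simp [Fin.card_filter_val_lt, hMN]
  have hA : ∀ i ∈ I, ∀ j ∉ I, x i < x j := by
    intro i hi j hj
    rw [hmem] at hi hj
    have : τ.symm i < τ.symm j := by rw [Fin.lt_def]; omega
    simpa using hmono this
  rw [Finset.sum_eq_single I]
  · rw [Set.indicator_of_mem (show x ∈ {x : Fin N → ℝ | ∀ i ∈ I, ∀ j ∉ I, x i < x j} from hA)]
    rw [hI, Finset.sum_map, lowSum]
    simp only [sortChamber, hmax]
    rfl
  · intro J hJ hne
    refine Set.indicator_of_notMem (fun hB => hne ?_) _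
    have hJc : J.card = M := (Finset.mem_powersetCard.1 hJ).2
    by_contra
    have h1 : ¬ I ⊆ J := fun h => hne (Finset.eq_of_subset_of_card_le h (by omega)).symm
    have h2 : ¬ J ⊆ I := fun h => hne (Finset.eq_of_subset_of_card_le h (by omega))
    obtain ⟨i, hi, hi'⟩ := Finset.not_subset.1 h1
    obtain ⟨j, hj, hj'⟩ := Finset.not_subset.1 h2
    exact lt_asymm (hA i hi j hj') (hB j hj i hi')
  · intro h
    exact absurd (Finset.mem_powersetCard.2 ⟨Finset.subset_univ _, hcard⟩) h

/-- Decompose by the index set of the `M` lowest points. The density is symmetric, so all sets of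
size `M` contribute equally, whence the binomial coefficient. -/
theorem lintegral_lowSum_laguerre {M : ℕ} (hM : 0 < M) {F : ℝ → ENNReal} (hF : Measurable F) :
    ∫⁻ x, F (lowSum M (sortChamber x)) ∂laguerre (2 * M) =
      ((2 * M).choose M : ENNReal) * ∫⁻ u : Fin M → ℝ, F (∑ i, u i) * radialWeight (Fin M) u *
        ENNReal.ofReal (pairProd u * Real.exp (-2 * ∑ i, u i)) ∂orthant (Fin M) := by
  have : Nonempty (Fin M) := ⟨⟨0, hM⟩⟩
  have h1 : ∀ᵐ x ∂laguerre (2 * M), F (lowSum M (sortChamber x)) =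
      ∑ I ∈ (Finset.univ : Finset (Fin (2 * M))).powersetCard M,
        Set.indicator {x : Fin (2 * M) → ℝ | ∀ i ∈ I, ∀ j ∉ I, x i < x j}
          (fun x => F (∑ i ∈ I, x i)) x := by
    filter_upwards [ae_laguerre_pos, ae_laguerre_injective] with x hp hi
    exact lowSum_sortChamber_eq (by omega) F hp hi
  have hset : ∀ I : Finset (Fin (2 * M)),
      MeasurableSet {x : Fin (2 * M) → ℝ | ∀ i ∈ I, ∀ j ∉ I, x i < x j} := by
    intro I
    have : {x : Fin (2 * M) → ℝ | ∀ i ∈ I, ∀ j ∉ I, x i < x j} =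
        ⋂ (i) (_ : i ∈ I) (j) (_ : j ∉ I), {x : Fin (2 * M) → ℝ | x i < x j} := by
      ext; simp
    rw [this]
    exact MeasurableSet.iInter fun i => MeasurableSet.iInter fun _ => MeasurableSet.iInter fun j =>
      MeasurableSet.iInter fun _ => measurableSet_lt (measurable_pi_apply _) (measurable_pi_apply _)
  have hmeas : ∀ I : Finset (Fin (2 * M)), Measurable
      (Set.indicator {x : Fin (2 * M) → ℝ | ∀ i ∈ I, ∀ j ∉ I, x i < x j}
          (fun x => F (∑ i ∈ I, x i))) := fun I =>
    (hF.comp (by fun_prop)).indicator (hset I)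
  rw [lintegral_congr_ae h1, lintegral_finsetSum _ fun I _ => hmeas I]
  rw [Finset.sum_congr rfl (g := fun _ => ∫⁻ u : Fin M → ℝ, F (∑ i, u i) *
    radialWeight (Fin M) u * ENNReal.ofReal (pairProd u * Real.exp (-2 * ∑ i, u i))
      ∂orthant (Fin M))]
  · simp [Finset.card_powersetCard]
  intro I hI
  have hIc : I.card = M := (Finset.mem_powersetCard.1 hI).2
  have hIc' : Iᶜ.card = M := by rw [Finset.card_compl, hIc, Fintype.card_fin]; omega
  let e1 : Fin M ≃ {i // i ∈ I} := (finCongr hIc.symm).trans I.equivFin.symm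
  let e2 : Fin M ≃ {i // ¬ i ∈ I} := ((finCongr hIc'.symm).trans Iᶜ.equivFin.symm).trans
    (Equiv.subtypeEquivRight fun i => Finset.mem_compl)
  let σ : Fin M ⊕ Fin M ≃ Fin (2 * M) := (e1.sumCongr e2).trans (Equiv.sumCompl (· ∈ I))
  have hl : ∀ i, σ (.inl i) = e1 i := fun i => rfl
  have hr : ∀ i, σ (.inr i) = e2 i := fun i => rfl
  rw [← lintegral_low_block σ hF, laguerre,
    lintegral_withDensity_eq_lintegral_mul _ measurable_laguerreDensity (hmeas I)]
  refine lintegral_congr fun x => ?_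
  rw [Pi.mul_apply, mul_comm, vandermondeSq_eq_pairProd]
  congr 1
  have hsum : ∑ i, x (σ (.inl i)) = ∑ i ∈ I, x i := by
    simp only [hl]
    rw [Equiv.sum_comp e1 (fun i => x i), Finset.sum_coe_sort I x]
  have hiff : (∀ i j, x (σ (.inl i)) < x (σ (.inr j))) ↔ ∀ i ∈ I, ∀ j ∉ I, x i < x j := by
    simp only [hl, hr]
    rw [e1.forall_congr_left, Subtype.forall]
    refine forall₂_congr fun i hi => ?_
    rw [e2.forall_congr_left, Subtype.forall]
    simp
  by_cases hx : ∀ i ∈ I, ∀ j ∉ I, x i < x j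
  · rw [Set.indicator_of_mem (by exact hx), Set.indicator_of_mem (by exact hiff.2 hx), hsum]
  · rw [Set.indicator_of_notMem (by exact hx),
      Set.indicator_of_notMem (fun h => hx (hiff.1 (by exact h)))]

/-- The substitution `x = 2 u`. Its constant combines `2 ^ M` from Lebesgue measure with `2 ^ (M * M
- M)` from the squared Vandermonde. -/
theorem lintegral_half_sum_laguerre {M : ℕ} {F : ℝ → ENNReal} (hF : Measurable F) :
    ∫⁻ x, F (1 / 2 * ∑ i, x i) ∂laguerre M = ENNReal.ofReal (2 ^ (M * M)) *
      ∫⁻ u : Fin M → ℝ, F (∑ i, u i) *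
        ENNReal.ofReal (pairProd u * Real.exp (-2 * ∑ i, u i)) ∂orthant (Fin M) := by
  have hV := (continuous_pairProd (ι := Fin M)).measurable
  rw [laguerre, lintegral_withDensity_eq_lintegral_mul _ measurable_laguerreDensity
    (show Measurable fun x : Fin M → ℝ => F (1 / 2 * ∑ i, x i) from hF.comp (by fun_prop))]
  have h := lintegral_orthant_comp_smul (ι := Fin M) two_pos fun x =>
    F (1 / 2 * ∑ i, x i) * ENNReal.ofReal (pairProd x * Real.exp (-∑ i, x i))
  have h2 : ∀ u : Fin M → ℝ, F (1 / 2 * ∑ i, ((2 : ℝ) • u) i) *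
      ENNReal.ofReal (pairProd ((2 : ℝ) • u) * Real.exp (-∑ i, ((2 : ℝ) • u) i)) =
      ENNReal.ofReal (2 ^ (M * M - M)) * (F (∑ i, u i) *
        ENNReal.ofReal (pairProd u * Real.exp (-2 * ∑ i, u i))) := by
    intro u
    have hs : ∑ i, ((2 : ℝ) • u) i = 2 * ∑ i, u i := by simp [Finset.mul_sum]
    rw [hs, pairProd_smul zero_le_two, Fintype.card_fin, mul_assoc (2 ^ _),
      ENNReal.ofReal_mul (by positivity)]
    rw [show 1 / 2 * (2 * ∑ i, u i) = ∑ i, u i by ring, neg_mul]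
    ring
  rw [lintegral_congr h2, lintegral_const_mul' _ _ ENNReal.ofReal_ne_top, Fintype.card_fin] at h
  have h3 : ENNReal.ofReal (2 ^ M) * ENNReal.ofReal ((2 ^ M)⁻¹) = 1 := by
    rw [← ENNReal.ofReal_mul (by positivity), mul_inv_cancel₀ (by positivity), ENNReal.ofReal_one]
  have h4 : ENNReal.ofReal (2 ^ (M * M)) =
      ENNReal.ofReal (2 ^ M) * ENNReal.ofReal (2 ^ (M * M - M)) := by
    rw [← ENNReal.ofReal_mul (by positivity), ← pow_add,
      Nat.add_sub_cancel' (Nat.le_mul_self M)]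
  rw [h4, mul_assoc, h, ← mul_assoc, h3, one_mul]
  refine lintegral_congr fun x => ?_
  rw [Pi.mul_apply, mul_comm, vandermondeSq_eq_pairProd]

/-- Both masses are the same integrals with `F = 1`, so all constants match and only the correlation
inequality for the radial weight remains. -/
theorem laguerreMass_mul_lintegral_lowSum_le {M : ℕ} (hM : 0 < M) {F : ℝ → ENNReal}
    (hF : Measurable F) (hFm : Monotone F) :
    ENNReal.ofReal (laguerreMass M) * ∫⁻ x, F (lowSum M (sortChamber x)) ∂laguerre (2 * M) ≤
      ENNReal.ofReal (laguerreMass (2 * M)) * ∫⁻ x, F (1 / 2 * ∑ i, x i) ∂laguerre M := by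
  have : Nonempty (Fin M) := ⟨⟨0, hM⟩⟩
  have h1 := lintegral_lowSum_laguerre hM (F := fun _ => 1) measurable_const
  have h2 := lintegral_half_sum_laguerre (M := M) (F := fun _ => 1) measurable_const
  simp only [lintegral_one, laguerre_univ, one_mul] at h1 h2
  rw [h1, h2, lintegral_lowSum_laguerre hM hF, lintegral_half_sum_laguerre hF]
  have h := lintegral_radial_correlation (ι := Fin M) hF hFm (measurable_radialWeight (κ := Fin M))
    (fun x s hs => radialWeight_smul_le rfl x hs)
  set c := ENNReal.ofReal (2 ^ (M * M))
  calc _ = c * ((2 * M).choose M : ENNReal) * ((∫⁻ u : Fin M → ℝ, F (∑ i, u i) *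
        radialWeight (Fin M) u * ENNReal.ofReal (pairProd u * Real.exp (-2 * ∑ i, u i))
          ∂orthant (Fin M)) * ∫⁻ x : Fin M → ℝ,
        ENNReal.ofReal (pairProd x * Real.exp (-2 * ∑ i, x i)) ∂orthant (Fin M)) := by ring
    _ ≤ _ := mul_le_mul' le_rfl h
    _ = _ := by ring

/-- The sum of the `M` smallest eigenvalues of a `2M × 2M` complex Wishart matrix is stochastically
dominated by half the squared Frobenius norm of an `M × M` Gaussian matrix. -/
theorem lintegral_lowSum_gramEigs_le {m n : Type*} [Fintype m] [Fintype n] [DecidableEq m]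
    {M : ℕ} (hM : 0 < M) (e : Fin (2 * M) ≃ m)
    (hn : Fintype.card n = 2 * M) {F : ℝ → ENNReal} (hF : Measurable F) (hFm : Monotone F) :
    ∫⁻ z, F (lowSum M (gramEigs e z)) ∂gaussPi (m × n) ≤
      ∫⁻ z, F (1 / 2 * ∑ i, ‖z i‖ ^ 2) ∂gaussPi (Fin M × Fin M) := by
  have hG : Measurable fun y : Chamber (2 * M) => F (lowSum M y) := hF.comp measurable_lowSum
  have hG' : Measurable fun y : Chamber M => F (1 / 2 * ∑ i, y.1 i) :=
    hF.comp (by fun_prop)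
  have h1 : ENNReal.ofReal (laguerreMass (2 * M)) *
      ∫⁻ z, F (lowSum M (gramEigs e z)) ∂gaussPi (m × n) =
      ∫⁻ x, F (lowSum M (sortChamber x)) ∂laguerre (2 * M) := by
    have := congrArg (fun ν => ∫⁻ y, F (lowSum M y) ∂ν) (laguerreMass_smul_map_gramEigs e hn)
    simp only [lintegral_smul_measure, smul_eq_mul] at this
    rwa [lintegral_map hG (measurable_gramEigs e), lintegral_map hG measurable_sortChamber] at this
  have h2 : ENNReal.ofReal (laguerreMass M) *
      ∫⁻ z, F (1 / 2 * ∑ i, ‖z i‖ ^ 2) ∂gaussPi (Fin M × Fin M) =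
      ∫⁻ x, F (1 / 2 * ∑ i, x i) ∂laguerre M := by
    have := congrArg (fun ν => ∫⁻ y, F (1 / 2 * ∑ i, y.1 i) ∂ν)
      (laguerreMass_smul_map_gramEigs (n := Fin M) (Equiv.refl (Fin M)) (Fintype.card_fin M))
    simp only [lintegral_smul_measure, smul_eq_mul] at this
    rw [lintegral_map hG' (measurable_gramEigs _), lintegral_map hG' measurable_sortChamber] at this
    simp only [sum_gramEigs] at this
    rw [this]
    refine lintegral_congr_ae ?_
    filter_upwards [ae_laguerre_pos] with x hx
    have hs := congrFun (psumSeq_sortChamber (fun i => (hx i).le)) 1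
    simp only [psumSeq, pow_one] at hs
    rw [hs]
  have h3 := laguerreMass_mul_lintegral_lowSum_le hM hF hFm
  rw [← h1, ← h2, mul_left_comm] at h3
  have hne : ∀ N, ENNReal.ofReal (laguerreMass N) ≠ 0 := fun N => by
    simpa using laguerreMass_pos
  exact (ENNReal.mul_le_mul_iff_right (hne M) ENNReal.ofReal_ne_top).1
    ((ENNReal.mul_le_mul_iff_right (hne (2 * M)) ENNReal.ofReal_ne_top).1 h3)

end LowSum

/-! ### Unitary invariance of Gaussian matrices -/

section Invariance

variable {ι : Type*} [Fintype ι]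

theorem gaussPi_eq_withDensity :
    gaussPi ι = volume.withDensity fun z : ι → ℂ =>
      ENNReal.ofReal (∏ i, (Real.pi⁻¹ * Real.exp (-‖z i‖ ^ 2))) := by
  have hdens : Integrable (fun z : ℂ => Real.pi⁻¹ * Real.exp (-‖z‖ ^ 2)) := by
    refine .of_integral_ne_zero ?_
    have := integral_stdComplexGaussian (fun _ => (1 : ℝ))
    simp only [integral_const, probReal_univ, smul_eq_mul, mul_one] at this
    rw [← this]
    exact one_ne_zero
  symm
  rw [gaussPi]
  refine (Measure.pi_eq fun s hs => ?_).symm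
  have hr : (volume : Measure (ι → ℂ)).restrict (Set.univ.pi s) =
      Measure.pi fun i => (volume : Measure ℂ).restrict (s i) :=
    Measure.restrict_pi_pi (fun _ => volume) s
  rw [withDensity_apply _ (MeasurableSet.univ_pi hs), hr,
    ← ofReal_integral_eq_lintegral_ofReal
      (Integrable.fintype_prod (f := fun _ z => Real.pi⁻¹ * Real.exp (-‖z‖ ^ 2))
        fun i => hdens.mono_measure Measure.restrict_le_self)
      (.of_forall fun z => Finset.prod_nonneg fun i _ => by positivity),
    integral_fintype_prod_eq_prod (f := fun _ z => Real.pi⁻¹ * Real.exp (-‖z‖ ^ 2)),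
    ENNReal.ofReal_prod_of_nonneg fun i _ => integral_nonneg fun z => by positivity]
  refine Finset.prod_congr rfl fun i _ => ?_
  rw [stdComplexGaussian_eq_withDensity, withDensity_apply _ (hs i),
    ofReal_integral_eq_lintegral_ofReal (hdens.mono_measure Measure.restrict_le_self)
      (.of_forall fun z => by positivity)]

/-- The standard complex Gaussian law is invariant under linear isometries. -/
theorem lintegral_gaussPi_comp_isometry (f : (ι → ℂ) →ₗ[ℂ] ι → ℂ)
    (hf : ∀ z, ∑ i, ‖f z i‖ ^ 2 = ∑ i, ‖z i‖ ^ 2) {h : (ι → ℂ) → ENNReal} (hh : Measurable h) :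
    ∫⁻ z, h (f z) ∂gaussPi ι = ∫⁻ z, h z ∂gaussPi ι := by
  set g : (ι → ℂ) →ₗ[ℝ] ι → ℂ := f.restrictScalars ℝ with hg
  have hker : LinearMap.ker g = ⊥ := by
    rw [LinearMap.ker_eq_bot']
    intro z hz
    have h0 : ∑ i, ‖z i‖ ^ 2 = 0 := by
      rw [← hf z, show f z = 0 from hz]; simp
    funext i
    have := (Finset.sum_eq_zero_iff_of_nonneg fun i _ => by positivity).1 h0 i (Finset.mem_univ i)
    simpa using this
  have hdet : LinearMap.det g ≠ 0 := by
    intro h0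
    exact (LinearMap.bot_lt_ker_of_det_eq_zero h0).ne' hker
  have hmap := Measure.map_linearMap_addHaar_eq_smul_addHaar (volume : Measure (ι → ℂ)) hdet
  have hgm : Measurable g := g.continuous_of_finiteDimensional.measurable
  set c := ENNReal.ofReal |(LinearMap.det g)⁻¹| with hc
  set ρ : (ι → ℂ) → ENNReal := fun z =>
    ENNReal.ofReal (∏ i, (Real.pi⁻¹ * Real.exp (-‖z i‖ ^ 2))) with hρ
  have hρm : Measurable ρ := by fun_prop
  have hρg : ∀ z, ρ (g z) = ρ z := by
    intro z
    simp only [hρ, Finset.prod_mul_distrib, ← Real.exp_sum, Finset.sum_neg_distrib]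
    rw [show ∑ i, ‖g z i‖ ^ 2 = ∑ i, ‖z i‖ ^ 2 from hf z]
  have key : ∀ h : (ι → ℂ) → ENNReal, Measurable h →
      ∫⁻ z, h (g z) ∂gaussPi ι = c * ∫⁻ z, h z ∂gaussPi ι := by
    intro h hh
    rw [gaussPi_eq_withDensity, lintegral_withDensity_eq_lintegral_mul _ hρm
      (show Measurable fun z => h (g z) from hh.comp hgm),
      lintegral_withDensity_eq_lintegral_mul _ hρm hh]
    have e : ∀ z, (ρ * fun z => h (g z)) z = (ρ * h) (g z) := fun z => by
      simp only [Pi.mul_apply, hρg]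
    rw [← smul_eq_mul c, ← lintegral_smul_measure, ← hmap, lintegral_map (hρm.mul hh) hgm]
    exact lintegral_congr e
  -- The density is invariant and Lebesgue measure changes by a constant. Testing with `1` shows
  -- that this constant is one, so no determinant has to be computed.
  have h1 := key (fun _ => 1) measurable_const
  simp only [lintegral_one, measure_univ, mul_one] at h1
  have := key h hh
  rwa [← h1, one_mul] at this

variable {r c : Type*} [Fintype r] [Fintype c]

theorem sum_norm_sq_eq_trace (z : r × c → ℂ) :
    ((∑ p, ‖z p‖ ^ 2 : ℝ) : ℂ) = trace (toMatrix z * (toMatrix z)ᴴ) := by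
  rw [Fintype.sum_prod_type]
  push_cast
  simp only [trace, diag_apply, mul_apply, conjTranspose_apply, toMatrix, of_apply]
  refine Finset.sum_congr rfl fun i _ => Finset.sum_congr rfl fun j _ => ?_
  exact (Complex.mul_conj' _).symm

theorem re_trace_mul_conjTranspose (X : Matrix r c ℂ) :
    (trace (X * Xᴴ)).re = ∑ i, ∑ j, ‖X i j‖ ^ 2 := by
  have := sum_norm_sq_eq_trace (fun p : r × c => X p.1 p.2)
  rw [show toMatrix (fun p : r × c => X p.1 p.2) = X from rfl] at this
  rw [← this, Complex.ofReal_re, Fintype.sum_prod_type]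

/-- Multiplication by a matrix from the left, on matrices written as tuples. -/
def leftMul (V : Matrix r r ℂ) : (r × c → ℂ) →ₗ[ℂ] r × c → ℂ where
  toFun z p := (V * toMatrix z) p.1 p.2
  map_add' z w := by
    funext p
    simp [toMatrix, mul_apply, mul_add, Finset.sum_add_distrib]
  map_smul' a z := by
    funext p
    simp [toMatrix, mul_apply, Finset.mul_sum, mul_left_comm]

theorem toMatrix_leftMul {r c : Type*} [Fintype r] (V : Matrix r r ℂ) (z : r × c → ℂ) :
    toMatrix (leftMul V z) = V * toMatrix z := rfl

theorem lintegral_gaussPi_leftMul [DecidableEq r] {V : Matrix r r ℂ} (hV : Vᴴ * V = 1)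
    {h : (r × c → ℂ) → ENNReal} (hh : Measurable h) :
    ∫⁻ z, h (leftMul V z) ∂gaussPi (r × c) = ∫⁻ z, h z ∂gaussPi (r × c) := by
  refine lintegral_gaussPi_comp_isometry _ (fun z => ?_) hh
  refine Complex.ofReal_injective ?_
  rw [sum_norm_sq_eq_trace, sum_norm_sq_eq_trace, toMatrix_leftMul, conjTranspose_mul,
    trace_mul_comm, Matrix.mul_assoc, ← Matrix.mul_assoc Vᴴ, hV, Matrix.one_mul, trace_mul_comm]

end Invariance

/-! ### Isometries, projections and polar decomposition -/

section Isometries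

variable {r c c' : Type*} [Fintype r] [Fintype c] [DecidableEq r] [DecidableEq c]

/-- The inclusion of the first block of coordinates. -/
def blockIsometry (σ : c ⊕ c' ≃ r) : Matrix r c ℂ :=
  (1 : Matrix r r ℂ).submatrix id (σ ∘ Sum.inl)

theorem mul_blockIsometry {r c c' : Type*} [Fintype r] [DecidableEq r] (σ : c ⊕ c' ≃ r)
    {m : Type*} (V : Matrix m r ℂ) :
    V * blockIsometry σ = V.submatrix id (σ ∘ Sum.inl) := by
  ext i j
  simp [blockIsometry, mul_apply, one_apply]

theorem conjTranspose_blockIsometry_mul {r c c' : Type*} [Fintype r] [DecidableEq r]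
    (σ : c ⊕ c' ≃ r) {m : Type*} (W : Matrix r m ℂ) :
    (blockIsometry σ)ᴴ * W = W.submatrix (σ ∘ Sum.inl) id := by
  rw [← conjTranspose_conjTranspose ((blockIsometry σ)ᴴ * W), conjTranspose_mul,
    conjTranspose_conjTranspose, mul_blockIsometry, conjTranspose_submatrix,
    conjTranspose_conjTranspose]

theorem conjTranspose_blockIsometry_mul_self {r c c' : Type*} [Fintype r] [DecidableEq r]
    [DecidableEq c] (σ : c ⊕ c' ≃ r) :
    (blockIsometry σ)ᴴ * blockIsometry σ = 1 := by
  rw [conjTranspose_blockIsometry_mul, blockIsometry, submatrix_submatrix]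
  simp only [Function.id_comp, Function.comp_id]
  exact submatrix_one _ (σ.injective.comp Sum.inl_injective)

theorem trace_one_sub_blockIsometry_mul {r c c' m : Type*} [Fintype r] [Fintype c] [Fintype c']
    [DecidableEq r] [Fintype m] (σ : c ⊕ c' ≃ r)
    (W : Matrix r m ℂ) :
    (trace ((1 - blockIsometry σ * (blockIsometry σ)ᴴ) * (W * Wᴴ))).re =
      ∑ p : c' × m, ‖W (σ (.inr p.1)) p.2‖ ^ 2 := by
  have h2 : trace (blockIsometry σ * (blockIsometry σ)ᴴ * (W * Wᴴ)) =
      trace ((blockIsometry σ)ᴴ * W * ((blockIsometry σ)ᴴ * W)ᴴ) := by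
    rw [conjTranspose_mul, conjTranspose_conjTranspose, Matrix.mul_assoc, trace_mul_comm]
    simp only [Matrix.mul_assoc]
  rw [Matrix.sub_mul, Matrix.one_mul, trace_sub, Complex.sub_re, h2,
    re_trace_mul_conjTranspose, re_trace_mul_conjTranspose, conjTranspose_blockIsometry_mul, ← Equiv.sum_comp σ, Fintype.sum_sum_type,
    Fintype.sum_prod_type]
  simp

/-- Every isometry extends to a unitary. -/
theorem exists_unitary_mul_blockIsometry {r c c' : Type*} [Fintype r] [DecidableEq r]
    [DecidableEq c] (σ : c ⊕ c' ≃ r) {Q : Matrix r c ℂ} (hQ : Qᴴ * Q = 1) :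
    ∃ V : Matrix r r ℂ, Vᴴ * V = 1 ∧ V * Vᴴ = 1 ∧ V * blockIsometry σ = Q := by
  let v : r → EuclideanSpace ℂ r := fun i => WithLp.toLp 2 fun k =>
    Sum.elim (fun j => Q k j) (fun _ => 0) (σ.symm i)
  let s : Set r := Set.range (σ ∘ Sum.inl)
  have hinner : ∀ i j : c, inner ℂ (v (σ (.inl i))) (v (σ (.inl j))) = (1 : Matrix c c ℂ) i j := by
    intro i j
    rw [← hQ, mul_apply, PiLp.inner_apply]
    simp [v, mul_comm]
  have hv : Orthonormal ℂ (s.domRestrict v) := by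
    rw [orthonormal_iff_ite]
    rintro ⟨_, i, rfl⟩ ⟨_, j, rfl⟩
    have := hinner i j
    rw [one_apply] at this
    simpa using this
  obtain ⟨b, hb⟩ := hv.exists_orthonormalBasis_extension_of_card_eq (by simp)
  refine ⟨Matrix.of fun k i => b i k, ?_, ?_, ?_⟩
  · ext i j
    have := orthonormal_iff_ite.1 b.orthonormal i j
    rw [PiLp.inner_apply] at this
    rw [mul_apply, one_apply, ← this]
    simp [mul_comm]
  · rw [mul_eq_one_comm]
    ext i j
    have := orthonormal_iff_ite.1 b.orthonormal i j
    rw [PiLp.inner_apply] at this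
    rw [mul_apply, one_apply, ← this]
    simp [mul_comm]
  · rw [mul_blockIsometry]
    ext k j
    simp [hb (σ (.inl j)) ⟨j, rfl⟩, v]

/-- The orthogonal projection onto the column space of a matrix of full column rank. -/
noncomputable def colProj (A : Matrix r c ℂ) : Matrix r r ℂ := A * (Aᴴ * A)⁻¹ * Aᴴ

theorem colProj_unitary_mul {V : Matrix r r ℂ} (hV : Vᴴ * V = 1) (A : Matrix r c ℂ) :
    colProj (V * A) = V * colProj A * Vᴴ := by
  rw [colProj, colProj, conjTranspose_mul]
  have : Aᴴ * Vᴴ * (V * A) = Aᴴ * A := by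
    rw [Matrix.mul_assoc, ← Matrix.mul_assoc Vᴴ, hV, Matrix.one_mul]
  rw [this]
  simp only [Matrix.mul_assoc]

open scoped ComplexOrder in
-- The inverse square root, built in an eigenbasis.
theorem exists_isHermitian_conj_eq_one {S : Matrix c c ℂ} (hS : S.PosDef) :
    ∃ T : Matrix c c ℂ, Tᴴ = T ∧ T * S * T = 1 := by
  set U : Matrix c c ℂ := ↑hS.1.eigenvectorUnitary with hU
  have hUU : Uᴴ * U = 1 := by
    simpa [star_eq_conjTranspose] using Unitary.coe_star_mul_self hS.1.eigenvectorUnitary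
  have hUU' : U * Uᴴ = 1 := by
    simpa [star_eq_conjTranspose] using Unitary.coe_mul_star_self hS.1.eigenvectorUnitary
  have hSU : S = U * diagonal (fun i => (hS.1.eigenvalues i : ℂ)) * Uᴴ :=
    eq_unitary_conj_diagonal hS.1
  set d : c → ℂ := fun i => ((√(hS.1.eigenvalues i))⁻¹ : ℝ) with hd
  have hdd : diagonal d * diagonal (fun i => (hS.1.eigenvalues i : ℂ)) * diagonal d = 1 := by
    rw [diagonal_mul_diagonal, diagonal_mul_diagonal, ← diagonal_one]
    congr 1
    funext i
    have hp := hS.eigenvalues_pos i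
    simp only [hd]
    rw [← Complex.ofReal_mul, ← Complex.ofReal_mul]
    have hs : √(hS.1.eigenvalues i) ≠ 0 := (Real.sqrt_pos.2 hp).ne'
    rw [show (√(hS.1.eigenvalues i))⁻¹ * hS.1.eigenvalues i * (√(hS.1.eigenvalues i))⁻¹ = 1 by
      nth_rewrite 2 [← Real.mul_self_sqrt hp.le]
      field_simp]
    simp
  refine ⟨U * diagonal d * Uᴴ, ?_, ?_⟩
  · rw [conjTranspose_mul, conjTranspose_mul, conjTranspose_conjTranspose,
      diagonal_conjTranspose, ← Matrix.mul_assoc]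
    congr 3
    funext i
    simp [hd]
  · calc U * diagonal d * Uᴴ * S * (U * diagonal d * Uᴴ)
        = U * diagonal d * (Uᴴ * U) * diagonal (fun i => (hS.1.eigenvalues i : ℂ)) * (Uᴴ * U) *
          diagonal d * Uᴴ := by
          conv_lhs => rw [hSU]
          simp only [Matrix.mul_assoc]
      _ = U * (diagonal d * diagonal (fun i => (hS.1.eigenvalues i : ℂ)) * diagonal d) * Uᴴ := by
          rw [hUU]; simp only [Matrix.mul_assoc, Matrix.one_mul]
      _ = 1 := by rw [hdd, Matrix.mul_one, hUU']

open scoped ComplexOrder in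
/-- The polar decomposition of a matrix of full column rank. -/
theorem exists_isometry_of_isUnit {r c : Type*} [Fintype r] [Fintype c] [DecidableEq c]
    {A : Matrix r c ℂ} (hA : IsUnit (Aᴴ * A)) :
    ∃ Q : Matrix r c ℂ, Qᴴ * Q = 1 ∧ colProj A = Q * Qᴴ ∧ A * Aᴴ = Q * (Aᴴ * A) * Qᴴ := by
  have hpos : (Aᴴ * A).PosDef :=
    (posSemidef_conjTranspose_mul_self A).posDef_iff_isUnit.2 hA
  obtain ⟨T, hT, hTS⟩ := exists_isHermitian_conj_eq_one hpos
  -- The isometric factor is A(A†A)^(-1/2).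
  refine ⟨A * T, ?_, ?_, ?_⟩
  · rw [conjTranspose_mul, hT, ← hTS]
    simp only [Matrix.mul_assoc]
  · have hinv : (Aᴴ * A)⁻¹ = T * T := by
      refine Matrix.inv_eq_right_inv ?_
      have h1 : (Aᴴ * A * T) * T = 1 := by
        rw [mul_eq_one_comm, ← Matrix.mul_assoc]; exact hTS
      rw [← Matrix.mul_assoc]; exact h1
    rw [colProj, hinv, conjTranspose_mul, hT]
    simp only [Matrix.mul_assoc]
  · rw [conjTranspose_mul, hT]
    calc A * Aᴴ = A * (T * (Aᴴ * A) * T) * Aᴴ := by rw [hTS, Matrix.mul_one]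
      _ = _ := by simp only [Matrix.mul_assoc]

theorem trace_one_sub_proj_mul_nonneg {Q : Matrix r c ℂ} (hQ : Qᴴ * Q = 1) {m : Type*} [Fintype m]
    (N : Matrix r m ℂ) : 0 ≤ (trace ((1 - Q * Qᴴ) * (N * Nᴴ))).re := by
  set R : Matrix r r ℂ := 1 - Q * Qᴴ with hR
  have hRh : Rᴴ = R := by simp [hR, conjTranspose_sub, conjTranspose_mul]
  have hRR : R * R = R := by
    have : Q * Qᴴ * (Q * Qᴴ) = Q * Qᴴ := by
      rw [Matrix.mul_assoc, ← Matrix.mul_assoc Qᴴ, hQ, Matrix.one_mul]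
    rw [hR, Matrix.mul_sub, Matrix.sub_mul, Matrix.sub_mul, this]
    simp
  have h : trace (R * (N * Nᴴ)) = trace (R * N * (R * N)ᴴ) := by
    rw [conjTranspose_mul, hRh, ← Matrix.mul_assoc (R * N), trace_mul_comm _ R]
    simp only [← Matrix.mul_assoc, hRR]
  rw [h, re_trace_mul_conjTranspose]
  positivity

end Isometries

/-! ### From the Gaussian norm to the distance of column spaces -/

section Jensen

variable {r c c' : Type*} [Fintype r] [Fintype c] [Fintype c'] [DecidableEq r] [DecidableEq c]

theorem measurable_mul_apply {α m n k : Type*} [MeasurableSpace α] [Fintype n]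
    {A : α → Matrix m n ℂ} {B : α → Matrix n k ℂ} (hA : ∀ i j, Measurable fun a => A a i j)
    (hB : ∀ i j, Measurable fun a => B a i j) (i : m) (j : k) :
    Measurable fun a => (A a * B a) i j := by
  simp only [mul_apply]
  exact Finset.measurable_sum _ fun l _ => (hA i l).mul (hB l j)

theorem measurable_toMatrix_apply {r c : Type*} (i : r) (j : c) :
    Measurable fun z : r × c → ℂ => toMatrix z i j := measurable_pi_apply (i, j)

theorem measurable_conjTranspose_toMatrix_apply {r c : Type*} (i : c) (j : r) :
    Measurable fun z : r × c → ℂ => (toMatrix z)ᴴ i j :=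
  Complex.continuous_conj.measurable.comp (measurable_pi_apply (j, i))

theorem measurable_colProj_apply {r c : Type*} [Fintype r] [Fintype c] [DecidableEq c] (i j : r) :
    Measurable fun z : r × c → ℂ => colProj (toMatrix z) i j := by
  have hA : Continuous fun z : r × c → ℂ => toMatrix z :=
    continuous_matrix fun i j => continuous_apply (i, j)
  have hS : Continuous fun z : r × c → ℂ => (toMatrix z)ᴴ * toMatrix z :=
    hA.matrix_conjTranspose.matrix_mul hA
  have hinv : ∀ k l, Measurable fun z : r × c → ℂ => ((toMatrix z)ᴴ * toMatrix z)⁻¹ k l := by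
    intro k l
    simp only [Matrix.inv_def, Matrix.smul_apply, Ring.inverse_eq_inv', smul_eq_mul]
    exact hS.matrix_det.measurable.inv.mul (hS.matrix_adjugate.matrix_elem k l).measurable
  exact measurable_mul_apply (measurable_mul_apply measurable_toMatrix_apply hinv)
    measurable_conjTranspose_toMatrix_apply i j

theorem measurable_re_trace {α m : Type*} [MeasurableSpace α] [Fintype m]
    {A : α → Matrix m m ℂ} (hA : ∀ i j, Measurable fun a => A a i j) :
    Measurable fun a => (trace (A a)).re :=
  Complex.measurable_re.comp (Finset.measurable_sum _ fun i _ => hA i i)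

theorem measurable_trace_colProj_prod {r c : Type*} [Fintype r] [Fintype c] [DecidableEq r]
    [DecidableEq c] {α : Type*} [MeasurableSpace α] {B : α → Matrix r r ℂ}
    (hB : ∀ i j, Measurable fun w => B w i j) :
    Measurable fun p : (r × c → ℂ) × α => (trace ((1 - colProj (toMatrix p.1)) * B p.2)).re :=
  measurable_re_trace (measurable_mul_apply
    (fun i j => ((measurable_colProj_apply i j).comp measurable_fst).const_sub ((1 : Matrix r r ℂ) i j))
    fun i j => (hB i j).comp measurable_snd)

theorem lintegral_trace_colProj_swap {B : (r × c → ℂ) → Matrix r r ℂ}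
    (hB : ∀ i j, Measurable fun w => B w i j) {E : ℝ → ENNReal} (hE : Measurable E) :
    ∫⁻ z : r × c → ℂ, ∫⁻ w, E (trace ((1 - colProj (toMatrix z)) * B w)).re
        ∂gaussPi (r × c) ∂gaussPi (r × c) =
      ∫⁻ w, ∫⁻ z : r × c → ℂ, E (trace ((1 - colProj (toMatrix z)) * B w)).re
        ∂gaussPi (r × c) ∂gaussPi (r × c) := by
  have h : Measurable (Function.uncurry fun (z : r × c → ℂ) (w : r × c → ℂ) =>
      E (trace ((1 - colProj (toMatrix z)) * B w)).re) :=
    hE.comp (measurable_trace_colProj_prod hB)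
  exact lintegral_lintegral_swap h.aemeasurable

/-- The law of a random column space is unitarily invariant. -/
theorem lintegral_trace_colProj_conj {V : Matrix r r ℂ} (B : Matrix r r ℂ) (hV : Vᴴ * V = 1)
    (hV' : V * Vᴴ = 1) {E : ℝ → ENNReal} (hE : Measurable E) :
    ∫⁻ z : r × c → ℂ, E (trace ((1 - colProj (toMatrix z)) * (V * B * Vᴴ))).re
        ∂gaussPi (r × c) =
      ∫⁻ z : r × c → ℂ, E (trace ((1 - colProj (toMatrix z)) * B)).re ∂gaussPi (r × c) := by
  have hm : Measurable fun z : r × c → ℂ =>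
      E (trace ((1 - colProj (toMatrix z)) * (V * B * Vᴴ))).re :=
    hE.comp (measurable_re_trace (measurable_mul_apply
      (fun i j => (measurable_colProj_apply i j).const_sub ((1 : Matrix r r ℂ) i j))
      fun _ _ => measurable_const))
  rw [← lintegral_gaussPi_leftMul hV hm]
  refine lintegral_congr fun z => ?_
  rw [toMatrix_leftMul, colProj_unitary_mul hV]
  congr 2
  have : (1 - V * colProj (toMatrix z) * Vᴴ) = V * (1 - colProj (toMatrix z)) * Vᴴ := by
    rw [Matrix.mul_sub, Matrix.sub_mul, Matrix.mul_one, hV']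
  rw [this]
  calc trace (V * (1 - colProj (toMatrix z)) * Vᴴ * (V * B * Vᴴ))
      = trace (V * ((1 - colProj (toMatrix z)) * (Vᴴ * V) * B * Vᴴ)) := by
        simp only [Matrix.mul_assoc]
    _ = trace ((1 - colProj (toMatrix z)) * B * (Vᴴ * V)) := by
        rw [trace_mul_comm, hV]
        simp only [Matrix.mul_assoc, Matrix.mul_one, hV]
    _ = _ := by rw [hV, Matrix.mul_one]

theorem integral_conj_mul_gaussPi {ι : Type*} [Fintype ι] [DecidableEq ι] (p q : ι) :
    Integrable (fun z : ι → ℂ => z q * starRingEnd ℂ (z p)) (gaussPi ι) ∧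
      ∫ z, z q * starRingEnd ℂ (z p) ∂gaussPi ι = if q = p then 1 else 0 := by
  set f : MvPolynomial (ι ⊕ ι) ℂ := MvPolynomial.X (Sum.inl q) * MvPolynomial.X (Sum.inr p)
  have e : ∀ z : ι → ℂ, conjEval z f * (Real.exp (-(0 : ℕ) * ∑ i, ‖z i‖ ^ 2) : ℂ) =
      z q * starRingEnd ℂ (z p) := fun z => by
    simp [f, conjEval]
  have h1 := integrable_conjEval 0 f
  have h2 := gaussFunctional_X_mul 0 q (MvPolynomial.X (Sum.inr p))
  rw [MvPolynomial.pderiv_X] at h2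
  have h3 : gaussFunctional ι 0 f = ∫ z, z q * starRingEnd ℂ (z p) ∂gaussPi ι := by
    simp only [gaussFunctional, LinearMap.coe_mk, AddHom.coe_mk, e]
  simp only [e] at h1
  refine ⟨h1, ?_⟩
  rw [← h3]
  simp only [Nat.cast_zero, add_zero, one_mul] at h2
  rw [h2]
  by_cases hqp : q = p
  · subst hqp
    simp [gaussFunctional_one]
  · rw [Pi.single_eq_of_ne (by simpa [eq_comm] using hqp), map_zero, if_neg hqp]

/-- The mean of W†W is `card r` times the identity, because each of its entries is a sum of `card r`
uncorrelated products. -/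
theorem integral_trace_mul_gram (A : Matrix c c ℂ) :
    Integrable (fun w : r × c → ℂ => trace (A * ((toMatrix w)ᴴ * toMatrix w)))
        (gaussPi (r × c)) ∧
      ∫ w, trace (A * ((toMatrix w)ᴴ * toMatrix w)) ∂gaussPi (r × c) =
        Fintype.card r * trace A := by
  have e : ∀ w : r × c → ℂ, trace (A * ((toMatrix w)ᴴ * toMatrix w)) =
      ∑ i, ∑ j, ∑ k, A i j * (w (k, i) * starRingEnd ℂ (w (k, j))) := by
    intro w
    simp only [trace, diag_apply, mul_apply, conjTranspose_apply, toMatrix, of_apply,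
      Finset.mul_sum]
    refine Finset.sum_congr rfl fun i _ => Finset.sum_congr rfl fun j _ =>
      Finset.sum_congr rfl fun k _ => ?_
    rw [mul_comm (w (k, i))]
    rfl
  have hi : ∀ i j k, Integrable (fun w : r × c → ℂ =>
      A i j * (w (k, i) * starRingEnd ℂ (w (k, j)))) (gaussPi (r × c)) := fun i j k =>
    (integral_conj_mul_gaussPi (k, j) (k, i)).1.const_mul _
  simp only [e]
  refine ⟨integrable_finsetSum _ fun i _ => integrable_finsetSum _ fun j _ =>
    integrable_finsetSum _ fun k _ => hi i j k, ?_⟩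
  rw [integral_finsetSum _ fun i _ => integrable_finsetSum _ fun j _ =>
    integrable_finsetSum _ fun k _ => hi i j k]
  simp only [trace, diag_apply, Finset.mul_sum]
  refine Finset.sum_congr rfl fun i _ => ?_
  rw [integral_finsetSum _ fun j _ => integrable_finsetSum _ fun k _ => hi i j k,
    Finset.sum_eq_single i]
  · rw [integral_finsetSum _ fun k _ => hi i i k]
    simp only [integral_const_mul, (integral_conj_mul_gaussPi _ _).2, if_true, mul_one,
      Finset.sum_const, Finset.card_univ, nsmul_eq_mul]
  · intro j _ hji
    rw [integral_finsetSum _ fun k _ => hi i j k]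
    refine Finset.sum_eq_zero fun k _ => ?_
    rw [integral_const_mul, (integral_conj_mul_gaussPi _ _).2, if_neg (by simpa using hji.symm),
      mul_zero]
  · simp

/-- The squared distance of a Gaussian matrix to a fixed subspace is the squared norm of a
Gaussian matrix. -/
theorem lintegral_trace_one_sub_proj (σ : c ⊕ c' ≃ r) {Q : Matrix r c ℂ} (hQ : Qᴴ * Q = 1)
    {F : ℝ → ENNReal} (hF : Measurable F) :
    ∫⁻ w, F (trace ((1 - Q * Qᴴ) * (toMatrix w * (toMatrix w)ᴴ))).re ∂gaussPi (r × c) =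
      ∫⁻ y, F (∑ p, ‖y p‖ ^ 2) ∂gaussPi (c' × c) := by
  obtain ⟨V, hV, hV', hVQ⟩ := exists_unitary_mul_blockIsometry σ hQ
  have hmeas : Measurable fun w : r × c → ℂ => F (∑ p : c' × c, ‖w (σ (.inr p.1), p.2)‖ ^ 2) :=
    hF.comp (by fun_prop)
  have e : ∀ w : r × c → ℂ,
      (trace ((1 - Q * Qᴴ) * (toMatrix w * (toMatrix w)ᴴ))).re =
        ∑ p : c' × c, ‖leftMul Vᴴ w (σ (.inr p.1), p.2)‖ ^ 2 := by
    intro w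
    have h := trace_one_sub_blockIsometry_mul σ (Vᴴ * toMatrix w)
    rw [show (∑ p : c' × c, ‖leftMul Vᴴ w (σ (.inr p.1), p.2)‖ ^ 2) =
      ∑ p : c' × c, ‖(Vᴴ * toMatrix w) (σ (.inr p.1)) p.2‖ ^ 2 from rfl, ← h]
    have hpq : 1 - Q * Qᴴ = V * (1 - blockIsometry σ * (blockIsometry σ)ᴴ) * Vᴴ := by
      rw [Matrix.mul_sub, Matrix.sub_mul, Matrix.mul_one, hV', ← hVQ, conjTranspose_mul]
      simp only [Matrix.mul_assoc]
    rw [hpq, conjTranspose_mul, conjTranspose_conjTranspose, Matrix.mul_assoc, Matrix.mul_assoc,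
      trace_mul_comm V]
    simp only [Matrix.mul_assoc]
  simp only [e]
  rw [lintegral_gaussPi_leftMul (V := Vᴴ) (by rw [conjTranspose_conjTranspose]; exact hV') hmeas]
  -- After the rotation the trace sees only the rows outside the first block; the remaining rows
  -- integrate to one.
  let τ : (c × c) ⊕ (c' × c) ≃ r × c := (Equiv.sumProdDistrib c c' c).symm.trans
    (σ.prodCongr (Equiv.refl c))
  rw [lintegral_pi_sum _ τ hmeas]
  have e2 : ∀ (u : c × c → ℂ) (v : c' × c → ℂ),
      F (∑ p : c' × c, ‖(Sum.elim u v ∘ τ.symm) (σ (.inr p.1), p.2)‖ ^ 2) =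
        F (∑ p, ‖v p‖ ^ 2) := by
    intro u v
    congr 1
    refine Finset.sum_congr rfl fun p _ => ?_
    have : τ.symm (σ (.inr p.1), p.2) = .inr p := by
      rw [Equiv.symm_apply_eq]
      simp [τ]
    simp [this]
  simp only [e2, lintegral_const, measure_univ, mul_one]

variable {φ : ℝ → ℝ}

/-- Replacing a Gaussian matrix by the projection onto its column space increases the mean of a
concave function of its squared distance to an independent random subspace. -/
theorem lintegral_concave_norm_sq_le (σ : c ⊕ c' ≃ r) (hr : 0 < Fintype.card r)
    (hfull : ∀ᵐ z ∂gaussPi (r × c), IsUnit ((toMatrix z)ᴴ * toMatrix z))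
    (hφm : Measurable φ) (hφ : ConcaveOn ℝ (Set.Ici 0) φ) (hφc : ContinuousOn φ (Set.Ici 0))
    (hφ0 : ∀ t, 0 ≤ t → 0 ≤ φ t) {a : ℝ} (hφa : ∀ t, 0 ≤ t → φ t ≤ a * t) :
    ∫⁻ y, ENNReal.ofReal (φ ((∑ p, ‖y p‖ ^ 2) / Fintype.card r)) ∂gaussPi (c' × c) ≤
      ∫⁻ z : r × c → ℂ, ∫⁻ w : r × c → ℂ, ENNReal.ofReal (φ
        (trace ((1 - colProj (toMatrix z)) * colProj (toMatrix w))).re)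
          ∂gaussPi (r × c) ∂gaussPi (r × c) := by
  set n : ℝ := (Fintype.card r : ℝ) with hn
  have hn0 : 0 < n := Nat.cast_pos.2 hr
  set J := blockIsometry σ with hJ
  have hJJ : Jᴴ * J = 1 := conjTranspose_blockIsometry_mul_self σ
  let F : ℝ → ENNReal := fun t => ENNReal.ofReal (φ t)
  have hF : Measurable F := by fun_prop
  let G : ℝ → ENNReal := fun t => F (t / n)
  have hG : Measurable G := by fun_prop
  have hgramM : ∀ i j, Measurable fun w : r × c → ℂ => (toMatrix w * (toMatrix w)ᴴ) i j :=
    measurable_mul_apply measurable_toMatrix_apply measurable_conjTranspose_toMatrix_apply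
  have hJgramM : ∀ i j, Measurable fun w : r × c → ℂ =>
      (J * ((toMatrix w)ᴴ * toMatrix w) * Jᴴ) i j :=
    measurable_mul_apply (measurable_mul_apply (fun _ _ => measurable_const)
      (measurable_mul_apply measurable_conjTranspose_toMatrix_apply measurable_toMatrix_apply))
      fun _ _ => measurable_const
  -- The inner mean is the same for almost every subspace, so averaging over an independent subspace
  -- changes nothing.
  have step1 : ∫⁻ y, F ((∑ p, ‖y p‖ ^ 2) / n) ∂gaussPi (c' × c) =
      ∫⁻ z : r × c → ℂ, ∫⁻ w : r × c → ℂ, G (trace ((1 - colProj (toMatrix z)) *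
        (toMatrix w * (toMatrix w)ᴴ))).re ∂gaussPi (r × c) ∂gaussPi (r × c) := by
    rw [← mul_one (∫⁻ y, F ((∑ p, ‖y p‖ ^ 2) / n) ∂gaussPi (c' × c)),
      ← measure_univ (μ := gaussPi (r × c)), ← lintegral_const]
    refine lintegral_congr_ae ?_
    filter_upwards [hfull] with z hz
    obtain ⟨Q, hQ, hzQ, -⟩ := exists_isometry_of_isUnit hz
    rw [hzQ]
    exact (lintegral_trace_one_sub_proj σ hQ hG).symm
  -- At fixed `w` the isometric factor is absorbed by the unitary invariance of the law of the other
  -- subspace. In this order, independence of the two polar factors of `w` is not needed.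
  have step2 : ∫⁻ z : r × c → ℂ, ∫⁻ w : r × c → ℂ, G (trace ((1 - colProj (toMatrix z)) *
        (toMatrix w * (toMatrix w)ᴴ))).re ∂gaussPi (r × c) ∂gaussPi (r × c) =
      ∫⁻ z : r × c → ℂ, ∫⁻ w : r × c → ℂ, G (trace ((1 - colProj (toMatrix z)) *
        (J * ((toMatrix w)ᴴ * toMatrix w) * Jᴴ))).re ∂gaussPi (r × c) ∂gaussPi (r × c) := by
    rw [lintegral_trace_colProj_swap hgramM hG, lintegral_trace_colProj_swap hJgramM hG]
    refine lintegral_congr_ae ?_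
    filter_upwards [hfull] with w hw
    obtain ⟨Q, hQ, -, hwQ⟩ := exists_isometry_of_isUnit hw
    obtain ⟨V, hV, hV', hVQ⟩ := exists_unitary_mul_blockIsometry σ hQ
    have e : Q * ((toMatrix w)ᴴ * toMatrix w) * Qᴴ =
        V * (J * ((toMatrix w)ᴴ * toMatrix w) * Jᴴ) * Vᴴ := by
      rw [← hVQ, conjTranspose_mul]
      simp only [Matrix.mul_assoc, hJ]
    rw [hwQ, e, lintegral_trace_colProj_conj _ hV hV' hG]
  -- Jensen over `w` at fixed `z`. The division by `n = card r` makes the mean of the Gram matrix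
  -- the identity; the linear bound on `φ` supplies integrability.
  have step3 : ∀ᵐ z ∂gaussPi (r × c), ∫⁻ w : r × c → ℂ, G (trace ((1 - colProj (toMatrix z)) *
        (J * ((toMatrix w)ᴴ * toMatrix w) * Jᴴ))).re ∂gaussPi (r × c) ≤
      F (trace ((1 - colProj (toMatrix z)) * (J * Jᴴ))).re := by
    filter_upwards [hfull] with z hz
    obtain ⟨Q, hQ, hzQ, -⟩ := exists_isometry_of_isUnit hz
    rw [hzQ]
    set X : (r × c → ℂ) → ℝ := fun w =>
      (trace ((1 - Q * Qᴴ) * (J * ((toMatrix w)ᴴ * toMatrix w) * Jᴴ))).re / n with hX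
    have hX0 : ∀ w, 0 ≤ X w := fun w => by
      have := trace_one_sub_proj_mul_nonneg hQ (J * (toMatrix w)ᴴ)
      rw [conjTranspose_mul, conjTranspose_conjTranspose] at this
      have e : J * ((toMatrix w)ᴴ * toMatrix w) * Jᴴ = J * (toMatrix w)ᴴ * (toMatrix w * Jᴴ) := by
        simp only [Matrix.mul_assoc]
      exact div_nonneg (e ▸ this) hn0.le
    obtain ⟨hi, hI⟩ := integral_trace_mul_gram (r := r) (Jᴴ * (1 - Q * Qᴴ) * J)
    have hXe : ∀ w, X w = (trace (Jᴴ * (1 - Q * Qᴴ) * J * ((toMatrix w)ᴴ * toMatrix w))).re / n := by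
      intro w
      simp only [hX]
      rw [← Matrix.mul_assoc, trace_mul_comm _ Jᴴ]
      simp only [Matrix.mul_assoc]
    have hXi : Integrable X (gaussPi (r × c)) := by
      simp only [funext hXe]
      exact hi.re.div_const n
    have hXI : ∫ w, X w ∂gaussPi (r × c) = (trace ((1 - Q * Qᴴ) * (J * Jᴴ))).re := by
      simp only [hXe]
      rw [integral_div]
      have h2 : ∫ w : r × c → ℂ, (trace (Jᴴ * (1 - Q * Qᴴ) * J *
          ((toMatrix w)ᴴ * toMatrix w))).re ∂gaussPi (r × c) =
          (∫ w : r × c → ℂ, trace (Jᴴ * (1 - Q * Qᴴ) * J *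
          ((toMatrix w)ᴴ * toMatrix w)) ∂gaussPi (r × c)).re := integral_re hi
      rw [h2, hI, ← Complex.ofReal_natCast, Complex.re_ofReal_mul, ← hn, mul_div_cancel_left₀ _ hn0.ne',
        Matrix.mul_assoc, trace_mul_comm]
      simp only [Matrix.mul_assoc]
    have hφX : Integrable (fun w => φ (X w)) (gaussPi (r × c)) := by
      refine (hXi.const_mul a).mono' (hφm.comp_aemeasurable hXi.aemeasurable).aestronglyMeasurable
        (.of_forall fun w => ?_)
      rw [Real.norm_of_nonneg (hφ0 _ (hX0 w))]
      exact hφa _ (hX0 w)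
    have := hφ.le_map_integral hφc isClosed_Ici (.of_forall fun w => hX0 w) hXi hφX
    rw [hXI] at this
    calc ∫⁻ w, ENNReal.ofReal (φ (X w)) ∂gaussPi (r × c)
        = ENNReal.ofReal (∫ w, φ (X w) ∂gaussPi (r × c)) :=
          (ofReal_integral_eq_lintegral_ofReal hφX (.of_forall fun w => hφ0 _ (hX0 w))).symm
      _ ≤ _ := ENNReal.ofReal_le_ofReal this
  -- The invariance argument run backwards: the fixed isometry is turned into that of a random
  -- column space.
  have step4 : ∫⁻ z : r × c → ℂ, F (trace ((1 - colProj (toMatrix z)) * (J * Jᴴ))).re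
        ∂gaussPi (r × c) =
      ∫⁻ z : r × c → ℂ, ∫⁻ w : r × c → ℂ, F (trace ((1 - colProj (toMatrix z)) *
        colProj (toMatrix w))).re ∂gaussPi (r × c) ∂gaussPi (r × c) := by
    rw [lintegral_trace_colProj_swap measurable_colProj_apply hF]
    have hconst : ∀ a : ENNReal, a = ∫⁻ _ : r × c → ℂ, a ∂gaussPi (r × c) := fun a => by
      rw [lintegral_const, measure_univ, mul_one]
    refine (hconst _).trans ?_
    refine lintegral_congr_ae ?_
    filter_upwards [hfull] with w hw
    obtain ⟨Q, hQ, hwQ, -⟩ := exists_isometry_of_isUnit hw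
    obtain ⟨V, hV, hV', hVQ⟩ := exists_unitary_mul_blockIsometry σ hQ
    have e : Q * Qᴴ = V * (J * Jᴴ) * Vᴴ := by
      rw [← hVQ, conjTranspose_mul]
      simp only [Matrix.mul_assoc, hJ]
    rw [hwQ, e, lintegral_trace_colProj_conj _ hV hV' hF]
  calc _ = _ := step1
    _ = _ := step2
    _ ≤ _ := lintegral_mono_ae step3
    _ = _ := step4

end Jensen

/-! ### Elementary properties of the rate function -/

section Rate

/-- The rate `M log₂ (1 + (P / M) t)`. -/
noncomputable def rateBound (M : ℕ) (P t : ℝ) : ℝ := M * Real.logb 2 (1 + P / M * t)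

variable {M : ℕ} {P : ℝ}

theorem measurable_rateBound : Measurable (rateBound M P) := by
  unfold rateBound Real.logb
  fun_prop

theorem one_le_one_add (hP : 0 ≤ P) {t : ℝ} (ht : 0 ≤ t) : 1 ≤ 1 + P / M * t := by
  have : 0 ≤ P / M * t := by positivity
  linarith

theorem rateBound_nonneg (hP : 0 ≤ P) {t : ℝ} (ht : 0 ≤ t) : 0 ≤ rateBound M P t :=
  mul_nonneg (Nat.cast_nonneg _) (Real.logb_nonneg one_lt_two (one_le_one_add hP ht))

theorem rateBound_mono (hP : 0 ≤ P) {s t : ℝ} (hs : 0 ≤ s) (hst : s ≤ t) :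
    rateBound M P s ≤ rateBound M P t := by
  refine mul_le_mul_of_nonneg_left ?_ (Nat.cast_nonneg _)
  refine Real.logb_le_logb_of_le one_lt_two (by linarith [one_le_one_add (M := M) hP hs]) ?_
  gcongr

theorem continuousOn_rateBound (hP : 0 ≤ P) : ContinuousOn (rateBound M P) (Set.Ici 0) := by
  intro t ht
  have h1 : (1 + P / M * t) ≠ 0 := by linarith [one_le_one_add (M := M) hP ht]
  unfold rateBound Real.logb
  exact ((((continuous_const.add (continuous_const.mul continuous_id)).continuousAt.log
    h1).div_const _).const_mul _).continuousWithinAt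

theorem concaveOn_rateBound (hP : 0 ≤ P) : ConcaveOn ℝ (Set.Ici 0) (rateBound M P) := by
  refine ⟨convex_Ici 0, fun x hx y hy a b ha hb hab => ?_⟩
  have hx1 := one_le_one_add (M := M) hP hx
  have hy1 := one_le_one_add (M := M) hP hy
  have h := strictConcaveOn_log_Ioi.concaveOn.2 (show 1 + P / M * x ∈ Set.Ioi 0 from by
    simp only [Set.mem_Ioi]; linarith) (show 1 + P / M * y ∈ Set.Ioi 0 from by
    simp only [Set.mem_Ioi]; linarith) ha hb hab
  have e : a • (1 + P / M * x) + b • (1 + P / M * y) = 1 + P / M * (a • x + b • y) := by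
    simp only [smul_eq_mul]
    linear_combination hab
  rw [e] at h
  simp only [smul_eq_mul] at h ⊢
  simp only [rateBound, Real.logb]
  have hM : (0 : ℝ) ≤ M / Real.log 2 := div_nonneg (Nat.cast_nonneg _) (Real.log_nonneg one_le_two)
  calc _ = M / Real.log 2 * (a * Real.log (1 + P / M * x) + b * Real.log (1 + P / M * y)) := by ring
    _ ≤ M / Real.log 2 * Real.log (1 + P / M * (a * x + b * y)) := by gcongr
    _ = _ := by ring

theorem rateBound_le_mul (hM : 0 < M) (hP : 0 ≤ P) {t : ℝ} (ht : 0 ≤ t) :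
    rateBound M P t ≤ P / Real.log 2 * t := by
  have h1 := one_le_one_add (M := M) hP ht
  have h2 := Real.log_le_sub_one_of_pos (show 0 < 1 + P / M * t by linarith)
  have hM' : (0 : ℝ) < M := Nat.cast_pos.2 hM
  have h3 : (0 : ℝ) ≤ M / Real.log 2 := div_nonneg hM'.le (Real.log_nonneg one_le_two)
  calc rateBound M P t = M / Real.log 2 * Real.log (1 + P / M * t) := by
        rw [rateBound, Real.logb]; ring
    _ ≤ M / Real.log 2 * (1 + P / M * t - 1) := by gcongr
    _ = _ := by field_simp; ring

end Rate

/-! ### The minimal rate and its bound by the weakest eigenvalues -/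

section PostProcessing

variable {n : Type*} [Fintype n] {M : ℕ} {P : ℝ}

/-- The admissible postprocessing matrices. -/
def coisometries (M N : ℕ) : Set (Matrix (Fin M) (Fin N) ℂ) := {F | F * Fᴴ = 1}

theorem isCompact_coisometries (M N : ℕ) : IsCompact (coisometries M N) := by
  have hK : IsCompact (Set.univ.pi fun _ : Fin M => Set.univ.pi fun _ : Fin N =>
      Metric.closedBall (0 : ℂ) 1) :=
    isCompact_univ_pi fun _ => isCompact_univ_pi fun _ => isCompact_closedBall 0 1
  have hc : Continuous fun F : Matrix (Fin M) (Fin N) ℂ => F * Fᴴ :=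
    continuous_id.matrix_mul continuous_id.matrix_conjTranspose
  refine hK.of_isClosed_subset (isClosed_eq hc continuous_const) ?_
  intro (F : Matrix (Fin M) (Fin N) ℂ) hF i _ j _
  have h1 : (F * Fᴴ) i i = 1 := by rw [show F * Fᴴ = 1 from hF]; simp
  have h2 : ∑ k, ‖F i k‖ ^ 2 = 1 := by
    refine Complex.ofReal_injective ?_
    rw [Complex.ofReal_one, ← h1, mul_apply]
    push_cast
    exact Finset.sum_congr rfl fun k _ => (Complex.mul_conj' _).symm
  have h3 : ‖F i j‖ ^ 2 ≤ 1 :=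
    h2 ▸ Finset.single_le_sum (f := fun k => ‖F i k‖ ^ 2) (fun k _ => by positivity)
      (Finset.mem_univ j)
  simpa using (sq_le_one_iff₀ (norm_nonneg _)).1 h3

open scoped ComplexOrder in
theorem one_le_re_det_one_add {m : Type*} [Fintype m] [DecidableEq m] {A : Matrix m m ℂ}
    (hA : A.PosSemidef) {t : ℝ} (ht : 0 ≤ t) : 1 ≤ (det (1 + (t : ℂ) • A)).re := by
  set U : Matrix m m ℂ := ↑hA.1.eigenvectorUnitary with hU
  have hUU' : U * Uᴴ = 1 := by
    simpa [star_eq_conjTranspose] using Unitary.coe_mul_star_self hA.1.eigenvectorUnitary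
  have hAU : A = U * diagonal (fun i => (hA.1.eigenvalues i : ℂ)) * Uᴴ :=
    eq_unitary_conj_diagonal hA.1
  have h1 : 1 + (t : ℂ) • A =
      U * (1 + (t : ℂ) • diagonal (fun i => (hA.1.eigenvalues i : ℂ))) * Uᴴ := by
    conv_lhs => rw [hAU]
    rw [Matrix.mul_add, Matrix.add_mul, Matrix.mul_one, hUU', Matrix.mul_smul, Matrix.smul_mul]
  have h2 : det (1 + (t : ℂ) • A) = ∏ i, ((1 + t * hA.1.eigenvalues i : ℝ) : ℂ) := by
    rw [h1, det_mul, det_mul, mul_right_comm, ← det_mul, hUU', det_one, one_mul,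
      ← diagonal_smul, ← diagonal_one, diagonal_add, det_diagonal]
    simp
  rw [h2, ← Complex.ofReal_prod, Complex.ofReal_re]
  refine (Finset.prod_const_one (s := (Finset.univ : Finset m))).symm.trans_le ?_
  refine Finset.prod_le_prod (fun _ _ => zero_le_one) fun i _ => ?_
  have := mul_nonneg ht (hA.eigenvalues_nonneg i)
  linarith

/-- The rate loss as a function of the joint interference channel. -/
noncomputable def jointRate (P : ℝ) (z : Fin (2 * M) × n → ℂ)
    (F : Matrix (Fin M) (Fin (2 * M)) ℂ) : ℝ :=
  Real.logb 2 (det (1 + ((P / M : ℝ) : ℂ) • (F * (toMatrix z * (toMatrix z)ᴴ) * Fᴴ))).re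

open scoped ComplexOrder in
theorem one_le_re_det_jointRate (hP : 0 ≤ P) (z : Fin (2 * M) × n → ℂ)
    (F : Matrix (Fin M) (Fin (2 * M)) ℂ) :
    1 ≤ (det (1 + ((P / M : ℝ) : ℂ) • (F * (toMatrix z * (toMatrix z)ᴴ) * Fᴴ))).re :=
  one_le_re_det_one_add
    ((posSemidef_self_mul_conjTranspose (toMatrix z)).mul_mul_conjTranspose_same F) (by positivity)

theorem jointRate_nonneg (hP : 0 ≤ P) (z : Fin (2 * M) × n → ℂ)
    (F : Matrix (Fin M) (Fin (2 * M)) ℂ) : 0 ≤ jointRate P z F :=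
  Real.logb_nonneg one_lt_two (one_le_re_det_jointRate hP z F)

theorem continuous_jointRate (hP : 0 ≤ P) :
    Continuous fun p : (Fin (2 * M) × n → ℂ) × Matrix (Fin M) (Fin (2 * M)) ℂ =>
      jointRate P p.1 p.2 := by
  have hz : Continuous fun p : (Fin (2 * M) × n → ℂ) × Matrix (Fin M) (Fin (2 * M)) ℂ =>
      toMatrix p.1 :=
    continuous_matrix fun i j => (continuous_apply (i, j)).comp continuous_fst
  have h1 : Continuous fun p : (Fin (2 * M) × n → ℂ) × Matrix (Fin M) (Fin (2 * M)) ℂ =>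
      1 + ((P / M : ℝ) : ℂ) • (p.2 * (toMatrix p.1 * (toMatrix p.1)ᴴ) * p.2ᴴ) :=
    continuous_const.add (((continuous_snd.matrix_mul
      (hz.matrix_mul hz.matrix_conjTranspose)).matrix_mul
        continuous_snd.matrix_conjTranspose).const_smul ((P / M : ℝ) : ℂ))
  unfold jointRate Real.logb
  refine Continuous.div_const (Continuous.log (Complex.continuous_re.comp h1.matrix_det) ?_) _
  intro p
  exact (zero_lt_one.trans_le (one_le_re_det_jointRate hP p.1 p.2)).ne'

/-- The smallest rate loss of one user. -/
noncomputable def minRate (P : ℝ) (z : Fin (2 * M) × n → ℂ) : ℝ :=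
  sInf (jointRate P z '' coisometries M (2 * M))

/-- An infimum over a compact set of a jointly continuous function is continuous; this gives
measurability of the minimal rate. -/
theorem continuous_minRate (hP : 0 ≤ P) :
    Continuous (minRate (M := M) (n := n) P) :=
  (isCompact_coisometries M (2 * M)).continuous_sInf (continuous_jointRate hP)

theorem coisometries_nonempty (M : ℕ) : (coisometries M (2 * M)).Nonempty := by
  let σ : Fin M ⊕ Fin M ≃ Fin (2 * M) := finSumFinEquiv.trans (finCongr (two_mul M).symm)
  refine ⟨(blockIsometry σ)ᴴ, ?_⟩
  change _ * _ = _
  rw [conjTranspose_conjTranspose, conjTranspose_blockIsometry_mul_self]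

theorem isLeast_minRate (hP : 0 ≤ P) (z : Fin (2 * M) × n → ℂ) :
    IsLeast (jointRate P z '' coisometries M (2 * M)) (minRate P z) := by
  have hc : Continuous fun F : Matrix (Fin M) (Fin (2 * M)) ℂ => jointRate P z F :=
    (continuous_jointRate hP).comp (f := fun F : Matrix (Fin M) (Fin (2 * M)) ℂ => (z, F))
      (Continuous.prodMk_right z)
  exact ((isCompact_coisometries M (2 * M)).image hc).isLeast_sInf
    ((coisometries_nonempty M).image _)

theorem minRate_nonneg (hP : 0 ≤ P) (z : Fin (2 * M) × n → ℂ) : 0 ≤ minRate P z := by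
  obtain ⟨F, -, hF⟩ := (isLeast_minRate hP z).1
  exact hF ▸ jointRate_nonneg hP z F

open scoped ComplexOrder in
/-- Projecting onto the weakest eigenvectors bounds the smallest rate loss. -/
theorem minRate_le (hM : 0 < M) (hP : 0 ≤ P) (z : Fin (2 * M) × n → ℂ) :
    minRate P z ≤ rateBound M P (lowSum M (gramEigs (Equiv.refl _) z) / M) := by
  set A := toMatrix z * (toMatrix z)ᴴ with hA
  have hAp : A.PosSemidef := posSemidef_self_mul_conjTranspose (toMatrix z)
  set lam : Fin (2 * M) → ℝ := (isHermitian_mul_conjTranspose_self (toMatrix z)).eigenvalues with hl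
  have hl0 : ∀ i, 0 ≤ lam i := hAp.eigenvalues_nonneg
  set U : Matrix (Fin (2 * M)) (Fin (2 * M)) ℂ :=
    ↑(isHermitian_mul_conjTranspose_self (toMatrix z)).eigenvectorUnitary with hU
  have hUU : Uᴴ * U = 1 := by
    simpa [star_eq_conjTranspose] using Unitary.coe_star_mul_self
      (isHermitian_mul_conjTranspose_self (toMatrix z)).eigenvectorUnitary
  have hAU : A = U * diagonal (fun i => (lam i : ℂ)) * Uᴴ :=
    eq_unitary_conj_diagonal (isHermitian_mul_conjTranspose_self (toMatrix z))
  -- The same sorting permutation as in `sortChamber`, so that the chosen eigenvalues are literally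
  -- the terms of `lowSum`.
  set τ := Tuple.sort fun i => max (lam i) 0 with hτ
  set ι : Fin M → Fin (2 * M) := fun i => τ (Fin.castLE (by omega) i) with hι
  have hinj : Function.Injective ι := τ.injective.comp (Fin.castLE_injective _)
  set F : Matrix (Fin M) (Fin (2 * M)) ℂ := Uᴴ.submatrix ι id with hF
  have hFX : ∀ X : Matrix (Fin (2 * M)) (Fin (2 * M)) ℂ,
      F * X * Fᴴ = (Uᴴ * X * U).submatrix ι ι := by
    intro X
    ext i j
    simp [hF, mul_apply]
  have hF1 : F * Fᴴ = 1 := by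
    have := hFX 1
    rwa [Matrix.mul_one, Matrix.mul_one, hUU, submatrix_one _ hinj] at this
  have hFA : F * A * Fᴴ = diagonal fun i => (lam (ι i) : ℂ) := by
    rw [hFX, hAU]
    have : Uᴴ * (U * diagonal (fun i => (lam i : ℂ)) * Uᴴ) * U =
        (Uᴴ * U) * diagonal (fun i => (lam i : ℂ)) * (Uᴴ * U) := by
      simp only [Matrix.mul_assoc]
    rw [this, hUU, Matrix.one_mul, Matrix.mul_one, submatrix_diagonal _ _ hinj]
    rfl
  have hM' : (0 : ℝ) < M := Nat.cast_pos.2 hM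
  have hrate : jointRate P z F = ∑ i, (M : ℝ)⁻¹ • rateBound M P (lam (ι i)) := by
    have hdet : det (1 + ((P / M : ℝ) : ℂ) • (F * A * Fᴴ)) =
        ((∏ i, (1 + P / M * lam (ι i)) : ℝ) : ℂ) := by
      rw [hFA, ← diagonal_smul, ← diagonal_one, diagonal_add, det_diagonal]
      simp
    rw [jointRate, ← hA, hdet, Complex.ofReal_re, Real.logb, Real.log_prod]
    · rw [Finset.sum_div]
      refine Finset.sum_congr rfl fun i _ => ?_
      rw [rateBound, smul_eq_mul, inv_mul_cancel_left₀ hM'.ne']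
      rfl
    · intro i _
      have := one_le_one_add (M := M) hP (hl0 (ι i))
      linarith
  have hlow : lowSum M (gramEigs (Equiv.refl _) z) = ∑ i, lam (ι i) := by
    have hy : ∀ i, (gramEigs (Equiv.refl _) z).1 i = lam (τ i) := fun i =>
      max_eq_left (hl0 _)
    rw [lowSum]
    simp only [hy]
    have : (Finset.univ.filter fun i : Fin (2 * M) => i.1 < M) =
        Finset.univ.map (Fin.castLEEmb (show M ≤ 2 * M by omega)) := by
      ext i
      simp only [Finset.mem_filter, Finset.mem_univ, true_and, Finset.mem_map]
      exact ⟨fun h => ⟨⟨i, h⟩, rfl⟩, by rintro ⟨j, rfl⟩; exact j.2⟩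
    rw [this, Finset.sum_map]
    rfl
  have hJ := (concaveOn_rateBound (M := M) hP).le_map_sum (t := Finset.univ)
    (w := fun _ : Fin M => (M : ℝ)⁻¹) (p := fun i => lam (ι i)) (fun _ _ => by positivity)
    (by simp [hM'.ne']) (fun i _ => hl0 _)
  calc minRate P z ≤ jointRate P z F := (isLeast_minRate hP z).2 ⟨F, hF1, rfl⟩
    _ = _ := hrate
    _ ≤ _ := hJ
    _ = _ := by
      rw [hlow, ← Finset.smul_sum, smul_eq_mul, inv_mul_eq_div]

end PostProcessing

/-! ### Chordal distance as a trace of projections -/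

section Chordal

variable {M N : ℕ}

theorem exists_eq_mul_of_colSpan_le {A Q : Matrix (Fin N) (Fin M) ℂ} (h : colSpan A ≤ colSpan Q) :
    ∃ T : Matrix (Fin M) (Fin M) ℂ, A = Q * T := by
  have hcol : ∀ j, ∃ t : Fin M → ℂ,
      ∑ i, t i • (WithLp.toLp 2 fun r => Q r i : EuclideanSpace ℂ (Fin N)) =
        WithLp.toLp 2 fun r => A r j := fun j =>
    (Submodule.mem_span_range_iff_exists_fun ℂ).1 (h (Submodule.subset_span ⟨j, rfl⟩))
  choose t ht using hcol
  refine ⟨Matrix.of fun i j => t j i, ?_⟩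
  ext r j
  have := congrArg (fun v : EuclideanSpace ℂ (Fin N) => v r) (ht j)
  simp only [WithLp.ofLp_sum, WithLp.ofLp_smul, Finset.sum_apply, Pi.smul_apply,
    smul_eq_mul] at this
  rw [← this, mul_apply]
  exact Finset.sum_congr rfl fun i _ => mul_comm _ _

/-- Equal spans give `A = Q T` and `Q = A S`, and orthonormality of `Q` forces `T S = 1`. So the
existence of a generator with this number of columns already implies full column rank. -/
theorem IsGenerator.isUnit_and_colProj_eq {A Q : Matrix (Fin N) (Fin M) ℂ}
    (h : IsGenerator Q (colSpan A)) : IsUnit (Aᴴ * A) ∧ colProj A = Q * Qᴴ := by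
  obtain ⟨hQ, hspan⟩ := h
  obtain ⟨T, hT⟩ := exists_eq_mul_of_colSpan_le hspan.ge
  obtain ⟨S, hS⟩ := exists_eq_mul_of_colSpan_le hspan.le
  have hTS : T * S = 1 := by
    calc T * S = (Qᴴ * Q) * T * S := by rw [hQ, Matrix.one_mul]
      _ = Qᴴ * (Q * T * S) := by simp only [Matrix.mul_assoc]
      _ = 1 := by rw [← hT, ← hS, hQ]
  have hST : S * T = 1 := mul_eq_one_comm.1 hTS
  have hAA : Aᴴ * A = Tᴴ * T := by
    rw [hT, conjTranspose_mul, Matrix.mul_assoc, ← Matrix.mul_assoc Qᴴ, hQ, Matrix.one_mul]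
  have hinv : Aᴴ * A * (S * Sᴴ) = 1 := by
    calc Aᴴ * A * (S * Sᴴ) = Tᴴ * (T * S) * Sᴴ := by rw [hAA]; simp only [Matrix.mul_assoc]
      _ = (S * T)ᴴ := by rw [hTS, Matrix.mul_one, conjTranspose_mul]
      _ = 1 := by rw [hST, conjTranspose_one]
  refine ⟨IsUnit.of_mul_eq_one _ hinv, ?_⟩
  rw [colProj, Matrix.inv_eq_right_inv hinv]
  calc A * (S * Sᴴ) * Aᴴ = (A * S) * (A * S)ᴴ := by
        rw [conjTranspose_mul]; simp only [Matrix.mul_assoc]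
    _ = _ := by rw [← hS]

theorem inner_toLp_col (Q R : Matrix (Fin N) (Fin M) ℂ) (i j : Fin M) :
    inner ℂ (WithLp.toLp 2 fun r => Q r i : EuclideanSpace ℂ (Fin N))
      (WithLp.toLp 2 fun r => R r j) = (Qᴴ * R) i j := by
  rw [mul_apply, PiLp.inner_apply]
  simp [mul_comm]

theorem trace_one_sub_mul_eq {Q R : Matrix (Fin N) (Fin M) ℂ} (hR : Rᴴ * R = 1) :
    (trace ((1 - Q * Qᴴ) * (R * Rᴴ))).re = M - ∑ i, ∑ j, ‖(Qᴴ * R) i j‖ ^ 2 := by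
  rw [← re_trace_mul_conjTranspose, Matrix.sub_mul, Matrix.one_mul, trace_sub, Complex.sub_re,
    trace_mul_comm R, hR, conjTranspose_mul, conjTranspose_conjTranspose, Matrix.mul_assoc Q,
    trace_mul_comm Q]
  simp [Matrix.mul_assoc]

/-- The sum of the squared cosines is the squared Frobenius norm of the matrix of inner products of
any two orthonormal bases: principal vectors make this matrix diagonal up to phases, and its norm
does not depend on the bases. -/
theorem chordalDist_sq_eq {Q R : Matrix (Fin N) (Fin M) ℂ} (hQ : Qᴴ * Q = 1) (hR : Rᴴ * R = 1) :
    chordalDist M (colSpan Q) (colSpan R) ^ 2 = (trace ((1 - Q * Qᴴ) * (R * Rᴴ))).re := by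
  have horth : ∀ X : Matrix (Fin N) (Fin M) ℂ, Xᴴ * X = 1 →
      Orthonormal ℂ fun i => (WithLp.toLp 2 fun r => X r i : EuclideanSpace ℂ (Fin N)) := by
    intro X hX
    rw [orthonormal_iff_ite]
    intro i j
    rw [inner_toLp_col, hX, one_apply]
  have hrank : ∀ X : Matrix (Fin N) (Fin M) ℂ, Xᴴ * X = 1 →
      Module.finrank ℂ (colSpan X) = M := by
    intro X hX
    rw [colSpan, finrank_span_eq_card (horth X hX).linearIndependent, Fintype.card_fin]
  have hmem : ∀ (X : Matrix (Fin N) (Fin M) ℂ) (i : Fin M),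
      (WithLp.toLp 2 fun r => X r i : EuclideanSpace ℂ (Fin N)) ∈ colSpan X :=
    fun X i => Submodule.subset_span ⟨i, rfl⟩
  obtain ⟨θ, hθ⟩ := exists_principalAngles M _ _ (hrank Q hQ) (hrank R hR)
  rw [chordalDist_eq (hrank Q hQ) (hrank R hR) hθ,
    Real.sq_sqrt (Finset.sum_nonneg fun _ _ => sq_nonneg _), trace_one_sub_mul_eq hR]
  obtain ⟨a, b, h⟩ := hθ
  have hc : ∑ m, Real.cos (θ m) ^ 2 = ∑ i, ∑ j, ‖(Qᴴ * R) i j‖ ^ 2 := by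
    simp only [← inner_toLp_col]
    rw [h.sum_cos_sq, Finset.sum_comm,
      Finset.sum_congr rfl fun j _ => sum_sq_norm_inner_eq (hrank Q hQ) h.left_orthonormal
        (horth Q hQ) h.left_mem (hmem Q) (b j), Finset.sum_comm]
    refine Finset.sum_congr rfl fun i _ => ?_
    have := sum_sq_norm_inner_eq (hrank R hR) h.symm.left_orthonormal (horth R hR) h.right_mem
      (hmem R) (WithLp.toLp 2 fun r => Q r i : EuclideanSpace ℂ (Fin N))
    simpa only [norm_inner_symm] using this
  simp only [Real.sin_sq, Finset.sum_sub_distrib, hc]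
  simp

end Chordal

/-! ### Comparison for a single user -/

section OneUser

variable {M : ℕ} {P : ℝ}

/-- The first block of columns. -/
def leftBlock (z : Fin (2 * M) × (Fin M ⊕ Fin M) → ℂ) : Fin (2 * M) × Fin M → ℂ :=
  fun p => z (p.1, .inl p.2)

/-- The second block of columns. -/
def rightBlock (z : Fin (2 * M) × (Fin M ⊕ Fin M) → ℂ) : Fin (2 * M) × Fin M → ℂ :=
  fun p => z (p.1, .inr p.2)

/-- The squared chordal distance of the two column spaces, where both blocks have full rank. -/
noncomputable def blockDist (z : Fin (2 * M) × (Fin M ⊕ Fin M) → ℂ) : ℝ :=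
  (trace ((1 - colProj (toMatrix (leftBlock z))) * colProj (toMatrix (rightBlock z)))).re

theorem measurable_blockDist : Measurable (blockDist (M := M)) := by
  have hl : Measurable (leftBlock (M := M)) := measurable_pi_lambda _ fun p => measurable_pi_apply _
  have hr : Measurable (rightBlock (M := M)) :=
    measurable_pi_lambda _ fun p => measurable_pi_apply _
  exact measurable_re_trace (measurable_mul_apply
    (fun i j => ((measurable_colProj_apply i j).comp hl).const_sub
      ((1 : Matrix (Fin (2 * M)) (Fin (2 * M)) ℂ) i j))
    fun i j => (measurable_colProj_apply i j).comp hr)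

/-- The intermediary is half the squared norm of an M × M Gaussian matrix. Monotonicity of `φ` is
used for the stochastic domination, concavity for Jensen. -/
theorem lintegral_lowSum_le_blockDist (hM : 0 < M)
    (hfull : ∀ᵐ z ∂gaussPi (Fin (2 * M) × Fin M), IsUnit ((toMatrix z)ᴴ * toMatrix z))
    {φ : ℝ → ℝ} (hφm : Measurable φ) (hφ : ConcaveOn ℝ (Set.Ici 0) φ)
    (hφc : ContinuousOn φ (Set.Ici 0)) (hφmono : MonotoneOn φ (Set.Ici 0))
    (hφ0 : ∀ t, 0 ≤ t → 0 ≤ φ t) {a : ℝ} (hφa : ∀ t, 0 ≤ t → φ t ≤ a * t) :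
    ∫⁻ z, ENNReal.ofReal (φ (lowSum M (gramEigs (Equiv.refl _) z) / M))
        ∂gaussPi (Fin (2 * M) × (Fin M ⊕ Fin M)) ≤
      ∫⁻ z, ENNReal.ofReal (φ (blockDist z)) ∂gaussPi (Fin (2 * M) × (Fin M ⊕ Fin M)) := by
  have hM' : (0 : ℝ) < M := Nat.cast_pos.2 hM
  -- `φ` is monotone only on the half-line, whereas the domination wants a monotone function on all
  -- reals; the sums in question are nonnegative, so the truncation is invisible.
  let F : ℝ → ENNReal := fun s => ENNReal.ofReal (φ (max s 0 / M))
  have hFm : Measurable F := by fun_prop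
  have hFmono : Monotone F := fun s t hst => ENNReal.ofReal_le_ofReal
    (hφmono (show (0 : ℝ) ≤ _ by positivity) (show (0 : ℝ) ≤ _ by positivity) (by gcongr))
  have hF : ∀ s, 0 ≤ s → F s = ENNReal.ofReal (φ (s / M)) := fun s hs => by
    simp only [F, max_eq_left hs]
  let σ : Fin M ⊕ Fin M ≃ Fin (2 * M) := finSumFinEquiv.trans (finCongr (two_mul M).symm)
  have h1 := lintegral_lowSum_gramEigs_le (n := Fin M ⊕ Fin M) hM (Equiv.refl (Fin (2 * M)))
    (by simp [two_mul]) hFm hFmono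
  have h2 := lintegral_concave_norm_sq_le σ (by simpa using hM) hfull hφm hφ hφc hφ0 hφa
  have hmeas : Measurable fun z : Fin (2 * M) × (Fin M ⊕ Fin M) → ℂ =>
    ENNReal.ofReal (φ (blockDist z)) := (hφm.comp measurable_blockDist).ennreal_ofReal
  have e1 : ∀ z : Fin (2 * M) × (Fin M ⊕ Fin M) → ℂ,
      F (lowSum M (gramEigs (Equiv.refl _) z)) =
        ENNReal.ofReal (φ (lowSum M (gramEigs (Equiv.refl _) z) / M)) := fun z =>
    hF _ (Finset.sum_nonneg fun i _ => (gramEigs (Equiv.refl _) z).2.2 i)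
  have e2 : ∀ y : Fin M × Fin M → ℂ, F (1 / 2 * ∑ p, ‖y p‖ ^ 2) =
      ENNReal.ofReal (φ ((∑ p, ‖y p‖ ^ 2) / Fintype.card (Fin (2 * M)))) := fun y => by
    rw [hF _ (by positivity)]
    congr 2
    simp only [Fintype.card_fin]
    push_cast
    field_simp
  rw [lintegral_pi_sum _ (Equiv.prodSumDistrib (Fin (2 * M)) (Fin M) (Fin M)).symm hmeas]
  simp only [e1, e2] at h1
  exact h1.trans h2

/-- Capping a concave nondecreasing function at a constant keeps it concave and nondecreasing, so
every truncation level is covered by the same comparison. -/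
theorem lintegral_min_minRate_le (hM : 0 < M) (hP : 0 ≤ P)
    (hfull : ∀ᵐ z ∂gaussPi (Fin (2 * M) × Fin M), IsUnit ((toMatrix z)ᴴ * toMatrix z))
    (b : ENNReal) :
    ∫⁻ z, min (ENNReal.ofReal (minRate P z)) b ∂gaussPi (Fin (2 * M) × (Fin M ⊕ Fin M)) ≤
      ∫⁻ z, min (ENNReal.ofReal (rateBound M P (blockDist z))) b
        ∂gaussPi (Fin (2 * M) × (Fin M ⊕ Fin M)) := by
  refine (lintegral_mono fun z => min_le_min_right b
    (ENNReal.ofReal_le_ofReal (minRate_le hM hP z))).trans ?_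
  induction b with
  | top =>
    simp only [le_top, min_eq_left]
    exact lintegral_lowSum_le_blockDist hM hfull measurable_rateBound (concaveOn_rateBound hP)
      (continuousOn_rateBound hP) (fun s hs t _ hst => rateBound_mono hP hs hst)
      (fun t ht => rateBound_nonneg hP ht) (fun t ht => rateBound_le_mul hM hP ht)
  | coe b =>
    have e : ∀ t : ℝ, min (ENNReal.ofReal t) b = ENNReal.ofReal (min t b) := fun t => by
      rw [ENNReal.ofReal_min, ENNReal.ofReal_coe_nnreal]
    simp only [e]
    exact lintegral_lowSum_le_blockDist hM hfull
      (φ := fun t => min (rateBound M P t) b) (measurable_rateBound.min measurable_const)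
      ((concaveOn_rateBound hP).inf (concaveOn_const _ (convex_Ici 0)))
      ((continuousOn_rateBound hP).inf continuousOn_const)
      (fun s hs t _ hst => min_le_min_right _ (rateBound_mono hP hs hst))
      (fun t ht => le_min (rateBound_nonneg hP ht) b.2)
      (fun t ht => (min_le_left _ _).trans (rateBound_le_mul hM hP ht))

end OneUser

/-! ### Minima over independent users -/

section Users

theorem iInf_fin_succ {α : Type*} [CompleteLattice α] {K : ℕ} (f : Fin (K + 1) → α) :
    ⨅ k, f k = f 0 ⊓ ⨅ k : Fin K, f k.succ :=
  le_antisymm (le_inf (iInf_le _ _) (le_iInf fun _ => iInf_le _ _))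
    (le_iInf fun k => Fin.cases inf_le_left (fun j => inf_le_right.trans (iInf_le _ j)) k)

variable {α : Type*} [MeasurableSpace α]

theorem lintegral_pi_fin_succ (ν : Measure α) [SigmaFinite ν] {K : ℕ}
    {g : α × (Fin K → α) → ENNReal} (hg : Measurable g) :
    ∫⁻ z, g (z 0, fun k => z k.succ) ∂(Measure.pi fun _ : Fin (K + 1) => ν) =
      ∫⁻ x, ∫⁻ y, g (x, y) ∂(Measure.pi fun _ : Fin K => ν) ∂ν := by
  rw [← lintegral_prod _ hg.aemeasurable]
  exact (measurePreserving_piFinSuccAbove (fun _ : Fin (K + 1) => ν) 0).lintegral_comp hg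

/-- If truncated means compare at every level, so do the means of minima of independent copies. -/
theorem lintegral_min_iInf_le {ν : Measure α} [IsProbabilityMeasure ν] {X D : α → ENNReal}
    (hX : Measurable X) (hD : Measurable D)
    (h : ∀ b, ∫⁻ x, min (X x) b ∂ν ≤ ∫⁻ x, min (D x) b ∂ν) (K : ℕ) (b : ENNReal) :
    ∫⁻ z, min (⨅ k, X (z k)) b ∂(Measure.pi fun _ : Fin K => ν) ≤
      ∫⁻ z, min (⨅ k, D (z k)) b ∂(Measure.pi fun _ : Fin K => ν) := by
  induction K generalizing b with
  | zero => simp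
  | succ K ih =>
    have hXi : Measurable fun y : Fin K → α => ⨅ k, X (y k) :=
      .iInf fun k => hX.comp (measurable_pi_apply k)
    have hDi : Measurable fun y : Fin K → α => ⨅ k, D (y k) :=
      .iInf fun k => hD.comp (measurable_pi_apply k)
    have hXX : Measurable fun p : α × (Fin K → α) => min (min (X p.1) (⨅ k, X (p.2 k))) b :=
      ((hX.comp measurable_fst).min (hXi.comp measurable_snd)).min measurable_const
    have hDX : Measurable fun p : α × (Fin K → α) => min (min (D p.1) (⨅ k, X (p.2 k))) b :=
      ((hD.comp measurable_fst).min (hXi.comp measurable_snd)).min measurable_const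
    have hDD : Measurable fun p : α × (Fin K → α) => min (min (D p.1) (⨅ k, D (p.2 k))) b :=
      ((hD.comp measurable_fst).min (hDi.comp measurable_snd)).min measurable_const
    have e1 := lintegral_pi_fin_succ ν hXX
    have e2 := lintegral_pi_fin_succ ν hDD
    simp only [iInf_fin_succ]
    refine e1.le.trans (le_trans ?_ e2.ge)
    -- With the other users fixed, their minimum together with `b` is just another truncation level
    -- for the first user. After the first user has been exchanged, it is in turn part of the level
    -- in the induction hypothesis, which therefore needs `b` arbitrary.
    calc ∫⁻ x, ∫⁻ y, min (min (X x) (⨅ k, X (y k))) b ∂(Measure.pi fun _ : Fin K => ν) ∂ν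
        = ∫⁻ y, ∫⁻ x, min (min (X x) (⨅ k, X (y k))) b ∂ν ∂(Measure.pi fun _ : Fin K => ν) :=
          lintegral_lintegral_swap hXX.aemeasurable
      _ ≤ ∫⁻ y, ∫⁻ x, min (min (D x) (⨅ k, X (y k))) b ∂ν ∂(Measure.pi fun _ : Fin K => ν) := by
          refine lintegral_mono fun y => ?_
          simp only [min_assoc]
          exact h _
      _ = ∫⁻ x, ∫⁻ y, min (min (D x) (⨅ k, X (y k))) b ∂(Measure.pi fun _ : Fin K => ν) ∂ν :=
          (lintegral_lintegral_swap hDX.aemeasurable).symm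
      _ ≤ _ := by
          refine lintegral_mono fun x => ?_
          simp only [min_comm (D x), min_assoc]
          exact ih _

theorem map_curry_pi {ι κ : Type*} [Fintype ι] [Fintype κ] (ν : Measure α) [SigmaFinite ν] :
    (Measure.pi fun _ : ι × κ => ν).map Function.curry =
      Measure.pi fun _ : ι => Measure.pi fun _ : κ => ν := by
  have h : Measure.pi (fun _ : ι × κ => ν) =
      (Measure.pi fun _ : ι => Measure.pi fun _ : κ => ν).map (MeasurableEquiv.curry ι κ α).symm := by
    refine Measure.pi_eq fun s hs => ?_
    rw [MeasurableEquiv.map_apply]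
    have : (MeasurableEquiv.curry ι κ α).symm ⁻¹' (Set.univ.pi s) =
        Set.univ.pi fun i => Set.univ.pi fun j => s (i, j) := by
      ext f
      simp only [Set.mem_preimage, Set.mem_pi, Set.mem_univ, forall_true_left, Prod.forall]
      rfl
    rw [this, Measure.pi_pi, Fintype.prod_prod_type]
    simp only [Measure.pi_pi]
  rw [h, ← MeasurableEquiv.coe_curry, MeasurableEquiv.map_map_symm]

end Users

/-! ### Transfer to the given channel -/

section Channel

variable {M : ℕ}

/-- The entries of the two interfering channels, side by side. -/
def interference (H : Fin 3 → Matrix (Fin (2 * M)) (Fin M) ℂ) :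
    Fin (2 * M) × (Fin M ⊕ Fin M) → ℂ :=
  fun p => Sum.elim (H 1 p.1) (H 2 p.1) p.2

theorem rateLoss_eq_jointRate (P : ℝ) (F : Matrix (Fin M) (Fin (2 * M)) ℂ)
    (H : Fin 3 → Matrix (Fin (2 * M)) (Fin M) ℂ) :
    rateLoss P F H = jointRate P (interference H) F := by
  have h : toMatrix (interference H) * (toMatrix (interference H))ᴴ =
      H 1 * (H 1)ᴴ + H 2 * (H 2)ᴴ := by
    ext i j
    simp [mul_apply, toMatrix, interference, Fintype.sum_sum_type]
  rw [rateLoss, jointRate, h, Finset.sum_pair (by decide), Matrix.mul_add, Matrix.add_mul]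
  simp only [Matrix.mul_assoc]

theorem isLeast_rateLossValues {K : ℕ} (hK : 0 < K) {P : ℝ} (hP : 0 ≤ P)
    (H : Fin K → Fin 3 → Matrix (Fin (2 * M)) (Fin M) ℂ) :
    IsLeast (rateLossValues P H) (⨅ k, minRate P (interference (H k))) := by
  have : Nonempty (Fin K) := ⟨⟨0, hK⟩⟩
  constructor
  · obtain ⟨k, hk⟩ := exists_eq_ciInf_of_finite (f := fun k => minRate P (interference (H k)))
    obtain ⟨F, hF, hFk⟩ := (isLeast_minRate hP (interference (H k))).1
    exact ⟨k, F, hF, by rw [rateLoss_eq_jointRate, hFk, hk]⟩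
  · rintro x ⟨k, F, hF, rfl⟩
    rw [rateLoss_eq_jointRate]
    exact (ciInf_le (Set.finite_range _).bddBelow k).trans
      ((isLeast_minRate hP (interference (H k))).2 ⟨F, hF, rfl⟩)

variable {Ω : Type*} [MeasurableSpace Ω] {μ : Measure Ω} {K : ℕ}
  {H : Fin K → Fin 3 → Ω → Matrix (Fin (2 * M)) (Fin M) ℂ}

theorem IsIIDGaussianChannel.hasLaw_of_injective (hH : IsIIDGaussianChannel μ H) {ι : Type*}
    [Fintype ι] {q : ι → Fin K × Fin 3 × Fin (2 * M) × Fin M} (hq : Function.Injective q) :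
    HasLaw (fun ω i => H (q i).1 (q i).2.1 ω (q i).2.2.1 (q i).2.2.2) (gaussPi ι) μ :=
  (hH.indep.precomp hq).hasLaw_pi fun _ => hH.hasLaw _ _ _ _

theorem IsIIDGaussianChannel.hasLaw_interference (hH : IsIIDGaussianChannel μ H) :
    HasLaw (fun ω k => interference fun i => H k i ω)
      (Measure.pi fun _ : Fin K => gaussPi (Fin (2 * M) × (Fin M ⊕ Fin M))) μ := by
  let q : Fin K × Fin (2 * M) × (Fin M ⊕ Fin M) → Fin K × Fin 3 × Fin (2 * M) × Fin M :=
    fun p => Sum.elim (fun j => (p.1, 1, p.2.1, j)) (fun j => (p.1, 2, p.2.1, j)) p.2.2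
  have hq : Function.Injective q := by
    rintro ⟨k, r, j | j⟩ ⟨k', r', j' | j'⟩ h <;> simp_all [q]
  have h := hH.hasLaw_of_injective hq
  have e : (fun ω k => interference fun i => H k i ω) =
      Function.curry ∘ fun ω p => H (q p).1 (q p).2.1 ω (q p).2.2.1 (q p).2.2.2 := by
    funext ω k p
    obtain ⟨r, j | j⟩ := p <;> rfl
  have hm : Measurable (Function.curry : (Fin K × Fin (2 * M) × (Fin M ⊕ Fin M) → ℂ) → _) :=
    (MeasurableEquiv.curry (Fin K) (Fin (2 * M) × (Fin M ⊕ Fin M)) ℂ).measurable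
  rw [e]
  refine ⟨hm.comp_aemeasurable h.aemeasurable, ?_⟩
  rw [← AEMeasurable.map_map_of_aemeasurable hm.aemeasurable h.aemeasurable, h.map_eq,
    map_curry_pi]

/-- A Gaussian channel matrix has full rank as soon as its column space admits a generator
matrix. -/
theorem IsIIDGaussianChannel.ae_isUnit (hH : IsIIDGaussianChannel μ H) (k : Fin K) (i : Fin 3)
    {Q : Ω → Matrix (Fin (2 * M)) (Fin M) ℂ}
    (hQ : ∀ᵐ ω ∂μ, IsGenerator (Q ω) (colSpan (H k i ω))) :
    ∀ᵐ z ∂gaussPi (Fin (2 * M) × Fin M), IsUnit ((toMatrix z)ᴴ * toMatrix z) := by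
  have h := hH.hasLaw_of_injective (q := fun p : Fin (2 * M) × Fin M => (k, i, p.1, p.2))
    fun p p' h => by simpa [Prod.ext_iff] using h
  have hc : Continuous fun z : Fin (2 * M) × Fin M → ℂ => toMatrix z :=
    continuous_matrix fun i j => continuous_apply (i, j)
  have hd : Continuous fun z : Fin (2 * M) × Fin M → ℂ => det ((toMatrix z)ᴴ * toMatrix z) :=
    (hc.matrix_conjTranspose.matrix_mul hc).matrix_det
  have hset : MeasurableSet {z : Fin (2 * M) × Fin M → ℂ |
      IsUnit ((toMatrix z)ᴴ * toMatrix z)} := by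
    simp only [Matrix.isUnit_iff_isUnit_det, isUnit_iff_ne_zero]
    exact (isOpen_ne_fun hd continuous_const).measurableSet
  rw [← h.map_eq, ae_map_iff h.aemeasurable hset]
  filter_upwards [hQ] with ω hω
  exact hω.isUnit_and_colProj_eq.1

theorem chordalDist_sq_eq_blockDist {H Q : Fin 3 → Matrix (Fin (2 * M)) (Fin M) ℂ}
    (h1 : IsGenerator (Q 1) (colSpan (H 1))) (h2 : IsGenerator (Q 2) (colSpan (H 2))) :
    chordalDist M (colSpan (Q 1)) (colSpan (Q 2)) ^ 2 = blockDist (interference H) := by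
  rw [chordalDist_sq_eq h1.1 h2.1, ← h1.isUnit_and_colProj_eq.2, ← h2.isUnit_and_colProj_eq.2]
  rfl

end Channel

/-! ### The main theorem -/

theorem lemma3 {Ω : Type*} [MeasurableSpace Ω] (μ : Measure Ω) [IsProbabilityMeasure μ]
    (K M : ℕ) (hK : 0 < K) (hM : 0 < M) (P : ℝ) (hP : 0 ≤ P)
    (H : Fin K → Fin 3 → Ω → Matrix (Fin (2 * M)) (Fin M) ℂ)
    (hH : IsIIDGaussianChannel μ H)
    (Ht : Fin K → Fin 3 → Ω → Matrix (Fin (2 * M)) (Fin M) ℂ)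
    (hHt : ∀ k, ∀ i ∈ ({1, 2} : Finset (Fin 3)),
      ∀ᵐ ω ∂μ, IsGenerator (Ht k i ω) (colSpan (H k i ω))) :
    (∀ ω, IsLeast (rateLossValues P fun k i => H k i ω)
      (sInf (rateLossValues P fun k i => H k i ω))) ∧
    Integrable (fun ω => sInf (rateLossValues P fun k i => H k i ω)) μ ∧
    Integrable (fun ω => ⨅ k : Fin K, (M : ℝ) * Real.logb 2
      (1 + P / M * chordalDist M (colSpan (Ht k 1 ω)) (colSpan (Ht k 2 ω)) ^ 2)) μ ∧
    ∫ ω, sInf (rateLossValues P fun k i => H k i ω) ∂μ ≤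
      ∫ ω, (⨅ k : Fin K, (M : ℝ) * Real.logb 2
        (1 + P / M * chordalDist M (colSpan (Ht k 1 ω)) (colSpan (Ht k 2 ω)) ^ 2)) ∂μ := by
  have : Nonempty (Fin K) := ⟨⟨0, hK⟩⟩
  have hleast := fun ω => isLeast_rateLossValues hK hP fun k i => H k i ω
  have hsInf : ∀ ω, sInf (rateLossValues P fun k i => H k i ω) =
      ⨅ k, minRate P (interference fun i => H k i ω) := fun ω => (hleast ω).csInf_eq
  -- One channel matrix is enough, as the conclusion concerns only the common Gaussian law.
  have hfull := hH.ae_isUnit ⟨0, hK⟩ 1 (hHt ⟨0, hK⟩ 1 (by simp))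
  have hlaw := hH.hasLaw_interference
  set d : Ω → Fin K → ℝ := fun ω k => blockDist (interference fun i => H k i ω) with hd
  have hgen : ∀ᵐ ω ∂μ, ∀ k, IsGenerator (Ht k 1 ω) (colSpan (H k 1 ω)) ∧
      IsGenerator (Ht k 2 ω) (colSpan (H k 2 ω)) := ae_all_iff.2 fun k =>
    (hHt k 1 (by simp)).and (hHt k 2 (by simp))
  have hdist : ∀ᵐ ω ∂μ, ∀ k,
      chordalDist M (colSpan (Ht k 1 ω)) (colSpan (Ht k 2 ω)) ^ 2 = d ω k := by
    filter_upwards [hgen] with ω hω k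
    exact chordalDist_sq_eq_blockDist (H := fun i => H k i ω) (Q := fun i => Ht k i ω)
      (hω k).1 (hω k).2
  have hd0 : ∀ᵐ ω ∂μ, ∀ k, 0 ≤ d ω k ∧ d ω k ≤ M := by
    filter_upwards [hgen, hdist] with ω hω hdω k
    refine ⟨hdω k ▸ sq_nonneg _, ?_⟩
    rw [← hdω k, chordalDist_sq_eq (hω k).1.1 (hω k).2.1, trace_one_sub_mul_eq (hω k).2.1]
    have : 0 ≤ ∑ i, ∑ j, ‖((Ht k 1 ω)ᴴ * Ht k 2 ω) i j‖ ^ 2 := by positivity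
    linarith
  have hRe : (fun ω => ⨅ k : Fin K, (M : ℝ) * Real.logb 2
      (1 + P / M * chordalDist M (colSpan (Ht k 1 ω)) (colSpan (Ht k 2 ω)) ^ 2)) =ᵐ[μ]
      fun ω => ⨅ k, rateBound M P (d ω k) := by
    filter_upwards [hdist] with ω hω
    simp only [hω, rateBound]
  have hXm : Measurable fun z : Fin K → Fin (2 * M) × (Fin M ⊕ Fin M) → ℂ =>
      ⨅ k, minRate P (z k) :=
    .iInf fun k => (continuous_minRate hP).measurable.comp (measurable_pi_apply k)
  have hDm : Measurable fun z : Fin K → Fin (2 * M) × (Fin M ⊕ Fin M) → ℂ =>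
      ⨅ k, rateBound M P (blockDist (z k)) :=
    .iInf fun k => (measurable_rateBound.comp measurable_blockDist).comp (measurable_pi_apply k)
  have hX : AEMeasurable (fun ω => ⨅ k, minRate P (interference fun i => H k i ω)) μ :=
    hXm.comp_aemeasurable hlaw.aemeasurable
  have hD : AEMeasurable (fun ω => ⨅ k, rateBound M P (d ω k)) μ :=
    hDm.comp_aemeasurable hlaw.aemeasurable
  have hX0 : ∀ ω, 0 ≤ ⨅ k, minRate P (interference fun i => H k i ω) := fun ω =>
    le_ciInf fun k => minRate_nonneg hP _
  have hD0 : ∀ᵐ ω ∂μ, 0 ≤ ⨅ k, rateBound M P (d ω k) := by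
    filter_upwards [hd0] with ω hω
    exact le_ciInf fun k => rateBound_nonneg hP (hω k).1
  -- The squared chordal distance lies between 0 and `M`, so this side is bounded.
  have hDint : Integrable (fun ω => ⨅ k, rateBound M P (d ω k)) μ := by
    refine .of_bound hD.aestronglyMeasurable (rateBound M P M) ?_
    filter_upwards [hd0, hD0] with ω hω h0
    rw [Real.norm_of_nonneg h0]
    exact (ciInf_le (Set.finite_range _).bddBelow ⟨0, hK⟩).trans
      (rateBound_mono hP (hω _).1 (hω _).2)
  have hle : ∫⁻ ω, ENNReal.ofReal (⨅ k, minRate P (interference fun i => H k i ω)) ∂μ ≤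
      ∫⁻ ω, ENNReal.ofReal (⨅ k, rateBound M P (d ω k)) ∂μ := by
    have h := lintegral_min_iInf_le
      ((continuous_minRate (M := M) (n := Fin M ⊕ Fin M) hP).measurable.ennreal_ofReal)
      ((measurable_rateBound (M := M) (P := P)).comp measurable_blockDist).ennreal_ofReal
      (lintegral_min_minRate_le hM hP hfull) K ⊤
    simp only [le_top, min_eq_left, ← ENNReal.ofReal_iInf, Function.comp_apply] at h
    rwa [← hlaw.lintegral_comp hXm.ennreal_ofReal.aemeasurable,
      ← hlaw.lintegral_comp hDm.ennreal_ofReal.aemeasurable] at h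
  have hfin : ∫⁻ ω, ENNReal.ofReal (⨅ k, rateBound M P (d ω k)) ∂μ < ⊤ :=
    (hasFiniteIntegral_iff_ofReal hD0).1 hDint.2
  -- Finiteness of the left expectation is inherited from the right one through the inequality for
  -- lower integrals.
  have hXint : Integrable (fun ω => ⨅ k, minRate P (interference fun i => H k i ω)) μ :=
    ⟨hX.aestronglyMeasurable,
      (hasFiniteIntegral_iff_ofReal (.of_forall hX0)).2 (hle.trans_lt hfin)⟩
  refine ⟨fun ω => hsInf ω ▸ hleast ω, ?_, hDint.congr hRe.symm, ?_⟩
  · simpa only [hsInf] using hXint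
  · rw [integral_congr_ae hRe]
    simp only [hsInf]
    rw [integral_eq_lintegral_of_nonneg_ae (.of_forall hX0) hX.aestronglyMeasurable,
      integral_eq_lintegral_of_nonneg_ae hD0 hD.aestronglyMeasurable]
    exact ENNReal.toReal_mono hfin.ne hle
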